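/- **Setting.** There are $M\ge 1$ synchronous agents with $K$ actions each. At every time step agent $m$ receives independently a pair $(x,r)\sim\mathcal D_m$, with context $x\in\mathcal X_m$ and reward vector $r\in[0,1]^K$, chooses an action $a$ and observes $r(a)$; put $\mu_m(x,a)=\mathbb E[r(a)\mid x]$ and $\mathrm{Reg}(T)=\mathbb E\sum_{m}\sum_{t\le T}\big[\max_{a}\mu_m(x_{m,t},a)-\mu_m(x_{m,t},a_{m,t})\big]$. Let $d\ge 1$, let $f_\omega$, $\omega\in\mathbb R^d$, be predictors $f_\omega(x_m,a_m)\in\mathbb R$, let $W\subseteq\mathbb R^d$ be a convex set of admissible parameters, $\mathcal F=\{f_\omega:\omega\in W\}$, and let $\ell_m(\cdot\,;\cdot)$ be loss functions (everything measurable, the losses integrable, $\omega\mapsto \ell_m(f_\omega(x,a);r)$ differentiable). For a dataset $\mathcal S$ with $n$ samples $(x_m^i,a_m^i,r_m^i)$, $r_m^i\in[0,1]$, per agent let $\widehat{\mathcal L}_m(\omega;\mathcal S)=\frac1n\sum_i\ell_m(f_\omega(x_m^i,a_m^i);r_m^i)$, $\widehat{\mathcal L}=\frac1M\sum_m\widehat{\mathcal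 L}_m$, and $$\mathfrak R(\mathcal F;n)=\sup\ \mathbb E_{\mathcal S,\sigma}\Big[\sup_{\omega\in W}\frac1{Mn}\sum_{m}\sum_{i\le n}\sigma_{m,i}\,\ell_m(f_\omega(x_m^i,a_m^i);r_m^i)\Big],$$ where $\sigma_{m,i}$ are independent Rademacher signs and the outer supremum is over all laws of $\mathcal S$ obtained from independent samples $(x,r)\sim\mathcal D'_m$, $a\sim p_m(\cdot\mid x)$ with arbitrary action selection distributions $p_m$ and $(\mathcal D'_m)_m$ in a given class of possible environments that contains $(\mathcal D_m)_m$. **FedIGW.** Epoch $l\ge1$ has length $E^l\ge 1$; $\tau^l=\sum_{j\le l}E^j$, $l(T)=\min\{l:T\le\tau^l\}$, $\mathfrak R^l=\mathfrak R(\mathcal F;E^l)$. In epoch $l$ all agents play inverse gap weighting with the predictor $\widehat f^l$ ($\widehat f^1=0$) and learning rate $\gamma^l$: with $\widehat a\in\arg\max_a\widehat f^l(x,a)$, an action $a\ne\widehat a$ has probability $1/(K+\gamma^l(\widehat f^l(x,\widehat a)-\widehat f^l(x,a)))$ and $\widehat a$ has the remaining probability. Then a federated learning protocol is run on the data of epoch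 $l$ from an initial model $\omega^0$; its output $\widehat\omega^l$ gives $\widehat f^{l+1}=f_{\widehat\omega^l}$. Here $\gamma^l=\sqrt{K\mu_f/\mathfrak R^{l-1}}$ for $l\ge2$. The protocol is FedAvg or SCAFFOLD with all agents participating, with $\rho^l$ communication rounds (global aggregations) and $\kappa^l\ge1$ local updates per round, each using one uniformly drawn local sample. From the global model $x$, agent $m$ sets $y_m\leftarrow x$ and makes $\kappa^l$ steps $y_m\leftarrow y_m-\eta_\ell(g_m(y_m)+v_m)$, $g_m$ being the stochastic gradient; then $x\leftarrow x+\frac{\eta_g}{M}\sum_m(y_m-x)$. For FedAvg $v_m=0$. For SCAFFOLD $v_m=\bar c-c_m$, $\bar c=\frac1M\sum_mc_m$, with control variates $c_m$, initially $0$, updated by $c_m\leftarrow c_m-\bar c+(x-y_m)/(\kappa^l\eta_\ell)$ ($x$ the global model at the start of the round). The output is a weighted average of the global models $x^0,\dots,x^{\rho^l}$. **Assumptions.** (i) $z\mapsto\ell_m(z;r)$ is $\mu_f$-strongly convex, $\mu_f>0$, for all $m$ and $r\in[0,1]$. (ii) There is $\omega^*\in W$ such that, for all $m$ and $a$ and almost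 every context $x$, $f_{\omega^*}(x,a)=\mu_m(x,a)$ and $\mathbb E[\ell_m(f_{\omega^*}(x,a);r(a))\mid x]=\inf_{y\in\mathbb R}\mathbb E[\ell_m(y;r(a))\mid x]$. (iii) $0<\mathfrak R^l<\infty$ for $1\le l\le l(T)$, and $\gamma^l$ is nondecreasing on $2\le l\le l(T)$. (iv) For all datasets with $E^l$ samples per agent, $1\le l\le l(T)$: each $\widehat{\mathcal L}_m(\cdot;\mathcal S)$ is $\mu_\omega$-strongly convex and $\beta_\omega$-smooth on $\mathbb R^d$ ($\mu_\omega,\beta_\omega>0$); for $\omega\in W$ the stochastic gradients of each agent have variance at most $\sigma_b^2$; and, for FedAvg only, $\frac1M\sum_m\|\nabla\widehat{\mathcal L}_m(\omega;\mathcal S)\|^2\le G_b^2$ for $\omega\in W$. (v) For all these datasets, with $\omega^*_{\mathcal S}=\arg\min_{\omega\in\mathbb R^d}\widehat{\mathcal L}(\omega;\mathcal S)$: $\|\omega^0-\omega^*_{\mathcal S}\|^2\le\Delta^2$ for FedAvg, and $\|\omega^0-\omega^*_{\mathcal S}\|^2+\frac1{2M\beta_\omega^2}\sum_m\|\nabla\widehat{\mathcal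 L}_m(\omega^*_{\mathcal S};\mathcal S)\|^2\le\Delta^2$ for SCAFFOLD. (vi) Whenever $\eta_\ell>0$, $\eta_g\ge1$ and $C\beta_\omega\kappa^l\eta_g\eta_\ell\le1$, all local and global iterates of the protocol on these datasets stay in $W$. **Statement.** There is a universal constant $C>0$, the same as in (vi), such that under (i)–(vi) one can choose for each epoch a number of rounds $\rho^l$, step sizes as in (vi) and averaging weights for which $$\mathrm{Reg}(T)\le C\Big(ME^1+\sum_{l=2}^{l(T)}\sqrt{K\mathfrak R^{l-1}/\mu_f}\;ME^l\Big)$$ and the total number of communication rounds satisfies $$\sum_{l=1}^{l(T)}\rho^l\le C\sum_{l=1}^{l(T)}\Big(\frac{\beta_\omega}{\mu_\omega}+\frac{\sigma_b^2}{\mu_\omega\mathfrak R^l\kappa^lM}+\sqrt{\frac{\beta_\omega G_b^2}{\mu_\omega^2\mathfrak R^l}}\Big)\log\Big(2+\frac{\mu_\omega\Delta^2}{\mathfrak R^l}\Big)\quad\text{(FedAvg)},$$ $$\sum_{l=1}^{l(T)}\rho^l\le C\sum_{l=1}^{l(T)}\Big(\frac{\beta_\omega}{\mu_\omega}+\frac{\sigma_b^2}{\mu_\omega\mathfrak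 R^l\kappa^lM}\Big)\log\Big(2+\frac{\mu_\omega\Delta^2}{\mathfrak R^l}\Big)\quad\text{(SCAFFOLD)}.$$ -/

import Mathlib

open MeasureTheory ProbabilityTheory
open scoped ENNReal Gradient

namespace FedIGW

noncomputable section

/-! ### Environments and data -/

/-- Parameters `ω ∈ ℝ^d` with the Euclidean norm. -/
abbrev Param (d : ℕ) := EuclideanSpace ℝ (Fin d)

/-- An environment: for each agent `m` the joint law `𝒟_m` of a context and a reward vector in
`[0,1]^K`. The `K` actions of each agent are enumerated by `Fin K`; the context spaces may differ
from agent to agent. -/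
abbrev Env {M : ℕ} (K : ℕ) (X : Fin M → Type*) [∀ m, MeasurableSpace (X m)] :=
  ∀ m, ProbabilityMeasure (X m × (Fin K → unitInterval))

/-- An observed triple `(x, a, r(a))`. -/
abbrev Sample (K : ℕ) (Y : Type*) := Y × Fin K × unitInterval

/-- A dataset `𝒮_{[M]}` with `n` samples per agent. -/
abbrev Dataset {M : ℕ} (K n : ℕ) (X : Fin M → Type*) := ∀ m, Fin n → Sample K (X m)

/-- A predictor: one reward estimate for each agent, context and action. -/
abbrev Predictor {M : ℕ} (K : ℕ) (X : Fin M → Type*) := ∀ m, X m → Fin K → ℝ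

/-- The conditional law of the reward vector of agent `m` given the context `x`. -/
def rewardLaw {M K : ℕ} {X : Fin M → Type*} [∀ m, MeasurableSpace (X m)]
    (D : Env K X) (m : Fin M) (x : X m) : Measure (Fin K → unitInterval) :=
  (D m : Measure (X m × (Fin K → unitInterval))).condKernel x

/-- The marginal law of the context of agent `m`. -/
def contextLaw {M K : ℕ} {X : Fin M → Type*} [∀ m, MeasurableSpace (X m)]
    (D : Env K X) (m : Fin M) : Measure (X m) :=
  (D m : Measure (X m × (Fin K → unitInterval))).fst

/-- The mean reward `μ_m(x, a) = 𝔼[r(a) | x]`. -/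
def meanReward {M K : ℕ} {X : Fin M → Type*} [∀ m, MeasurableSpace (X m)]
    (D : Env K X) (m : Fin M) (x : X m) (a : Fin K) : ℝ :=
  ∫ r, (r a : ℝ) ∂(rewardLaw D m x)

/-- `p(a | x)` is an action selection distribution, measurable in the context. -/
structure IsActionRule {K : ℕ} {Y : Type*} [MeasurableSpace Y] (p : Y → Fin K → ℝ) : Prop where
  measurable : ∀ a, Measurable fun x => p x a
  nonneg : ∀ x a, 0 ≤ p x a
  sum_eq_one : ∀ x, ∑ a, p x a = 1

/-- The law of `(x, a, r(a))` when `(x, r) ∼ P` and `a ∼ p(· | x)`, with `a` and `r` conditionally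
independent given `x`. -/
def sampleLaw {K : ℕ} {Y : Type*} [MeasurableSpace Y] (P : Measure (Y × (Fin K → unitInterval)))
    (p : Y → Fin K → ℝ) : Measure (Sample K Y) :=
  ∑ a, (P.withDensity fun z => ENNReal.ofReal (p z.1 a)).map fun z => (z.1, a, z.2 a)

/-- The law of a dataset with `n` independent samples per agent, agent `m` using the action
selection distribution `p m`. -/
def dataLaw {M K : ℕ} {X : Fin M → Type*} [∀ m, MeasurableSpace (X m)] (n : ℕ)
    (D : Env K X) (p : Predictor K X) : Measure (Dataset K n X) :=
  Measure.pi fun m => Measure.pi fun _ : Fin n =>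
    sampleLaw (D m : Measure (X m × (Fin K → unitInterval))) (p m)

/-! ### The parameterized function class and the empirical losses -/

/-- The function class `{f_ω : ω ∈ W}` with the loss functions `ℓ_m(z₁; z₂)` of the agents. -/
structure Model {M : ℕ} (K d : ℕ) (X : Fin M → Type*) where
  f : Param d → Predictor K X
  loss : Fin M → ℝ → ℝ → ℝ
  W : Set (Param d)

section Losses

variable {M K d : ℕ} {X : Fin M → Type*} (P : Model K d X)

/-- `ℓ_m(f_ω(x, a); r)` as a function of `ω`. -/
def sampleLoss (m : Fin M) (z : Sample K (X m)) (ω : Param d) : ℝ :=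
  P.loss m (P.f ω m z.1 z.2.1) z.2.2

/-- The empirical local loss of agent `m`. -/
def localLoss {n : ℕ} (S : Dataset K n X) (m : Fin M) (ω : Param d) : ℝ :=
  (1 / (n : ℝ)) * ∑ i, sampleLoss P m (S m i) ω

/-- The empirical global loss; all agents have the same number of samples. -/
def globalLoss {n : ℕ} (S : Dataset K n X) (ω : Param d) : ℝ :=
  (1 / (M : ℝ)) * ∑ m, localLoss P S m ω

/-- `ω` is the empirical optimal parameter `ω*_𝒮`. -/
def IsEmpiricalOptimum {n : ℕ} (S : Dataset K n X) (ω : Param d) : Prop :=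
  ∀ ω', globalLoss P S ω ≤ globalLoss P S ω'

/-! ### Rademacher complexity -/

/-- The supremum over `ω ∈ W` of `(1 / (M n)) ∑_m ∑_i σ_{m,i} ℓ_m(f_ω(x_{m,i}, a_{m,i}); r_{m,i})`,
possibly `⊤`. -/
def signedSup {n : ℕ} (S : Dataset K n X) (σ : Fin M → Fin n → ℤˣ) : EReal :=
  ⨆ ω ∈ P.W, (((1 / ((M : ℝ) * n)) *
    ∑ m, ∑ i, ((σ m i : ℤ) : ℝ) * sampleLoss P m (S m i) ω : ℝ) : EReal)

/-- The average of `signedSup` over independent uniform signs. The terms of `σ` and `-σ` have a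
nonnegative sum when `W` is nonempty, so that `EReal.toENNReal` loses nothing. -/
def empiricalRademacher {n : ℕ} (S : Dataset K n X) : ℝ≥0∞ :=
  (∑ σ : Fin M → Fin n → ℤˣ, signedSup P S σ).toENNReal / 2 ^ (M * n)

/-- The Rademacher complexity `ℜ(ℱ; {n : m ∈ [M]})`: the supremum of the expected empirical
complexity over the possible distributions of the dataset, given by the environments in the class
`𝓔` and by arbitrary action selection distributions. -/
def rademacher [∀ m, MeasurableSpace (X m)] (𝓔 : Set (Env K X)) (n : ℕ) : ℝ≥0∞ :=
  ⨆ D ∈ 𝓔, ⨆ p : Predictor K X, ⨆ _ : ∀ m, IsActionRule (p m),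
    ∫⁻ S, empiricalRademacher P S ∂(dataLaw n D p)

/-! ### Regularity of the empirical problem -/

/-- For every dataset with `n` samples per agent, the local empirical losses are `μ`-strongly
convex and `β`-smooth on `ℝ^d`, and on `W` the stochastic gradients (one uniformly drawn local
sample) have variance at most `σ²`. -/
structure IsRegular (n : ℕ) (μ β σ : ℝ) : Prop where
  strongConvex : ∀ (S : Dataset K n X) m, StrongConvexOn Set.univ μ (localLoss P S m)
  smooth : ∀ (S : Dataset K n X) m (ω ω' : Param d),
    localLoss P S m ω' - localLoss P S m ω ≤
      inner ℝ (∇ (localLoss P S m) ω) (ω' - ω) + β / 2 * ‖ω' - ω‖ ^ 2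
  variance : ∀ (S : Dataset K n X) m, ∀ ω ∈ P.W,
    (1 / (n : ℝ)) * ∑ i, ‖∇ (sampleLoss P m (S m i)) ω - ∇ (localLoss P S m) ω‖ ^ 2 ≤ σ ^ 2

/-- For every dataset with `n` samples per agent, the gradients have `G`-bounded dissimilarity
on `W`. -/
def HasBoundedDissimilarity (n : ℕ) (G : ℝ) : Prop :=
  ∀ S : Dataset K n X, ∀ ω ∈ P.W,
    (1 / (M : ℝ)) * ∑ m, ‖∇ (localLoss P S m) ω‖ ^ 2 ≤ G ^ 2

end Losses

/-! ### FedAvg and SCAFFOLD -/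

/-- The two federated learning protocols. -/
inductive Protocol
  | fedAvg
  | scaffold

/-- The tuning of one call: local and global step sizes, the number `rounds` of communication
rounds (global aggregations), the number `steps` of local updates per round, and the weights with
which the global models `x⁰, …, x^rounds` are averaged into the output. -/
structure Tuning where
  ηl : ℝ
  ηg : ℝ
  rounds : ℕ
  steps : ℕ
  weight : ℕ → ℝ

/-- The correction added to the local gradient of agent `m` when the control variates are `c`. -/
def correction {M d : ℕ} : Protocol → (Fin M → Param d) → Fin M → Param d
  | .fedAvg, _, _ => 0
  | .scaffold, c, m => (1 / (M : ℝ)) • ∑ m', c m' - c m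

/-- `k` local (corrected) gradient steps from `x`, where `g k` is the stochastic gradient at local
step `k`. -/
def localSteps {d : ℕ} (η : ℝ) (g : ℕ → Param d → Param d) (v x : Param d) : ℕ → Param d
  | 0 => x
  | k + 1 => localSteps η g v x k - η • (g k (localSteps η g v x k) + v)

section Protocols

variable {M K d : ℕ} {X : Fin M → Type*} (P : Model K d X) (proto : Protocol)

/-- The stochastic gradient of agent `m` in round `r` at local step `k`, for the sampled indices
`ξ`. -/
def stochGrad {n : ℕ} (S : Dataset K n X) (ξ : Fin M × ℕ × ℕ → Fin n) (m : Fin M) (r k : ℕ)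
    (ω : Param d) : Param d :=
  ∇ (sampleLoss P m (S m (ξ (m, r, k)))) ω

/-- The global model and the local control variates after `r` rounds, from the initial model `ω₀`
and zero control variates. All agents take part in each round. (FedAvg never reads the control
variates.) -/
def serverState {n : ℕ} (S : Dataset K n X) (ξ : Fin M × ℕ × ℕ → Fin n) (ηl ηg : ℝ) (κ : ℕ)
    (ω₀ : Param d) : ℕ → Param d × (Fin M → Param d)
  | 0 => (ω₀, fun _ => 0)
  | r + 1 =>
    let x := (serverState S ξ ηl ηg κ ω₀ r).1
    let c := (serverState S ξ ηl ηg κ ω₀ r).2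
    let y := fun m => localSteps ηl (stochGrad P S ξ m r) (correction proto c m) x κ
    (x + (ηg / (M : ℝ)) • ∑ m, (y m - x),
      fun m => c m - (1 / (M : ℝ)) • ∑ m', c m' + (1 / ((κ : ℝ) * ηl)) • (x - y m))

/-- The model of agent `m` after `k` local steps of round `r`. -/
def localIterate {n : ℕ} (S : Dataset K n X) (ξ : Fin M × ℕ × ℕ → Fin n) (ηl ηg : ℝ) (κ : ℕ)
    (ω₀ : Param d) (m : Fin M) (r k : ℕ) : Param d :=
  localSteps ηl (stochGrad P S ξ m r)
    (correction proto (serverState P proto S ξ ηl ηg κ ω₀ r).2 m)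
    (serverState P proto S ξ ηl ηg κ ω₀ r).1 k

/-- The output `ω̂_𝒮` of the protocol. -/
def output {n : ℕ} (h : Tuning) (ω₀ : Param d) (S : Dataset K n X)
    (ξ : Fin M × ℕ × ℕ → Fin n) : Param d :=
  ∑ r ∈ Finset.range (h.rounds + 1),
    h.weight r • (serverState P proto S ξ h.ηl h.ηg h.steps ω₀ r).1

/-- The local sample indices are independent and uniform. -/
def seedLaw (M n : ℕ) : Measure (Fin M × ℕ × ℕ → Fin n) :=
  Measure.infinitePi fun _ => uniformOn Set.univ

/-- For step sizes `ηl, ηg`, all (local and global) iterates of the protocol stay in `W`,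
whatever the dataset with `n` samples per agent and the sampled indices. -/
def StaysIn (n κ : ℕ) (ηl ηg : ℝ) (ω₀ : Param d) : Prop :=
  ∀ (S : Dataset K n X) (ξ : Fin M × ℕ × ℕ → Fin n) m r, ∀ k ≤ κ,
    localIterate P proto S ξ ηl ηg κ ω₀ m r k ∈ P.W

/-- The squared distance measure of the initialization to an empirical optimum `ω` that appears in
the convergence rate of the protocol. -/
def initDistSq {n : ℕ} (β : ℝ) (ω₀ : Param d) (S : Dataset K n X) (ω : Param d) : ℝ :=
  match proto with
  | .fedAvg => ‖ω₀ - ω‖ ^ 2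
  | .scaffold => ‖ω₀ - ω‖ ^ 2 +
      (1 / (2 * (M : ℝ) * β ^ 2)) * ∑ m, ‖∇ (localLoss P S m) ω‖ ^ 2

/-- The order of the number of rounds needed for accuracy `ε`, up to a logarithm. -/
def roundsOrder (μ β σ G ε : ℝ) (κ M : ℕ) : ℝ :=
  match proto with
  | .fedAvg => β / μ + σ ^ 2 / (μ * ε * κ * M) + √(β * G ^ 2 / (μ ^ 2 * ε))
  | .scaffold => β / μ + σ ^ 2 / (μ * ε * κ * M)

end Protocols

/-! ### The FedIGW algorithm -/

/-- Inverse gap weighting for the estimated rewards `v` with learning rate `γ`, where `greedy`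
selects a maximizer. -/
def igw {K : ℕ} (greedy : (Fin K → ℝ) → Fin K) (γ : ℝ) (v : Fin K → ℝ) (a : Fin K) : ℝ :=
  if a = greedy v then
    1 - ∑ a' ∈ Finset.univ.erase (greedy v), 1 / ((K : ℝ) + γ * (v (greedy v) - v a'))
  else 1 / ((K : ℝ) + γ * (v (greedy v) - v a))

/-- The end `τ^l` of epoch `l`, when epoch `j ≥ 1` has length `E j`. -/
def epochEnd (E : ℕ → ℕ+) (l : ℕ) : ℕ := ∑ j ∈ Finset.Icc 1 l, (E j : ℕ)

/-- The number `l(T)` of epochs up to the horizon `T`. -/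
def numEpochs (E : ℕ → ℕ+) (T : ℕ) : ℕ := sInf {l | T ≤ epochEnd E l}

section Regret

variable {M K d : ℕ} {X : Fin M → Type*} [∀ m, MeasurableSpace (X m)]

/-- The regret of all agents in epoch `l` on the data `S` of that epoch, counting only the time
steps up to `T`. -/
def epochRegret (D : Env K X) (E : ℕ → ℕ+) (T l : ℕ) (S : Dataset K (E l) X) : ℝ :=
  ∑ m, ∑ i : Fin (E l), if epochEnd E (l - 1) + i + 1 ≤ T then
    (⨆ a, meanReward D m (S m i).1 a) - meanReward D m (S m i).1 (S m i).2.1 else 0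

/-- The expected regret up to time `T` in the epochs `l, l+1, …, l+k-1`, when epoch `l` starts with
the predictor `fhat`: the data of epoch `l` are collected by inverse gap weighting with `fhat`, the
protocol is run on them, and its output gives the predictor of epoch `l+1`. -/
def regretFrom (D : Env K X) (P : Model K d X) (proto : Protocol)
    (greedy : (Fin K → ℝ) → Fin K) (γ : ℕ → ℝ) (E : ℕ → ℕ+) (h : ℕ → Tuning) (ω₀ : Param d)
    (T : ℕ) : ℕ → ℕ → Predictor K X → ℝ
  | 0, _, _ => 0
  | k + 1, l, fhat =>
    ∫ S, (epochRegret D E T l S +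
        ∫ ξ, regretFrom D P proto greedy γ E h ω₀ T k (l + 1) (P.f (output P proto (h l) ω₀ S ξ))
          ∂(seedLaw M (E l)))
      ∂(dataLaw (E l) D fun m x => igw greedy (γ l) (fhat m x))

/-- `Reg(T)` of FedIGW, started in epoch `1` with the zero predictor. -/
def regret (D : Env K X) (P : Model K d X) (proto : Protocol)
    (greedy : (Fin K → ℝ) → Fin K) (γ : ℕ → ℝ) (E : ℕ → ℕ+) (h : ℕ → Tuning) (ω₀ : Param d)
    (T : ℕ) : ℝ :=
  regretFrom D P proto greedy γ E h ω₀ T (numEpochs E T) 1 fun _ _ _ => 0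

/-- The learning rate `γ^l = √(K μ_f / ℜ^{l-1})`. -/
def learningRate (P : Model K d X) (𝓔 : Set (Env K X)) (μf : ℝ) (E : ℕ → ℕ+) (l : ℕ) : ℝ :=
  √(K * μf / (rademacher P 𝓔 (E (l - 1))).toReal)

end Regret

end

end FedIGW

/-!
The regret bound rests on four facts.

*Optimization.* The corrections of SCAFFOLD sum to zero over the agents, so under both protocols
the server moves by `κ ηg ηl` along the average of the stochastic gradients taken at the local
models (`serverState_succ_fst`). Only `ηg ≥ 1` is required of `ηg`. At a fixed product `κ ηg ηl`, a
large `ηg` makes the local steps so short that the local models hardly leave the global one: the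
iterates obey a bound that does not depend on `ηg` (`serverState_bound`), and the drift is that
bound divided by `ηg`. Each round is then one step of minibatch gradient descent with `κ M`
independent samples, up to a bias as small as desired (`expected_descent`). With the step size
`1 / (C (β + σ² / (ε κ M)))` and geometrically weighted averaging, the expected empirical
excess loss of the output is at most `4 ε` after `O((β / μ + σ² / (μ ε κ M)) log (2 + μ Δ² / ε))`
rounds (`exists_tuning`). This is used with `ε` equal to the Rademacher complexity.

*Generalization.* By symmetrization with a ghost sample, the excess risk exceeds the empirical
excess loss by at most twice the Rademacher complexity in the mean, uniformly over `W`
(`exists_generalization_bound`). Since the loss is strongly convex in the prediction and the true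
mean reward minimizes its conditional expectation, the excess risk dominates the squared
prediction error under the distribution that collected the data (`lintegral_sqError_le`).

*Inverse gap weighting.* Suppose that the distribution `p` which collected the data satisfies
`1 / p(a) ≤ K + 2 γ gap(a) + B`. Actions with a small gap are thus explored often, so that the
squared error `Q` of the next predictor under `p` bounds its error at each action in terms of the
gap. The next
distribution therefore satisfies the same inequality at its own learning rate `γ'`, with the excess
`B' = B / 4 + K / 4 + 4 γ'² Q`, and its regret is at most `(4/3) (K + B') / γ'` (`igw_step`).
This is a pointwise statement in the context.

*Induction.* The learning rate is chosen so that `γ'² Q` has mean of order `K M`. As the old excess is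
damped by `1 / 4`, its mean stays of order `K M` and the regret of epoch `l` is of order
`K M E_l / γ_l` (`exists_ofReal_regretFrom_le`). In the first epoch all actions are equally likely,
so that the inequality holds with `γ = 0` and `B = 0`, and the regret is at most `M E_1`.

The regret is a nested Bochner integral of functions whose measurability is not known, because the
predictor of an epoch depends on the data through the gradients of the loss at each dataset. Such
an integral is bounded by the upper Lebesgue integral of the positive part, whether or not its
integrand is measurable (`ofReal_integral_le_lintegral`), and all estimates are made for upper
integrals. They split sums only when one summand is measurable, which is why the regret of an epoch
and the generalization error are first replaced by measurable bounds.
-/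

namespace FedIGW

/-! ### Smooth and strongly convex functions -/

/-- `f` lies between the two quadratics of curvatures `μ` and `β` which touch it at `x` with slope
`g x`, for each point `x`: the first-order form of `μ`-strong convexity and `β`-smoothness. -/
structure QuadraticBounds {V : Type*} [NormedAddCommGroup V] [InnerProductSpace ℝ V]
    (μ β : ℝ) (f : V → ℝ) (g : V → V) : Prop where
  lower : ∀ x y, f x + inner ℝ (g x) (y - x) + μ / 2 * ‖y - x‖ ^ 2 ≤ f y
  upper : ∀ x y, f y ≤ f x + inner ℝ (g x) (y - x) + β / 2 * ‖y - x‖ ^ 2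

section Convex

variable {V : Type*} [NormedAddCommGroup V] [InnerProductSpace ℝ V] {μ β : ℝ} {f : V → ℝ}
  {g : V → V}

lemma add_inner_gradient_le_of_strongConvexOn [CompleteSpace V]
    (hf : StrongConvexOn Set.univ μ f) (hd : Differentiable ℝ f) (x y : V) :
    f x + inner ℝ (∇ f x) (y - x) + μ / 2 * ‖y - x‖ ^ 2 ≤ f y := by
  have hderiv : HasDerivAt (fun t : ℝ => f (x + t • (y - x))) (inner ℝ (∇ f x) (y - x)) 0 := by
    have h1 : HasDerivAt (fun t : ℝ => x + t • (y - x)) (y - x) 0 := by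
      simpa using ((hasDerivAt_id (0 : ℝ)).smul_const (y - x)).const_add x
    have h2 : HasFDerivAt f (fderiv ℝ f x) (x + (0 : ℝ) • (y - x)) := by
      simpa using (hd x).hasFDerivAt
    have h3 := h2.comp_hasDerivAt (0 : ℝ) h1
    rwa [← inner_gradient_left] at h3
  have hslope := hderiv.tendsto_slope_zero_right
  simp only [zero_add, zero_smul, add_zero] at hslope
  have hlim : Filter.Tendsto (fun t : ℝ => f y - f x - (1 - t) * (μ / 2 * ‖y - x‖ ^ 2))
      (nhdsWithin 0 (Set.Ioi 0)) (nhds (f y - f x - (1 - 0) * (μ / 2 * ‖y - x‖ ^ 2))) := by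
    apply Filter.Tendsto.mono_left _ nhdsWithin_le_nhds
    apply Continuous.tendsto (by fun_prop)
  have key := le_of_tendsto_of_tendsto hslope hlim (by
    have : Set.Ioc (0 : ℝ) 1 ∈ nhdsWithin (0 : ℝ) (Set.Ioi 0) := Ioc_mem_nhdsGT one_pos
    filter_upwards [this] with t ht
    have h := hf.2 (Set.mem_univ x) (Set.mem_univ y) (sub_nonneg.2 ht.2) ht.1.le (by ring)
    have e : (1 - t) • x + t • y = x + t • (y - x) := by
      simp only [sub_smul, one_smul, smul_sub]; abel
    rw [e] at h
    simp only [smul_eq_mul] at h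
    rw [norm_sub_rev x y] at h
    rw [smul_eq_mul, inv_mul_le_iff₀ ht.1]
    nlinarith)
  linarith

lemma QuadraticBounds.le_curvature (h : QuadraticBounds μ β f g) [Nontrivial V] : μ ≤ β := by
  obtain ⟨y, hy⟩ := exists_ne (0 : V)
  have h1 := h.lower 0 y
  have h2 := h.upper 0 y
  have h3 : 0 < ‖y - 0‖ ^ 2 := by rw [sub_zero]; positivity
  by_contra! hlt
  nlinarith

lemma QuadraticBounds.norm_sq_le (h : QuadraticBounds μ β f g) (hβ : 0 < β) {c : ℝ}
    (hc : ∀ y, c ≤ f y) (x : V) : ‖g x‖ ^ 2 ≤ 2 * β * (f x - c) := by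
  have h1 := (hc _).trans (h.upper x (x - (1 / β) • g x))
  have e : x - (1 / β) • g x - x = -((1 / β) • g x) := by abel
  rw [e, inner_neg_right, inner_smul_right, real_inner_self_eq_norm_sq, norm_neg, norm_smul,
    mul_pow, Real.norm_eq_abs, sq_abs] at h1
  have e2 : β / 2 * ((1 / β) ^ 2 * ‖g x‖ ^ 2) = ‖g x‖ ^ 2 / β / 2 := by field_simp
  rw [e2] at h1
  have h2 : ‖g x‖ ^ 2 / β ≤ 2 * (f x - c) := by
    have : 1 / β * ‖g x‖ ^ 2 = ‖g x‖ ^ 2 / β := by ring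
    linarith
  rw [div_le_iff₀ hβ] at h2
  linarith

lemma QuadraticBounds.eq_zero_of_minimizer (h : QuadraticBounds μ β f g) (hβ : 0 < β) {x : V}
    (hx : ∀ y, f x ≤ f y) : g x = 0 := by
  have := h.norm_sq_le hβ hx x
  have h0 : ‖g x‖ ^ 2 = 0 := le_antisymm (by simpa using this) (by positivity)
  simpa using h0

/-- Subtracting a tangent from a smooth convex function leaves a function which is minimal at the
point of contact; the gradient bound for it is cocoercivity. -/
lemma QuadraticBounds.lipschitz (h : QuadraticBounds μ β f g) (hμ : 0 ≤ μ) (hβ : 0 < β) (x y : V) :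
    ‖g x - g y‖ ≤ β * ‖x - y‖ := by
  have key : ∀ x y, ‖g y - g x‖ ^ 2 ≤ 2 * β * (f y - f x - inner ℝ (g x) (y - x)) := by
    intro x y
    have hq : QuadraticBounds 0 β (fun z => f z - inner ℝ (g x) z) (fun z => g z - g x) := by
      constructor
      · intro u v
        have := h.lower u v
        have hp : 0 ≤ μ / 2 * ‖v - u‖ ^ 2 := by positivity
        simp only [inner_sub_left, inner_sub_right] at this ⊢
        linarith
      · intro u v
        have := h.upper u v
        simp only [inner_sub_left, inner_sub_right] at this ⊢
        linarith
    have hmin : ∀ z, f x - inner ℝ (g x) x ≤ f z - inner ℝ (g x) z := by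
      intro z
      have := hq.lower x z
      simpa using this
    refine (hq.norm_sq_le hβ hmin y).trans_eq ?_
    simp only [inner_sub_right]; ring
  have h1 := key x y
  have h2 := key y x
  rw [norm_sub_rev] at h1
  have h3 : ‖g x - g y‖ ^ 2 ≤ β * inner ℝ (g x - g y) (x - y) := by
    simp only [inner_sub_left, inner_sub_right] at h1 h2 ⊢
    linarith
  have h4 : inner ℝ (g x - g y) (x - y) ≤ ‖g x - g y‖ * ‖x - y‖ := real_inner_le_norm _ _
  rcases (norm_nonneg (g x - g y)).eq_or_lt with h0 | h0
  · rw [← h0]; positivity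
  · nlinarith [mul_le_mul_of_nonneg_left h4 hβ.le]

lemma QuadraticBounds.average {ι : Type*} [Fintype ι] [Nonempty ι] {f : ι → V → ℝ}
    {g : ι → V → V} (h : ∀ i, QuadraticBounds μ β (f i) (g i)) :
    QuadraticBounds μ β (fun x => (1 / (Fintype.card ι : ℝ)) * ∑ i, f i x)
      (fun x => (1 / (Fintype.card ι : ℝ)) • ∑ i, g i x) := by
  have hc : (0 : ℝ) < Fintype.card ι := by exact_mod_cast Fintype.card_pos
  have key : ∀ c : ℝ, c = (1 / (Fintype.card ι : ℝ)) * ∑ _i : ι, c := by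
    intro c; rw [Finset.sum_const, Finset.card_univ, nsmul_eq_mul]; field_simp
  constructor
  · intro x y
    rw [inner_smul_left, sum_inner, key (μ / 2 * ‖y - x‖ ^ 2)]
    simp only [conj_trivial, ← mul_add, ← Finset.sum_add_distrib]
    gcongr with i
    exact (h i).lower x y
  · intro x y
    rw [inner_smul_left, sum_inner, key (β / 2 * ‖y - x‖ ^ 2)]
    simp only [conj_trivial, ← mul_add, ← Finset.sum_add_distrib]
    gcongr with i
    exact (h i).upper x y

lemma QuadraticBounds.exists_minimizer [FiniteDimensional ℝ V] (h : QuadraticBounds μ β f g)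
    (hμ : 0 < μ) (hf : Continuous f) : ∃ x, ∀ y, f x ≤ f y := by
  apply hf.exists_forall_le
  have hlow : ∀ y, f 0 + ‖y‖ * (μ / 2 * ‖y‖ - ‖g 0‖) ≤ f y := by
    intro y
    have h1 := h.lower 0 y
    rw [sub_zero] at h1
    have h2 : -(‖g 0‖ * ‖y‖) ≤ inner ℝ (g 0) y := neg_le_of_abs_le (abs_real_inner_le_norm _ _)
    nlinarith
  refine Filter.tendsto_atTop_mono hlow ?_
  apply Filter.tendsto_atTop_add_const_left
  have hn : Filter.Tendsto (fun y : V => ‖y‖) (Filter.cocompact V) Filter.atTop :=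
    tendsto_norm_cocompact_atTop
  apply hn.atTop_mul_atTop₀
  exact Filter.tendsto_atTop_add_const_right _ _ (hn.const_mul_atTop (by positivity))

/-- Jensen's inequality, from the tangent at the mean. -/
lemma QuadraticBounds.map_sum_le (h : QuadraticBounds μ β f g) (hμ : 0 ≤ μ) {ι : Type*}
    (s : Finset ι) (w : ι → ℝ) (x : ι → V) (hw : ∀ i, 0 ≤ w i) (hs : ∑ i ∈ s, w i = 1) :
    f (∑ i ∈ s, w i • x i) ≤ ∑ i ∈ s, w i * f (x i) := by
  set z := ∑ i ∈ s, w i • x i with hz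
  have h1 : ∀ i ∈ s, w i * (f z + inner ℝ (g z) (x i - z)) ≤ w i * f (x i) := by
    intro i _
    have := h.lower z (x i)
    have hp : 0 ≤ μ / 2 * ‖x i - z‖ ^ 2 := by positivity
    exact mul_le_mul_of_nonneg_left (by linarith) (hw i)
  have h2 := Finset.sum_le_sum h1
  refine le_trans (le_of_eq ?_) h2
  have h3 : ∑ i ∈ s, w i * inner ℝ (g z) (x i - z) = 0 := by
    have : ∑ i ∈ s, w i * inner ℝ (g z) (x i - z) = inner ℝ (g z) (∑ i ∈ s, w i • (x i - z)) := by
      rw [inner_sum]; simp only [inner_smul_right]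
    rw [this]
    simp only [smul_sub, Finset.sum_sub_distrib, ← Finset.sum_smul, hs, one_smul, ← hz, sub_self,
      inner_zero_right]
  simp only [mul_add, Finset.sum_add_distrib, h3, ← Finset.sum_mul, hs, one_mul, add_zero]

/-- One step of gradient descent with step size `η`, where the descent direction is the gradient
up to a bias `b` and a noise `ζ`. -/
lemma QuadraticBounds.descent_step (h : QuadraticBounds μ β f g) (hμ : 0 < μ) (hβ : 0 < β)
    {xs : V} (hxs : ∀ y, f xs ≤ f y) {η : ℝ} (hη : 0 < η) (hη' : 16 * β * η ≤ 1) (x b ζ : V) :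
    ‖x - η • (g x + b + ζ) - xs‖ ^ 2 ≤ (1 - μ * η) * ‖x - xs‖ ^ 2 - η / 2 * (f x - f xs) +
      (2 * η ^ 2 * ‖ζ‖ ^ 2 + (2 * η / μ + 4 * η ^ 2) * ‖b‖ ^ 2 - 2 * η * inner ℝ ζ (x - xs)) := by
  have h0 := h.eq_zero_of_minimizer hβ hxs
  have hgap : μ / 2 * ‖x - xs‖ ^ 2 ≤ f x - f xs := by
    have := h.lower xs x
    rw [h0, inner_zero_left] at this
    linarith
  have hin : f x - f xs + μ / 2 * ‖x - xs‖ ^ 2 ≤ inner ℝ (g x) (x - xs) := by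
    have := h.lower x xs
    rw [← neg_sub x xs, inner_neg_right, norm_neg] at this
    linarith
  have hg := h.norm_sq_le hβ hxs x
  have e : x - η • (g x + b + ζ) - xs = (x - xs) - η • (g x + b + ζ) := by abel
  have hsq : ‖g x + b + ζ‖ ^ 2 ≤ 4 * ‖g x‖ ^ 2 + 4 * ‖b‖ ^ 2 + 2 * ‖ζ‖ ^ 2 := by
    have t : ∀ u v : V, ‖u + v‖ ^ 2 ≤ 2 * ‖u‖ ^ 2 + 2 * ‖v‖ ^ 2 := by
      intro u v
      have h1 := norm_add_le u v
      have h2 := norm_nonneg (u + v)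
      nlinarith [sq_nonneg (‖u‖ - ‖v‖)]
    have := t (g x + b) ζ
    have := t (g x) b
    linarith
  have hb : -(μ / 4 * ‖x - xs‖ ^ 2 + 1 / μ * ‖b‖ ^ 2) ≤ inner ℝ b (x - xs) := by
    have h1 : -(‖b‖ * ‖x - xs‖) ≤ inner ℝ b (x - xs) :=
      neg_le_of_abs_le (abs_real_inner_le_norm _ _)
    refine le_trans ?_ h1
    have h2 : 0 ≤ (μ / 2 * ‖x - xs‖ - ‖b‖) ^ 2 / μ := by positivity
    have h3 : (μ / 2 * ‖x - xs‖ - ‖b‖) ^ 2 / μ =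
      μ / 4 * ‖x - xs‖ ^ 2 + 1 / μ * ‖b‖ ^ 2 - ‖b‖ * ‖x - xs‖ := by field_simp; ring
    linarith
  rw [e, norm_sub_sq_real, inner_smul_right, norm_smul, mul_pow, Real.norm_eq_abs, sq_abs,
    real_inner_comm, inner_add_left, inner_add_left]
  have hgap0 : 0 ≤ f x - f xs := sub_nonneg.2 (hxs x)
  have k1 : η ^ 2 * ‖g x + b + ζ‖ ^ 2 ≤
      η / 2 * (f x - f xs) + η ^ 2 * (4 * ‖b‖ ^ 2 + 2 * ‖ζ‖ ^ 2) := by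
    have a1 : η ^ 2 * ‖g x + b + ζ‖ ^ 2 ≤ η ^ 2 * (4 * ‖g x‖ ^ 2 + 4 * ‖b‖ ^ 2 + 2 * ‖ζ‖ ^ 2) := by
      gcongr
    have a2 : η ^ 2 * (4 * ‖g x‖ ^ 2) ≤ η ^ 2 * (4 * (2 * β * (f x - f xs))) := by gcongr
    have a3 : η * (f x - f xs) * (16 * β * η) ≤ η * (f x - f xs) * 1 := by gcongr
    nlinarith
  have k2 := mul_le_mul_of_nonneg_left hin (by positivity : 0 ≤ 2 * η)
  have k3 := mul_le_mul_of_nonneg_left hb (by positivity : 0 ≤ 2 * η)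
  have k4 := mul_le_mul_of_nonneg_left hgap hη.le
  have e4 : (2 * η / μ + 4 * η ^ 2) * ‖b‖ ^ 2 =
    2 * η * (1 / μ * ‖b‖ ^ 2) + 4 * η ^ 2 * ‖b‖ ^ 2 := by ring
  rw [e4]
  nlinarith

end Convex

/-! ### The server iteration as perturbed gradient descent -/

section Protocols

variable {M K d : ℕ} {X : Fin M → Type*} {P : Model K d X} {proto : Protocol}

lemma localSteps_eq (η : ℝ) (g : ℕ → Param d → Param d) (v x : Param d) (k : ℕ) :
    localSteps η g v x k =
      x - η • (∑ j ∈ Finset.range k, g j (localSteps η g v x j) + (k : ℝ) • v) := by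
  induction k with
  | zero => simp [localSteps]
  | succ k ih =>
    rw [Finset.sum_range_succ, localSteps]
    nth_rewrite 1 [ih]
    push_cast
    module

lemma sum_correction (proto : Protocol) (c : Fin M → Param d) :
    ∑ m, correction proto c m = 0 := by
  cases proto with
  | fedAvg => simp [correction]
  | scaffold =>
    rcases Nat.eq_zero_or_pos M with rfl | hM
    · simp
    · have : (M : ℝ) ≠ 0 := by positivity
      simp only [correction, Finset.sum_sub_distrib, Finset.sum_const, Finset.card_univ,
        Fintype.card_fin, ← Nat.cast_smul_eq_nsmul ℝ, smul_smul]
      rw [mul_one_div_cancel this, one_smul, sub_self]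

/-- The average, over agents and local steps, of the stochastic gradients used in round `r`. -/
noncomputable def roundGrad (P : Model K d X) (proto : Protocol) {n : ℕ} (S : Dataset K n X)
    (ξ : Fin M × ℕ × ℕ → Fin n) (ηl ηg : ℝ) (κ : ℕ) (ω₀ : Param d) (r : ℕ) : Param d :=
  (1 / ((M : ℝ) * κ)) • ∑ m, ∑ k ∈ Finset.range κ,
    stochGrad P S ξ m r k (localIterate P proto S ξ ηl ηg κ ω₀ m r k)

variable {n : ℕ} {S : Dataset K n X} {ξ : Fin M × ℕ × ℕ → Fin n} {ηl ηg : ℝ} {κ : ℕ}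
  {ω₀ : Param d}

/-- The control variates of SCAFFOLD cancel in the sum over the agents, so that under both
protocols the server moves along the averaged stochastic gradients. -/
lemma serverState_succ_fst (hκ : 0 < κ) (r : ℕ) :
    (serverState P proto S ξ ηl ηg κ ω₀ (r + 1)).1 =
      (serverState P proto S ξ ηl ηg κ ω₀ r).1 -
        (κ * ηg * ηl) • roundGrad P proto S ξ ηl ηg κ ω₀ r := by
  have hκ' : (κ : ℝ) ≠ 0 := by positivity
  have h : ∑ m, (localIterate P proto S ξ ηl ηg κ ω₀ m r κ -
        (serverState P proto S ξ ηl ηg κ ω₀ r).1) =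
      -(ηl • ∑ m, ∑ k ∈ Finset.range κ,
        stochGrad P S ξ m r k (localIterate P proto S ξ ηl ηg κ ω₀ m r k)) := by
    have h1 : ∀ m, localIterate P proto S ξ ηl ηg κ ω₀ m r κ -
        (serverState P proto S ξ ηl ηg κ ω₀ r).1 =
        -(ηl • (∑ k ∈ Finset.range κ,
          stochGrad P S ξ m r k (localIterate P proto S ξ ηl ηg κ ω₀ m r k))) -
        (ηl * κ) • correction proto (serverState P proto S ξ ηl ηg κ ω₀ r).2 m := by
      intro m
      rw [localIterate, localSteps_eq]
      simp only [localIterate]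
      module
    simp only [h1, Finset.sum_sub_distrib, ← Finset.smul_sum, sum_correction, smul_zero, sub_zero,
      Finset.sum_neg_distrib]
  change (serverState P proto S ξ ηl ηg κ ω₀ r).1 + (ηg / (M : ℝ)) •
    ∑ m, (localIterate P proto S ξ ηl ηg κ ω₀ m r κ - (serverState P proto S ξ ηl ηg κ ω₀ r).1) = _
  rw [h, roundGrad, smul_smul, sub_eq_add_neg, smul_neg, smul_smul]
  congr 3
  rcases Nat.eq_zero_or_pos M with rfl | hM
  · simp
  · have : (M : ℝ) ≠ 0 := by positivity
    field_simp

/-- After a round of SCAFFOLD, the control variate of an agent is the average of the stochastic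
gradients that it has just used. -/
lemma serverState_scaffold_succ_snd (hκ : 0 < κ) (hη : ηl ≠ 0) (r : ℕ) (m : Fin M) :
    (serverState P .scaffold S ξ ηl ηg κ ω₀ (r + 1)).2 m =
      (1 / (κ : ℝ)) • ∑ k ∈ Finset.range κ,
        stochGrad P S ξ m r k (localIterate P .scaffold S ξ ηl ηg κ ω₀ m r k) := by
  have hκ' : (κ : ℝ) ≠ 0 := by positivity
  change (serverState P .scaffold S ξ ηl ηg κ ω₀ r).2 m -
    (1 / (M : ℝ)) • ∑ m', (serverState P .scaffold S ξ ηl ηg κ ω₀ r).2 m' +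
    (1 / ((κ : ℝ) * ηl)) • ((serverState P .scaffold S ξ ηl ηg κ ω₀ r).1 -
      localIterate P .scaffold S ξ ηl ηg κ ω₀ m r κ) = _
  nth_rewrite 1 [localIterate]
  rw [localSteps_eq]
  simp only [localIterate, sub_sub_cancel, smul_smul, smul_add, correction]
  have e1 : 1 / ((κ : ℝ) * ηl) * ηl = 1 / κ := by field_simp
  have e2 : 1 / (κ : ℝ) * κ = 1 := by field_simp
  simp only [← mul_assoc, e1, e2]
  module

section Drift

variable {β s H : ℝ} {xs : Param d}

lemma norm_stochGrad_le (hlip : ∀ m x y, ‖∇ (localLoss P S m) x - ∇ (localLoss P S m) y‖ ≤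
      β * ‖x - y‖)
    (hs : ∀ m i, ∀ ω ∈ P.W, ‖∇ (sampleLoss P m (S m i)) ω - ∇ (localLoss P S m) ω‖ ≤ s)
    (hH : ∀ m, ‖∇ (localLoss P S m) xs‖ ≤ H) (m : Fin M) (r k : ℕ) {ω : Param d} (hω : ω ∈ P.W) :
    ‖stochGrad P S ξ m r k ω‖ ≤ s + H + β * ‖ω - xs‖ := by
  have h1 := hs m (ξ (m, r, k)) ω hω
  have h2 := hlip m ω xs
  have h3 := hH m
  have e : stochGrad P S ξ m r k ω = (∇ (sampleLoss P m (S m (ξ (m, r, k)))) ω -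
    ∇ (localLoss P S m) ω) + (∇ (localLoss P S m) ω - ∇ (localLoss P S m) xs) +
    ∇ (localLoss P S m) xs := by simp [stochGrad]
  rw [e]
  exact (norm_add₃_le).trans (by linarith)

/-- In a round whose starting point satisfies the bound `A`, the local models stay within
`2 k ηl A` of it, and the corrected stochastic gradients within `2 A`. -/
lemma norm_localIterate_sub_le (hβ : 0 ≤ β) (hη : 0 < ηl) (hηβ : 2 * β * κ * ηl ≤ 1)
    (hlip : ∀ m x y, ‖∇ (localLoss P S m) x - ∇ (localLoss P S m) y‖ ≤ β * ‖x - y‖)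
    (hs : ∀ m i, ∀ ω ∈ P.W, ‖∇ (sampleLoss P m (S m i)) ω - ∇ (localLoss P S m) ω‖ ≤ s)
    (hH : ∀ m, ‖∇ (localLoss P S m) xs‖ ≤ H)
    (hW : ∀ m r, ∀ k ≤ κ, localIterate P proto S ξ ηl ηg κ ω₀ m r k ∈ P.W)
    (m : Fin M) (r : ℕ) {A : ℝ} (hA0 : 0 ≤ A)
    (hA : s + H + β * ‖(serverState P proto S ξ ηl ηg κ ω₀ r).1 - xs‖ +
      ‖correction proto (serverState P proto S ξ ηl ηg κ ω₀ r).2 m‖ ≤ A) (k : ℕ) (hk : k ≤ κ) :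
    ‖localIterate P proto S ξ ηl ηg κ ω₀ m r k - (serverState P proto S ξ ηl ηg κ ω₀ r).1‖ ≤
        2 * k * ηl * A ∧
      ‖stochGrad P S ξ m r k (localIterate P proto S ξ ηl ηg κ ω₀ m r k)‖ ≤
        2 * A - ‖correction proto (serverState P proto S ξ ηl ηg κ ω₀ r).2 m‖ := by
  set x := (serverState P proto S ξ ηl ηg κ ω₀ r).1
  set v := correction proto (serverState P proto S ξ ηl ηg κ ω₀ r).2 m
  -- a drift of length `2 k ηl A` changes the gradients by at most `A`
  have grad : ∀ k ≤ κ, ‖localIterate P proto S ξ ηl ηg κ ω₀ m r k - x‖ ≤ 2 * k * ηl * A →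
      ‖stochGrad P S ξ m r k (localIterate P proto S ξ ηl ηg κ ω₀ m r k)‖ ≤ 2 * A - ‖v‖ := by
    intro k hk h
    have h1 := norm_stochGrad_le (ξ := ξ) hlip hs hH m r k (hW m r k hk)
    have h2 : ‖localIterate P proto S ξ ηl ηg κ ω₀ m r k - xs‖ ≤ 2 * k * ηl * A + ‖x - xs‖ :=
      (norm_sub_le_norm_sub_add_norm_sub _ x _).trans (by linarith)
    have h3 : β * (2 * k * ηl * A) ≤ A := by
      have hk' : (k : ℝ) ≤ κ := by exact_mod_cast hk
      have : 2 * β * k * ηl ≤ 1 := le_trans (by gcongr) hηβ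
      calc β * (2 * k * ηl * A) = (2 * β * k * ηl) * A := by ring
        _ ≤ 1 * A := by gcongr
        _ = A := one_mul A
    have h4 := mul_le_mul_of_nonneg_left h2 hβ
    linarith
  have drift : ∀ k ≤ κ, ‖localIterate P proto S ξ ηl ηg κ ω₀ m r k - x‖ ≤ 2 * k * ηl * A := by
    intro k
    induction k with
    | zero => intro _; simp [localIterate, localSteps, x]
    | succ k ih =>
      intro hk
      have h1 := ih (by omega)
      have h2 := grad k (by omega) h1
      have e : localIterate P proto S ξ ηl ηg κ ω₀ m r (k + 1) - x =
        (localIterate P proto S ξ ηl ηg κ ω₀ m r k - x) -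
          ηl • (stochGrad P S ξ m r k (localIterate P proto S ξ ηl ηg κ ω₀ m r k) + v) := by
        simp only [localIterate, localSteps, x, v]; abel
      rw [e]
      refine (norm_sub_le _ _).trans ?_
      rw [norm_smul, Real.norm_of_nonneg hη.le]
      have h3 : ‖stochGrad P S ξ m r k (localIterate P proto S ξ ηl ηg κ ω₀ m r k) + v‖ ≤ 2 * A :=
        (norm_add_le _ _).trans (by linarith)
      have h4 := mul_le_mul_of_nonneg_left h3 hη.le
      push_cast
      linarith
  exact ⟨drift k hk, grad k hk (drift k hk)⟩

lemma norm_roundGrad_le (hM : 0 < M) (hκ : 0 < κ) {r : ℕ} {B : ℝ}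
    (h : ∀ m, ∀ k < κ,
      ‖stochGrad P S ξ m r k (localIterate P proto S ξ ηl ηg κ ω₀ m r k)‖ ≤ B) :
    ‖roundGrad P proto S ξ ηl ηg κ ω₀ r‖ ≤ B := by
  have hM' : (0 : ℝ) < M := by exact_mod_cast hM
  have hκ' : (0 : ℝ) < κ := by exact_mod_cast hκ
  rw [roundGrad, norm_smul, Real.norm_of_nonneg (by positivity)]
  have : ‖∑ m, ∑ k ∈ Finset.range κ,
      stochGrad P S ξ m r k (localIterate P proto S ξ ηl ηg κ ω₀ m r k)‖ ≤
      ∑ _m : Fin M, ∑ _k ∈ Finset.range κ, B :=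
    norm_sum_le_of_le _ fun m _ => norm_sum_le_of_le _ fun k hk => h m k (Finset.mem_range.1 hk)
  simp only [Finset.sum_const, Finset.card_univ, Fintype.card_fin, Finset.card_range,
    nsmul_eq_mul] at this
  calc _ ≤ 1 / ((M : ℝ) * κ) * (M * (κ * B)) := by gcongr
    _ = B := by field_simp

/-- A bound on all iterates, valid for every outcome of the sampling. It does not depend on how
the step size `κ ηg ηl` is split between the local and the global step. -/
lemma serverState_bound (hM : 0 < M) (hκ : 0 < κ) (hβ : 0 ≤ β) (hη : 0 < ηl) (hηg : 1 ≤ ηg)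
    (hηβ : 2 * β * (κ * ηg * ηl) ≤ 1) (hs0 : 0 ≤ s) (hH0 : 0 ≤ H)
    (hlip : ∀ m x y, ‖∇ (localLoss P S m) x - ∇ (localLoss P S m) y‖ ≤ β * ‖x - y‖)
    (hs : ∀ m i, ∀ ω ∈ P.W, ‖∇ (sampleLoss P m (S m i)) ω - ∇ (localLoss P S m) ω‖ ≤ s)
    (hH : ∀ m, ‖∇ (localLoss P S m) xs‖ ≤ H)
    (hW : ∀ m r, ∀ k ≤ κ, localIterate P proto S ξ ηl ηg κ ω₀ m r k ∈ P.W)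
    (r : ℕ) (m : Fin M) :
    s + H + β * ‖(serverState P proto S ξ ηl ηg κ ω₀ r).1 - xs‖ +
      ‖correction proto (serverState P proto S ξ ηl ηg κ ω₀ r).2 m‖ ≤
      7 ^ r * (s + H + β * ‖ω₀ - xs‖) := by
  have hM' : (0 : ℝ) < M := by exact_mod_cast hM
  have hκ' : (0 : ℝ) < κ := by exact_mod_cast hκ
  have hηβ' : 2 * β * κ * ηl ≤ 1 := by
    refine le_trans ?_ hηβ
    have : 2 * β * κ * ηl * 1 ≤ 2 * β * κ * ηl * ηg := by gcongr
    linarith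
  induction r generalizing m with
  | zero =>
    have : correction proto (serverState P proto S ξ ηl ηg κ ω₀ 0).2 m = 0 := by
      cases proto <;> simp [correction, serverState]
    rw [this]
    simp [serverState]
  | succ r ih =>
    set A := 7 ^ r * (s + H + β * ‖ω₀ - xs‖) with hA
    have hA0 : 0 ≤ A := by positivity
    have hg : ∀ m, ∀ k ≤ κ,
        ‖stochGrad P S ξ m r k (localIterate P proto S ξ ηl ηg κ ω₀ m r k)‖ ≤ 2 * A := by
      intro m k hk
      have := (norm_localIterate_sub_le hβ hη hηβ' hlip hs hH hW m r hA0 (ih m) k hk).2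
      linarith [norm_nonneg (correction proto (serverState P proto S ξ ηl ηg κ ω₀ r).2 m)]
    have hx : β * ‖(serverState P proto S ξ ηl ηg κ ω₀ (r + 1)).1 - xs‖ ≤
        β * ‖(serverState P proto S ξ ηl ηg κ ω₀ r).1 - xs‖ + A := by
      rw [serverState_succ_fst hκ, sub_right_comm]
      have h1 := norm_sub_le ((serverState P proto S ξ ηl ηg κ ω₀ r).1 - xs)
        ((κ * ηg * ηl) • roundGrad P proto S ξ ηl ηg κ ω₀ r)
      rw [norm_smul, Real.norm_of_nonneg (by positivity)] at h1
      have h2 := norm_roundGrad_le (ξ := ξ) (r := r) hM hκ fun m k hk => hg m k hk.le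
      have h3 : β * (κ * ηg * ηl * ‖roundGrad P proto S ξ ηl ηg κ ω₀ r‖) ≤ A := by
        calc β * (κ * ηg * ηl * ‖roundGrad P proto S ξ ηl ηg κ ω₀ r‖)
            ≤ β * (κ * ηg * ηl * (2 * A)) := by gcongr
          _ = (2 * β * (κ * ηg * ηl)) * A := by ring
          _ ≤ 1 * A := by gcongr
          _ = A := one_mul A
      have h4 := mul_le_mul_of_nonneg_left h1 hβ
      linarith
    have hv : ‖correction proto (serverState P proto S ξ ηl ηg κ ω₀ (r + 1)).2 m‖ ≤ 4 * A := by
      cases proto with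
      | fedAvg => simp only [correction, norm_zero]; positivity
      | scaffold =>
        have hc : ∀ m, ‖(serverState P .scaffold S ξ ηl ηg κ ω₀ (r + 1)).2 m‖ ≤ 2 * A := by
          intro m
          rw [serverState_scaffold_succ_snd hκ hη.ne', norm_smul,
            Real.norm_of_nonneg (by positivity)]
          have := norm_sum_le_of_le (Finset.range κ)
            fun k hk => hg m k (Finset.mem_range.1 hk).le
          rw [Finset.sum_const, Finset.card_range, nsmul_eq_mul] at this
          calc _ ≤ 1 / (κ : ℝ) * (κ * (2 * A)) := by gcongr
            _ = 2 * A := by field_simp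
        have hbar : ‖(1 / (M : ℝ)) • ∑ m', (serverState P .scaffold S ξ ηl ηg κ ω₀ (r + 1)).2 m'‖ ≤
            2 * A := by
          rw [norm_smul, Real.norm_of_nonneg (by positivity)]
          have := norm_sum_le_of_le Finset.univ fun m (_ : m ∈ Finset.univ) => hc m
          rw [Finset.sum_const, Finset.card_univ, Fintype.card_fin, nsmul_eq_mul] at this
          calc _ ≤ 1 / (M : ℝ) * (M * (2 * A)) := by gcongr
            _ = 2 * A := by field_simp
        simp only [correction]
        refine (norm_sub_le _ _).trans ?_
        linarith [hc m]
    have h5 := ih m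
    have h6 := norm_nonneg (correction proto (serverState P proto S ξ ηl ηg κ ω₀ r).2 m)
    rw [pow_succ, mul_right_comm, ← hA]
    linarith

end Drift

end Protocols

/-! ### Independence of the sampled indices -/

section Resample

variable {M n : ℕ}

instance isProbabilityMeasure_seedLaw [NeZero n] : IsProbabilityMeasure (seedLaw M n) := by
  unfold seedLaw
  infer_instance

/-- A single index can be drawn afresh without changing the law of the indices: the law is
invariant under cyclic shifts of one index, and these are averaged. -/
lemma integral_seedLaw_resample [NeZero n] (i : Fin M × ℕ × ℕ)
    {ψ : (Fin M × ℕ × ℕ → Fin n) → ℝ} (hψ : Integrable ψ (seedLaw M n)) :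
    ∫ ξ, ψ ξ ∂(seedLaw M n) =
      ∫ ξ, (1 / (n : ℝ)) * ∑ j, ψ (Function.update ξ i j) ∂(seedLaw M n) := by
  have hn : (n : ℝ) ≠ 0 := by exact_mod_cast NeZero.ne n
  let T : Fin n → (Fin M × ℕ × ℕ → Fin n) → (Fin M × ℕ × ℕ → Fin n) :=
    fun c ξ => Function.update ξ i (ξ i + c)
  have hT : ∀ c, MeasurePreserving (T c) (seedLaw M n) (seedLaw M n) := by
    intro c
    let e : Fin M × ℕ × ℕ → Fin n → Fin n := fun i' x => if i' = i then x + c else x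
    have he : T c = fun ξ i' => e i' (ξ i') := by
      funext ξ i'
      by_cases h : i' = i
      · subst h; simp [T, e]
      · simp [T, e, h]
    have hm : ∀ i', Measurable (e i') := fun i' => measurable_of_countable _
    refine ⟨?_, ?_⟩
    · rw [he]
      exact measurable_pi_lambda _ fun i' => (hm i').comp (measurable_pi_apply i')
    · rw [he, seedLaw, Measure.infinitePi_map_pi _ fun i' => hm i']
      congr 1
      funext i'
      by_cases h : i' = i
      · have hinj : Function.Bijective (e i') := by
          simp only [e, h, if_true]
          exact (Equiv.addRight c).bijective
        refine Measure.ext_of_singleton fun x => ?_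
        obtain ⟨y, rfl⟩ := hinj.2 x
        rw [Measure.map_apply (hm i') (measurableSet_singleton _), ← Set.image_singleton,
          Set.preimage_image_eq _ hinj.1, Set.image_singleton]
        simp only [uniformOn_univ, Measure.count_singleton]
      · have : e i' = id := by funext x; simp [e, h]
        rw [this, Measure.map_id]
  have h1 : ∀ c, Integrable (fun ξ => ψ (T c ξ)) (seedLaw M n) := fun c =>
    (hT c).integrable_comp_of_integrable hψ
  have h2 : ∀ c, ∫ ξ, ψ (T c ξ) ∂(seedLaw M n) = ∫ ξ, ψ ξ ∂(seedLaw M n) := by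
    intro c
    have := integral_map (μ := seedLaw M n) (hT c).measurable.aemeasurable
      (f := ψ) (by rw [(hT c).map_eq]; exact hψ.aestronglyMeasurable)
    rw [(hT c).map_eq] at this
    exact this.symm
  have h3 : ∀ ξ, ∑ j, ψ (Function.update ξ i j) = ∑ c, ψ (T c ξ) := fun ξ =>
    (Equiv.sum_comp (Equiv.addLeft (ξ i)) fun j => ψ (Function.update ξ i j)).symm
  simp only [h3]
  rw [integral_const_mul, integral_finsetSum _ fun c _ => h1 c]
  simp only [h2, Finset.sum_const, Finset.card_univ, Fintype.card_fin, nsmul_eq_mul]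
  field_simp

end Resample

section Noise

variable {M K d : ℕ} {X : Fin M → Type*} {P : Model K d X} {proto : Protocol}
  {n : ℕ} {S : Dataset K n X} {ηl ηg : ℝ} {κ : ℕ} {ω₀ : Param d}

lemma localSteps_congr {η : ℝ} {g g' : ℕ → Param d → Param d} {v x : Param d} {k : ℕ}
    (h : ∀ j < k, g j = g' j) : localSteps η g v x k = localSteps η g' v x k := by
  induction k with
  | zero => rfl
  | succ k ih =>
    rw [localSteps, localSteps, ih fun j hj => h j (by omega), h k (by omega)]

lemma serverState_congr {ξ ξ' : Fin M × ℕ × ℕ → Fin n} {r : ℕ}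
    (h : ∀ m, ∀ r' < r, ∀ k, ξ (m, r', k) = ξ' (m, r', k)) :
    serverState P proto S ξ ηl ηg κ ω₀ r = serverState P proto S ξ' ηl ηg κ ω₀ r := by
  induction r with
  | zero => rfl
  | succ r ih =>
    have hg : ∀ m, stochGrad P S ξ m r = stochGrad P S ξ' m r := by
      intro m; funext k ω; rw [stochGrad, stochGrad, h m r (by omega) k]
    rw [serverState, serverState, ih fun m r' hr' k => h m r' (by omega) k]
    simp only [hg]

lemma localIterate_congr {ξ ξ' : Fin M × ℕ × ℕ → Fin n} {m : Fin M} {r k : ℕ}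
    (h : ∀ m, ∀ r' < r, ∀ k, ξ (m, r', k) = ξ' (m, r', k))
    (h' : ∀ j < k, ξ (m, r, j) = ξ' (m, r, j)) :
    localIterate P proto S ξ ηl ηg κ ω₀ m r k = localIterate P proto S ξ' ηl ηg κ ω₀ m r k := by
  rw [localIterate, localIterate, serverState_congr h]
  exact localSteps_congr fun j hj => by funext ω; rw [stochGrad, stochGrad, h' j hj]

lemma measurable_gradient {V : Type*} [NormedAddCommGroup V] [InnerProductSpace ℝ V]
    [CompleteSpace V] [MeasurableSpace V] [BorelSpace V] (f : V → ℝ) : Measurable (∇ f) := by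
  have h : Measurable (fderiv ℝ f) := measurable_fderiv ℝ f
  exact (InnerProductSpace.toDual ℝ V).symm.continuous.measurable.comp h

lemma measurable_stochGrad (m : Fin M) (r k : ℕ) {y : (Fin M × ℕ × ℕ → Fin n) → Param d}
    (hy : Measurable y) : Measurable fun ξ => stochGrad P S ξ m r k (y ξ) := by
  have h : Measurable fun q : Fin n × Param d => ∇ (sampleLoss P m (S m q.1)) q.2 :=
    measurable_from_prod_countable_right fun j =>
      measurable_gradient (sampleLoss P m (S m j))
  exact h.comp ((measurable_pi_apply (m, r, k)).prodMk hy)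

lemma measurable_localSteps (m : Fin M) (r : ℕ) {v x : (Fin M × ℕ × ℕ → Fin n) → Param d}
    (hv : Measurable v) (hx : Measurable x) (k : ℕ) :
    Measurable fun ξ => localSteps ηl (stochGrad P S ξ m r) (v ξ) (x ξ) k := by
  induction k with
  | zero => exact hx
  | succ k ih =>
    have h := measurable_stochGrad (P := P) (S := S) m r k ih
    simp only [localSteps]
    fun_prop

lemma measurable_correction {c : (Fin M × ℕ × ℕ → Fin n) → Fin M → Param d}
    (hc : ∀ m, Measurable fun ξ => c ξ m) (m : Fin M) :
    Measurable fun ξ => correction proto (c ξ) m := by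
  cases proto with
  | fedAvg => exact measurable_const
  | scaffold =>
    simp only [correction]
    fun_prop

lemma measurable_serverState (r : ℕ) :
    (Measurable fun ξ => (serverState P proto S ξ ηl ηg κ ω₀ r).1) ∧
      ∀ m, Measurable fun ξ => (serverState P proto S ξ ηl ηg κ ω₀ r).2 m := by
  induction r with
  | zero => exact ⟨measurable_const, fun m => measurable_const⟩
  | succ r ih =>
    obtain ⟨hx, hc⟩ := ih
    have hy := fun m => measurable_localSteps (P := P) (S := S) (ηl := ηl) m r
      (measurable_correction (proto := proto) hc m) hx κ
    have key : ∀ (x : (Fin M × ℕ × ℕ → Fin n) → Param d)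
        (c y : (Fin M × ℕ × ℕ → Fin n) → Fin M → Param d), Measurable x →
        (∀ m, Measurable fun ξ => c ξ m) → (∀ m, Measurable fun ξ => y ξ m) →
        (Measurable fun ξ => x ξ + (ηg / (M : ℝ)) • ∑ m, (y ξ m - x ξ)) ∧
        ∀ m, Measurable fun ξ =>
          c ξ m - (1 / (M : ℝ)) • ∑ m', c ξ m' + (1 / ((κ : ℝ) * ηl)) • (x ξ - y ξ m) := by
      intro x c y hx hc hy
      exact ⟨by fun_prop, fun m => by fun_prop⟩
    exact key _ _ _ hx hc hy

lemma measurable_localIterate (m : Fin M) (r k : ℕ) :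
    Measurable fun ξ => localIterate P proto S ξ ηl ηg κ ω₀ m r k :=
  measurable_localSteps m r (measurable_correction (measurable_serverState r).2 m)
    (measurable_serverState r).1 k

lemma gradient_average {V ι : Type*} [NormedAddCommGroup V] [InnerProductSpace ℝ V]
    [CompleteSpace V] [Fintype ι] (c : ℝ) {f : ι → V → ℝ} (hf : ∀ i, Differentiable ℝ (f i))
    (x : V) : ∇ (fun x => c * ∑ i, f i x) x = c • ∑ i, ∇ (f i) x := by
  apply HasGradientAt.gradient
  rw [hasGradientAt_iff_hasFDerivAt, map_smul, map_sum]
  simp only [toDual_gradient]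
  exact (HasFDerivAt.fun_sum fun i _ => (hf i x).hasFDerivAt).const_mul c

/-- The deviation of the stochastic gradient from the local gradient, at a local iterate. -/
noncomputable def gradNoise (P : Model K d X) (proto : Protocol) {n : ℕ} (S : Dataset K n X)
    (ηl ηg : ℝ) (κ : ℕ) (ω₀ : Param d) (m : Fin M) (r k : ℕ)
    (ξ : Fin M × ℕ × ℕ → Fin n) : Param d :=
  stochGrad P S ξ m r k (localIterate P proto S ξ ηl ηg κ ω₀ m r k) -
    ∇ (localLoss P S m) (localIterate P proto S ξ ηl ηg κ ω₀ m r k)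

lemma measurable_gradNoise (m : Fin M) (r k : ℕ) :
    Measurable (gradNoise P proto S ηl ηg κ ω₀ m r k) :=
  (measurable_stochGrad m r k (measurable_localIterate m r k)).sub
    ((measurable_gradient _).comp (measurable_localIterate m r k))

lemma gradNoise_update (m : Fin M) (r k : ℕ) (ξ : Fin M × ℕ × ℕ → Fin n) (j : Fin n) :
    gradNoise P proto S ηl ηg κ ω₀ m r k (Function.update ξ (m, r, k) j) =
      ∇ (sampleLoss P m (S m j)) (localIterate P proto S ξ ηl ηg κ ω₀ m r k) -
        ∇ (localLoss P S m) (localIterate P proto S ξ ηl ηg κ ω₀ m r k) := by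
  have h : localIterate P proto S (Function.update ξ (m, r, k) j) ηl ηg κ ω₀ m r k =
      localIterate P proto S ξ ηl ηg κ ω₀ m r k := by
    apply localIterate_congr
    · intro m' r' hr' k'
      exact Function.update_of_ne (by simp [hr'.ne]) _ _
    · intro k' hk'
      exact Function.update_of_ne (by simp [hk'.ne]) _ _
  rw [gradNoise, h, stochGrad, Function.update_self]

lemma gradNoise_update_of_ne {m m' : Fin M} {r k k' : ℕ} (hne : m ≠ m' ∨ k' < k)
    (ξ : Fin M × ℕ × ℕ → Fin n) (j : Fin n) :
    gradNoise P proto S ηl ηg κ ω₀ m' r k' (Function.update ξ (m, r, k) j) =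
      gradNoise P proto S ηl ηg κ ω₀ m' r k' ξ := by
  have h : localIterate P proto S (Function.update ξ (m, r, k) j) ηl ηg κ ω₀ m' r k' =
      localIterate P proto S ξ ηl ηg κ ω₀ m' r k' := by
    apply localIterate_congr
    · intro m₂ r₂ hr₂ k₂
      exact Function.update_of_ne (by simp [hr₂.ne]) _ _
    · intro k₂ hk₂
      refine Function.update_of_ne ?_ _ _
      rintro h
      simp only [Prod.mk.injEq, true_and] at h
      rcases hne with h' | h'
      · exact h' h.1.symm
      · omega
  have h2 : Function.update ξ (m, r, k) j (m', r, k') = ξ (m', r, k') := by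
    refine Function.update_of_ne ?_ _ _
    rintro h
    simp only [Prod.mk.injEq, true_and] at h
    rcases hne with h' | h'
    · exact h' h.1.symm
    · omega
  rw [gradNoise, gradNoise, h, stochGrad, h2, stochGrad]

section

variable [NeZero n] (hd : ∀ m z, Differentiable ℝ (sampleLoss P m z))
include hd

omit [NeZero n] in
lemma gradient_localLoss (m : Fin M) (ω : Param d) :
    ∇ (localLoss P S m) ω = (1 / (n : ℝ)) • ∑ i, ∇ (sampleLoss P m (S m i)) ω :=
  gradient_average _ (fun i => hd m (S m i)) ω

lemma sum_gradNoise_update (m : Fin M) (r k : ℕ) (ξ : Fin M × ℕ × ℕ → Fin n) :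
    ∑ j, gradNoise P proto S ηl ηg κ ω₀ m r k (Function.update ξ (m, r, k) j) = 0 := by
  have hn : (n : ℝ) ≠ 0 := by exact_mod_cast NeZero.ne n
  simp only [gradNoise_update, Finset.sum_sub_distrib, Finset.sum_const, Finset.card_univ,
    Fintype.card_fin, ← Nat.cast_smul_eq_nsmul ℝ, gradient_localLoss hd, smul_smul]
  rw [mul_one_div_cancel hn, one_smul, sub_self]

/-- The noise of a local step is orthogonal to everything that does not depend on the index drawn
in this step. -/
lemma integral_inner_gradNoise_eq_zero (m : Fin M) (r k : ℕ)
    {h : (Fin M × ℕ × ℕ → Fin n) → Param d}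
    (hi : Integrable (fun ξ => inner ℝ (gradNoise P proto S ηl ηg κ ω₀ m r k ξ) (h ξ))
      (seedLaw M n))
    (hh : ∀ ξ j, h (Function.update ξ (m, r, k) j) = h ξ) :
    ∫ ξ, inner ℝ (gradNoise P proto S ηl ηg κ ω₀ m r k ξ) (h ξ) ∂(seedLaw M n) = 0 := by
  rw [integral_seedLaw_resample (m, r, k) hi]
  have : ∀ ξ, (1 / (n : ℝ)) * ∑ j, inner ℝ
      (gradNoise P proto S ηl ηg κ ω₀ m r k (Function.update ξ (m, r, k) j))
      (h (Function.update ξ (m, r, k) j)) = 0 := by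
    intro ξ
    simp only [hh]
    rw [← sum_inner, sum_gradNoise_update hd, inner_zero_left, mul_zero]
  simp only [this, integral_zero]

variable {s : ℝ} (hW : ∀ ξ m r, ∀ k ≤ κ, localIterate P proto S ξ ηl ηg κ ω₀ m r k ∈ P.W)
  (hs : ∀ m i, ∀ ω ∈ P.W, ‖∇ (sampleLoss P m (S m i)) ω - ∇ (localLoss P S m) ω‖ ≤ s)

omit hd [NeZero n] in
include hW hs in
lemma norm_gradNoise_le (m : Fin M) (r : ℕ) {k : ℕ} (hk : k ≤ κ) (ξ : Fin M × ℕ × ℕ → Fin n) :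
    ‖gradNoise P proto S ηl ηg κ ω₀ m r k ξ‖ ≤ s :=
  hs m (ξ (m, r, k)) _ (hW ξ m r k hk)

end

end Noise

/-! ### The noise of a communication round -/

lemma integral_norm_sum_sq_le_of_orthogonal {Ω V ι : Type*} [MeasurableSpace Ω] {ρ : Measure Ω}
    [IsProbabilityMeasure ρ] [NormedAddCommGroup V] [InnerProductSpace ℝ V]
    {ζ : ι → Ω → V} {c : ℝ} (s : Finset ι)
    (hi : ∀ p ∈ s, ∀ q ∈ s, Integrable (fun ω => inner ℝ (ζ p ω) (ζ q ω)) ρ)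
    (h0 : ∀ p ∈ s, ∀ q ∈ s, p ≠ q → ∫ ω, inner ℝ (ζ p ω) (ζ q ω) ∂ρ = 0)
    (h1 : ∀ p ∈ s, ∫ ω, ‖ζ p ω‖ ^ 2 ∂ρ ≤ c) :
    ∫ ω, ‖∑ p ∈ s, ζ p ω‖ ^ 2 ∂ρ ≤ s.card * c := by
  have e : ∀ ω, ‖∑ p ∈ s, ζ p ω‖ ^ 2 = ∑ p ∈ s, ∑ q ∈ s, inner ℝ (ζ p ω) (ζ q ω) := by
    intro ω
    rw [← real_inner_self_eq_norm_sq, sum_inner]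
    simp only [inner_sum]
  simp only [e]
  rw [integral_finsetSum _ fun p hp => integrable_finsetSum _ fun q hq => hi p hp q hq]
  have : ∀ p ∈ s, ∫ ω, ∑ q ∈ s, inner ℝ (ζ p ω) (ζ q ω) ∂ρ ≤ c := by
    intro p hp
    rw [integral_finsetSum _ fun q hq => hi p hp q hq,
      Finset.sum_eq_single_of_mem p hp fun q hq hqp => h0 p hp q hq hqp.symm]
    simpa only [real_inner_self_eq_norm_sq] using h1 p hp
  simpa using Finset.sum_le_sum this

section Round

variable {M K d : ℕ} {X : Fin M → Type*} {P : Model K d X} {proto : Protocol}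
  {n : ℕ} {S : Dataset K n X} {ηl ηg : ℝ} {κ : ℕ} {ω₀ : Param d}

/-- The average of the gradient noises of one round. -/
noncomputable def roundNoise (P : Model K d X) (proto : Protocol) {n : ℕ} (S : Dataset K n X)
    (ηl ηg : ℝ) (κ : ℕ) (ω₀ : Param d) (r : ℕ) (ξ : Fin M × ℕ × ℕ → Fin n) : Param d :=
  (1 / ((M : ℝ) * κ)) • ∑ m, ∑ k ∈ Finset.range κ, gradNoise P proto S ηl ηg κ ω₀ m r k ξ

lemma measurable_roundNoise (r : ℕ) : Measurable (roundNoise P proto S ηl ηg κ ω₀ r) := by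
  have h := fun m k => measurable_gradNoise (P := P) (proto := proto) (S := S) (ηl := ηl)
    (ηg := ηg) (κ := κ) (ω₀ := ω₀) m r k
  unfold roundNoise
  fun_prop

section

variable [NeZero n] (hd : ∀ m z, Differentiable ℝ (sampleLoss P m z))
  {s σ : ℝ} (hW : ∀ ξ m r, ∀ k ≤ κ, localIterate P proto S ξ ηl ηg κ ω₀ m r k ∈ P.W)
  (hs : ∀ m i, ∀ ω ∈ P.W, ‖∇ (sampleLoss P m (S m i)) ω - ∇ (localLoss P S m) ω‖ ≤ s)
include hW hs

omit [NeZero n] in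
lemma norm_roundNoise_le (hM : 0 < M) (hκ : 0 < κ) (r : ℕ) (ξ : Fin M × ℕ × ℕ → Fin n) :
    ‖roundNoise P proto S ηl ηg κ ω₀ r ξ‖ ≤ s := by
  have hM' : (0 : ℝ) < M := by exact_mod_cast hM
  have hκ' : (0 : ℝ) < κ := by exact_mod_cast hκ
  rw [roundNoise, norm_smul, Real.norm_of_nonneg (by positivity)]
  have : ‖∑ m, ∑ k ∈ Finset.range κ, gradNoise P proto S ηl ηg κ ω₀ m r k ξ‖ ≤
      ∑ _m : Fin M, ∑ _k ∈ Finset.range κ, s :=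
    norm_sum_le_of_le _ fun m _ => norm_sum_le_of_le _ fun k hk =>
      norm_gradNoise_le hW hs m r (Finset.mem_range.1 hk).le ξ
  simp only [Finset.sum_const, Finset.card_univ, Fintype.card_fin, Finset.card_range,
    nsmul_eq_mul] at this
  calc _ ≤ 1 / ((M : ℝ) * κ) * (M * (κ * s)) := by gcongr
    _ = s := by field_simp

lemma integrable_inner_gradNoise (m : Fin M) (r : ℕ) {k : ℕ} (hk : k ≤ κ)
    {h : (Fin M × ℕ × ℕ → Fin n) → Param d} (hm : Measurable h) {B : ℝ} (hB : ∀ ξ, ‖h ξ‖ ≤ B) :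
    Integrable (fun ξ => inner ℝ (gradNoise P proto S ηl ηg κ ω₀ m r k ξ) (h ξ))
      (seedLaw M n) := by
  refine Integrable.of_bound ((measurable_gradNoise m r k).inner hm).aestronglyMeasurable (s * B)
    (Filter.Eventually.of_forall fun ξ => ?_)
  have h1 := norm_gradNoise_le hW hs m r hk ξ
  exact (norm_inner_le_norm _ _).trans
    (mul_le_mul h1 (hB ξ) (norm_nonneg _) ((norm_nonneg _).trans h1))

include hd

/-- The noise of a round is centred given the global model at the start of the round. -/
lemma integral_inner_roundNoise_eq_zero (r : ℕ) {xs : Param d} {B : ℝ}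
    (hB : ∀ ξ, ‖(serverState P proto S ξ ηl ηg κ ω₀ r).1 - xs‖ ≤ B) :
    ∫ ξ, inner ℝ (roundNoise P proto S ηl ηg κ ω₀ r ξ)
      ((serverState P proto S ξ ηl ηg κ ω₀ r).1 - xs) ∂(seedLaw M n) = 0 := by
  simp only [roundNoise, inner_smul_left, sum_inner, conj_trivial]
  have hm : Measurable fun ξ => (serverState P proto S ξ ηl ηg κ ω₀ r).1 - xs :=
    (measurable_serverState r).1.sub_const _
  have hi : ∀ m, ∀ k ∈ Finset.range κ, Integrable (fun ξ =>
      inner ℝ (gradNoise P proto S ηl ηg κ ω₀ m r k ξ)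
        ((serverState P proto S ξ ηl ηg κ ω₀ r).1 - xs)) (seedLaw M n) := fun m k hk =>
    integrable_inner_gradNoise hW hs m r (Finset.mem_range.1 hk).le hm hB
  rw [integral_const_mul, integral_finsetSum _ fun m _ => integrable_finsetSum _ (hi m)]
  simp_rw [integral_finsetSum _ (hi _)]
  refine mul_eq_zero_of_right _ (Finset.sum_eq_zero fun m _ => Finset.sum_eq_zero fun k hk => ?_)
  refine integral_inner_gradNoise_eq_zero hd m r k (hi m k hk) fun ξ j => ?_
  rw [serverState_congr]
  intro m' r' hr' k'
  exact Function.update_of_ne (by simp [hr'.ne]) _ _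

/-- Averaging over agents and local steps divides the variance by their number. -/
lemma integral_norm_roundNoise_sq_le (hM : 0 < M) (hκ : 0 < κ)
    (hσ : ∀ m, ∀ ω ∈ P.W,
      (1 / (n : ℝ)) * ∑ i, ‖∇ (sampleLoss P m (S m i)) ω - ∇ (localLoss P S m) ω‖ ^ 2 ≤ σ ^ 2)
    (r : ℕ) :
    ∫ ξ, ‖roundNoise P proto S ηl ηg κ ω₀ r ξ‖ ^ 2 ∂(seedLaw M n) ≤ σ ^ 2 / (κ * M) := by
  have hM' : (0 : ℝ) < M := by exact_mod_cast hM
  have hκ' : (0 : ℝ) < κ := by exact_mod_cast hκ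
  have hi : ∀ m, ∀ k < κ, ∀ m', ∀ k' < κ, Integrable (fun ξ =>
      inner ℝ (gradNoise P proto S ηl ηg κ ω₀ m r k ξ)
        (gradNoise P proto S ηl ηg κ ω₀ m' r k' ξ)) (seedLaw M n) := fun m k hk m' k' hk' =>
    integrable_inner_gradNoise hW hs m r hk.le (measurable_gradNoise m' r k')
      (norm_gradNoise_le hW hs m' r hk'.le)
  have h0 : ∀ m, ∀ k < κ, ∀ m', ∀ k' < κ, m ≠ m' ∨ k' < k →
      ∫ ξ, inner ℝ (gradNoise P proto S ηl ηg κ ω₀ m r k ξ)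
        (gradNoise P proto S ηl ηg κ ω₀ m' r k' ξ) ∂(seedLaw M n) = 0 := by
    intro m k hk m' k' hk' hne
    exact integral_inner_gradNoise_eq_zero hd m r k (hi m k hk m' k' hk') fun ξ j =>
      gradNoise_update_of_ne hne ξ j
  have h1 : ∀ m, ∀ k < κ,
      ∫ ξ, ‖gradNoise P proto S ηl ηg κ ω₀ m r k ξ‖ ^ 2 ∂(seedLaw M n) ≤ σ ^ 2 := by
    intro m k hk
    have hint : Integrable (fun ξ => ‖gradNoise P proto S ηl ηg κ ω₀ m r k ξ‖ ^ 2)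
        (seedLaw M n) := by
      simpa only [real_inner_self_eq_norm_sq] using hi m k hk m k hk
    rw [integral_seedLaw_resample (m, r, k) hint]
    have hb : ∀ ξ, (1 / (n : ℝ)) * ∑ j, ‖gradNoise P proto S ηl ηg κ ω₀ m r k
        (Function.update ξ (m, r, k) j)‖ ^ 2 ≤ σ ^ 2 := by
      intro ξ
      simp only [gradNoise_update]
      exact hσ m _ (hW ξ m r k hk.le)
    refine (integral_mono_of_nonneg (Filter.Eventually.of_forall fun ξ => by positivity)
      (integrable_const (σ ^ 2)) (Filter.Eventually.of_forall hb)).trans_eq ?_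
    simp
  have key := integral_norm_sum_sq_le_of_orthogonal (ρ := seedLaw M n) (c := σ ^ 2)
    (ζ := fun p : Fin M × ℕ => gradNoise P proto S ηl ηg κ ω₀ p.1 r p.2)
    (Finset.univ ×ˢ Finset.range κ)
    (by
      rintro ⟨m, k⟩ hp ⟨m', k'⟩ hq
      simp only [Finset.mem_product, Finset.mem_univ, Finset.mem_range, true_and] at hp hq
      exact hi m k hp m' k' hq)
    (by
      rintro ⟨m, k⟩ hp ⟨m', k'⟩ hq hne
      simp only [Finset.mem_product, Finset.mem_univ, Finset.mem_range, true_and] at hp hq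
      by_cases hm : m = m'
      · subst hm
        rcases lt_trichotomy k k' with h | h | h
        · rw [← h0 m k' hq m k hp (Or.inr h)]
          exact integral_congr_ae (Filter.Eventually.of_forall fun ξ => real_inner_comm _ _)
        · exact absurd (by rw [h]) hne
        · exact h0 m k hp m k' hq (Or.inr h)
      · exact h0 m k hp m' k' hq (Or.inl hm))
    (by
      rintro ⟨m, k⟩ hp
      simp only [Finset.mem_product, Finset.mem_univ, Finset.mem_range, true_and] at hp
      exact h1 m k hp)
  simp only [Finset.sum_product] at key
  simp only [roundNoise, norm_smul, mul_pow]
  rw [integral_const_mul, Real.norm_of_nonneg (by positivity)]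
  rw [Finset.card_product, Finset.card_univ, Fintype.card_fin, Finset.card_range] at key
  push_cast at key
  calc _ ≤ (1 / ((M : ℝ) * κ)) ^ 2 * (M * κ * σ ^ 2) := by gcongr
    _ = σ ^ 2 / (κ * M) := by field_simp

end

end Round

/-! ### Convergence of the protocols -/

/-- Unrolling a perturbed contraction. -/
lemma sum_le_of_contraction {a G : ℕ → ℝ} {q η ν : ℝ} (hq : 0 ≤ q) (N : ℕ)
    (h : ∀ r < N, a (r + 1) ≤ q * a r - η * G r + ν) :
    a N + η * ∑ r ∈ Finset.range N, q ^ (N - 1 - r) * G r ≤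
      q ^ N * a 0 + ν * ∑ r ∈ Finset.range N, q ^ (N - 1 - r) := by
  induction N with
  | zero => simp
  | succ N ih =>
    have h1 := ih fun r hr => h r (by omega)
    have h2 := h N (by omega)
    have e : ∀ u : ℕ → ℝ, ∑ r ∈ Finset.range (N + 1), q ^ (N + 1 - 1 - r) * u r =
        q * (∑ r ∈ Finset.range N, q ^ (N - 1 - r) * u r) + u N := by
      intro u
      rw [Finset.sum_range_succ, Finset.mul_sum]
      congr 1
      · refine Finset.sum_congr rfl fun r hr => ?_
        have : N + 1 - 1 - r = (N - 1 - r) + 1 := by have := Finset.mem_range.1 hr; omega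
        rw [this, pow_succ]; ring
      · simp
    have e1 := e G
    have e2 := e fun _ => 1
    simp only [mul_one] at e2
    rw [e1, e2, pow_succ]
    have h3 := mul_le_mul_of_nonneg_left h1 hq
    linarith

section

variable {M K d : ℕ} {X : Fin M → Type*} {P : Model K d X} {proto : Protocol}
  {n : ℕ} {S : Dataset K n X} {ηl ηg : ℝ} {κ : ℕ} {ω₀ : Param d} {μ β : ℝ}

lemma differentiable_localLoss (hd : ∀ m z, Differentiable ℝ (sampleLoss P m z)) (m : Fin M) :
    Differentiable ℝ (localLoss P S m) :=
  (Differentiable.fun_sum fun i _ => hd m (S m i)).const_mul _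

lemma differentiable_globalLoss (hd : ∀ m z, Differentiable ℝ (sampleLoss P m z)) :
    Differentiable ℝ (globalLoss P S) :=
  (Differentiable.fun_sum fun m _ => differentiable_localLoss hd m).const_mul _

lemma IsRegular.quadraticBounds_localLoss {σ : ℝ} (h : IsRegular P n μ β σ)
    (hd : ∀ m z, Differentiable ℝ (sampleLoss P m z)) (S : Dataset K n X) (m : Fin M) :
    QuadraticBounds μ β (localLoss P S m) (∇ (localLoss P S m)) :=
  ⟨add_inner_gradient_le_of_strongConvexOn (h.strongConvex S m) (differentiable_localLoss hd m),
    fun x y => by linarith [h.smooth S m x y]⟩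

lemma quadraticBounds_globalLoss (hM : 0 < M)
    (h : ∀ m, QuadraticBounds μ β (localLoss P S m) (∇ (localLoss P S m))) :
    QuadraticBounds μ β (globalLoss P S)
      (fun ω => (1 / (M : ℝ)) • ∑ m, ∇ (localLoss P S m) ω) := by
  have : NeZero M := ⟨hM.ne'⟩
  have h1 := QuadraticBounds.average h
  rw [Fintype.card_fin] at h1
  exact h1

/-- The local drift biases the direction of a round by no more than the drift of the gradients. -/
lemma norm_roundGrad_sub_le (hM : 0 < M) (hκ : 0 < κ) (hβ : 0 ≤ β)
    (hlip : ∀ m x y, ‖∇ (localLoss P S m) x - ∇ (localLoss P S m) y‖ ≤ β * ‖x - y‖)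
    {ξ : Fin M × ℕ × ℕ → Fin n} {r : ℕ} {τ : ℝ}
    (hτ : ∀ m, ∀ k < κ, ‖localIterate P proto S ξ ηl ηg κ ω₀ m r k -
      (serverState P proto S ξ ηl ηg κ ω₀ r).1‖ ≤ τ) :
    ‖roundGrad P proto S ξ ηl ηg κ ω₀ r - roundNoise P proto S ηl ηg κ ω₀ r ξ -
      (1 / (M : ℝ)) • ∑ m, ∇ (localLoss P S m) (serverState P proto S ξ ηl ηg κ ω₀ r).1‖ ≤
      β * τ := by
  have hM' : (0 : ℝ) < M := by exact_mod_cast hM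
  have hκ' : (0 : ℝ) < κ := by exact_mod_cast hκ
  set x := (serverState P proto S ξ ηl ηg κ ω₀ r).1
  have e : roundGrad P proto S ξ ηl ηg κ ω₀ r - roundNoise P proto S ηl ηg κ ω₀ r ξ -
      (1 / (M : ℝ)) • ∑ m, ∇ (localLoss P S m) x =
      (1 / ((M : ℝ) * κ)) • ∑ m, ∑ k ∈ Finset.range κ,
        (∇ (localLoss P S m) (localIterate P proto S ξ ηl ηg κ ω₀ m r k) -
          ∇ (localLoss P S m) x) := by
    have e1 : (1 / (M : ℝ)) • ∑ m, ∇ (localLoss P S m) x = (1 / ((M : ℝ) * κ)) •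
        ∑ m, ∑ _k ∈ Finset.range κ, ∇ (localLoss P S m) x := by
      simp only [Finset.sum_const, Finset.card_range, ← Nat.cast_smul_eq_nsmul ℝ,
        ← Finset.smul_sum, smul_smul]
      congr 1
      field_simp
    rw [e1, roundGrad, roundNoise, ← smul_sub, ← smul_sub]
    simp only [← Finset.sum_sub_distrib, gradNoise]
    congr 1
    refine Finset.sum_congr rfl fun m _ => Finset.sum_congr rfl fun k _ => ?_
    abel
  rw [e, norm_smul, Real.norm_of_nonneg (by positivity)]
  have : ‖∑ m, ∑ k ∈ Finset.range κ,
        (∇ (localLoss P S m) (localIterate P proto S ξ ηl ηg κ ω₀ m r k) -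
          ∇ (localLoss P S m) x)‖ ≤ ∑ _m : Fin M, ∑ _k ∈ Finset.range κ, (β * τ) :=
    norm_sum_le_of_le _ fun m _ => norm_sum_le_of_le _ fun k hk =>
      (hlip m _ _).trans (mul_le_mul_of_nonneg_left (hτ m k (Finset.mem_range.1 hk)) hβ)
  simp only [Finset.sum_const, Finset.card_univ, Fintype.card_fin, Finset.card_range,
    nsmul_eq_mul] at this
  calc _ ≤ 1 / ((M : ℝ) * κ) * (M * (κ * (β * τ))) := by gcongr
    _ = β * τ := by field_simp

lemma integrable_comp_of_bounded [NeZero n] {V : Type*} [NormedAddCommGroup V] [MeasurableSpace V]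
    [BorelSpace V] [SecondCountableTopology V]
    {x : (Fin M × ℕ × ℕ → Fin n) → Param d} (hx : Measurable x) {B : ℝ} {xs : Param d}
    (hB : ∀ ξ, ‖x ξ - xs‖ ≤ B) {F : Param d → V} (hF : Continuous F) :
    Integrable (fun ξ => F (x ξ)) (seedLaw M n) := by
  have hc : IsCompact (F '' Metric.closedBall xs B) := (isCompact_closedBall xs B).image hF
  obtain ⟨C, hC⟩ := hc.isBounded.exists_norm_le
  exact Integrable.of_bound (hF.measurable.comp hx).aestronglyMeasurable C
    (Filter.Eventually.of_forall fun ξ =>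
      hC _ ⟨x ξ, mem_closedBall_iff_norm.2 (hB ξ), rfl⟩)

/-- The expected effect of a round on the distance to the optimum. -/
lemma expected_descent [NeZero n] (hd : ∀ m z, Differentiable ℝ (sampleLoss P m z))
    (hM : 0 < M) (hκ : 0 < κ) (hμ : 0 < μ) (hβ : 0 < β)
    (hq : ∀ m, QuadraticBounds μ β (localLoss P S m) (∇ (localLoss P S m)))
    {xs : Param d} (hxs : IsEmpiricalOptimum P S xs)
    (hη : 0 < κ * ηg * ηl) (hη' : 16 * β * (κ * ηg * ηl) ≤ 1) {s σ τ B : ℝ}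
    (hW : ∀ ξ m r, ∀ k ≤ κ, localIterate P proto S ξ ηl ηg κ ω₀ m r k ∈ P.W)
    (hs : ∀ m i, ∀ ω ∈ P.W, ‖∇ (sampleLoss P m (S m i)) ω - ∇ (localLoss P S m) ω‖ ≤ s)
    (hσ : ∀ m, ∀ ω ∈ P.W,
      (1 / (n : ℝ)) * ∑ i, ‖∇ (sampleLoss P m (S m i)) ω - ∇ (localLoss P S m) ω‖ ^ 2 ≤ σ ^ 2)
    {r : ℕ} (hτ : ∀ ξ m, ∀ k < κ, ‖localIterate P proto S ξ ηl ηg κ ω₀ m r k -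
      (serverState P proto S ξ ηl ηg κ ω₀ r).1‖ ≤ τ)
    (hB : ∀ ξ, ‖(serverState P proto S ξ ηl ηg κ ω₀ r).1 - xs‖ ≤ B) :
    ∫ ξ, ‖(serverState P proto S ξ ηl ηg κ ω₀ (r + 1)).1 - xs‖ ^ 2 ∂(seedLaw M n) ≤
      (1 - μ * (κ * ηg * ηl)) *
          ∫ ξ, ‖(serverState P proto S ξ ηl ηg κ ω₀ r).1 - xs‖ ^ 2 ∂(seedLaw M n) -
        κ * ηg * ηl / 2 * ∫ ξ, (globalLoss P S (serverState P proto S ξ ηl ηg κ ω₀ r).1 -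
          globalLoss P S xs) ∂(seedLaw M n) +
        (2 * (κ * ηg * ηl) ^ 2 * (σ ^ 2 / (κ * M)) +
          (2 * (κ * ηg * ηl) / μ + 4 * (κ * ηg * ηl) ^ 2) * (β * τ) ^ 2) := by
  set η := κ * ηg * ηl with hηdef
  have hQ := quadraticBounds_globalLoss hM hq
  set x := fun ξ => (serverState P proto S ξ ηl ηg κ ω₀ r).1 with hx
  have hxm : Measurable x := (measurable_serverState r).1
  set ζ := roundNoise P proto S ηl ηg κ ω₀ r with hζ
  have hζm : Measurable ζ := measurable_roundNoise r
  have hζb : ∀ ξ, ‖ζ ξ‖ ≤ s := norm_roundNoise_le hW hs hM hκ r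
  have i1 : Integrable (fun ξ => ‖x ξ - xs‖ ^ 2) (seedLaw M n) :=
    integrable_comp_of_bounded hxm hB (F := fun y => ‖y - xs‖ ^ 2) (by fun_prop)
  have i2 : Integrable (fun ξ => globalLoss P S (x ξ) - globalLoss P S xs) (seedLaw M n) :=
    integrable_comp_of_bounded hxm hB (F := fun y => globalLoss P S y - globalLoss P S xs)
      ((differentiable_globalLoss hd).continuous.sub continuous_const)
  have i3 : Integrable (fun ξ => ‖ζ ξ‖ ^ 2) (seedLaw M n) :=
    integrable_comp_of_bounded hζm (xs := 0) (B := s) (by simpa using hζb)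
      (F := fun y => ‖y‖ ^ 2) (by fun_prop)
  have i4 : Integrable (fun ξ => inner ℝ (ζ ξ) (x ξ - xs)) (seedLaw M n) := by
    refine Integrable.of_bound (hζm.inner (hxm.sub_const _)).aestronglyMeasurable (s * B)
      (Filter.Eventually.of_forall fun ξ => ?_)
    exact (norm_inner_le_norm _ _).trans
      (mul_le_mul (hζb ξ) (hB ξ) (norm_nonneg _) ((norm_nonneg _).trans (hζb ξ)))
  have h0 : ∫ ξ, inner ℝ (ζ ξ) (x ξ - xs) ∂(seedLaw M n) = 0 :=
    integral_inner_roundNoise_eq_zero hd hW hs r hB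
  have hv : ∫ ξ, ‖ζ ξ‖ ^ 2 ∂(seedLaw M n) ≤ σ ^ 2 / (κ * M) :=
    integral_norm_roundNoise_sq_le hd hW hs hM hκ hσ r
  have key : ∀ ξ, ‖(serverState P proto S ξ ηl ηg κ ω₀ (r + 1)).1 - xs‖ ^ 2 ≤
      (1 - μ * η) * ‖x ξ - xs‖ ^ 2 - η / 2 * (globalLoss P S (x ξ) - globalLoss P S xs) +
      (2 * η ^ 2 * ‖ζ ξ‖ ^ 2 + (2 * η / μ + 4 * η ^ 2) * (β * τ) ^ 2 -
        2 * η * inner ℝ (ζ ξ) (x ξ - xs)) := by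
    intro ξ
    have hb := norm_roundGrad_sub_le hM hκ hβ.le (fun m => (hq m).lipschitz hμ.le hβ) (hτ ξ)
    have h1 := hQ.descent_step hμ hβ hxs hη hη' (x ξ) (roundGrad P proto S ξ ηl ηg κ ω₀ r - ζ ξ -
      (1 / (M : ℝ)) • ∑ m, ∇ (localLoss P S m) (x ξ)) (ζ ξ)
    have e : (1 / (M : ℝ)) • ∑ m, ∇ (localLoss P S m) (x ξ) +
        (roundGrad P proto S ξ ηl ηg κ ω₀ r - ζ ξ -
          (1 / (M : ℝ)) • ∑ m, ∇ (localLoss P S m) (x ξ)) + ζ ξ =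
        roundGrad P proto S ξ ηl ηg κ ω₀ r := by abel
    simp only [e] at h1
    rw [serverState_succ_fst hκ]
    refine h1.trans ?_
    have h2 : (2 * η / μ + 4 * η ^ 2) * ‖roundGrad P proto S ξ ηl ηg κ ω₀ r - ζ ξ -
        (1 / (M : ℝ)) • ∑ m, ∇ (localLoss P S m) (x ξ)‖ ^ 2 ≤
        (2 * η / μ + 4 * η ^ 2) * (β * τ) ^ 2 := by gcongr
    linarith
  have j12 : Integrable (fun ξ => (1 - μ * η) * ‖x ξ - xs‖ ^ 2 -
      η / 2 * (globalLoss P S (x ξ) - globalLoss P S xs)) (seedLaw M n) :=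
    (i1.const_mul _).sub (i2.const_mul _)
  have j3 : Integrable (fun ξ => 2 * η ^ 2 * ‖ζ ξ‖ ^ 2 +
      (2 * η / μ + 4 * η ^ 2) * (β * τ) ^ 2) (seedLaw M n) :=
    (i3.const_mul _).add (integrable_const _)
  have j34 : Integrable (fun ξ => 2 * η ^ 2 * ‖ζ ξ‖ ^ 2 +
      (2 * η / μ + 4 * η ^ 2) * (β * τ) ^ 2 - 2 * η * inner ℝ (ζ ξ) (x ξ - xs)) (seedLaw M n) :=
    j3.sub (i4.const_mul _)
  have hmono := integral_mono_of_nonneg (μ := seedLaw M n)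
    (Filter.Eventually.of_forall fun ξ => by positivity)
    (j12.add j34) (Filter.Eventually.of_forall key)
  refine hmono.trans ?_
  have e : ∫ ξ, ((1 - μ * η) * ‖x ξ - xs‖ ^ 2 -
      η / 2 * (globalLoss P S (x ξ) - globalLoss P S xs) +
      (2 * η ^ 2 * ‖ζ ξ‖ ^ 2 + (2 * η / μ + 4 * η ^ 2) * (β * τ) ^ 2 -
        2 * η * inner ℝ (ζ ξ) (x ξ - xs))) ∂(seedLaw M n) =
      (1 - μ * η) * ∫ ξ, ‖x ξ - xs‖ ^ 2 ∂(seedLaw M n) -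
      η / 2 * ∫ ξ, (globalLoss P S (x ξ) - globalLoss P S xs) ∂(seedLaw M n) +
      (2 * η ^ 2 * ∫ ξ, ‖ζ ξ‖ ^ 2 ∂(seedLaw M n) + (2 * η / μ + 4 * η ^ 2) * (β * τ) ^ 2) := by
    rw [integral_add j12 j34, integral_sub (i1.const_mul _) (i2.const_mul _),
      integral_sub j3 (i4.const_mul _), integral_add (i3.const_mul _) (integrable_const _)]
    simp only [integral_const_mul, h0, integral_const, probReal_univ, smul_eq_mul, one_mul,
      mul_zero, sub_zero]
  refine (le_of_eq e).trans ?_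
  gcongr

end

/-! ### Weights, step sizes and the number of rounds -/

/-- The weights under which the contraction of all rounds telescopes. -/
noncomputable def geomWeight (q : ℝ) (N r : ℕ) : ℝ :=
  q ^ (N - 1 - r) / ∑ j ∈ Finset.range N, q ^ j

lemma geomWeight_nonneg {q : ℝ} (hq : 0 ≤ q) (N r : ℕ) : 0 ≤ geomWeight q N r := by
  unfold geomWeight; positivity

lemma geom_sum_pos_of_nonneg {q : ℝ} (hq : 0 ≤ q) {N : ℕ} (hN : 0 < N) :
    0 < ∑ j ∈ Finset.range N, q ^ j :=
  Finset.sum_pos' (fun j _ => pow_nonneg hq j) ⟨0, Finset.mem_range.2 hN, by simp⟩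

lemma sum_geomWeight {q : ℝ} (hq : 0 ≤ q) {N : ℕ} (hN : 0 < N) :
    ∑ r ∈ Finset.range N, geomWeight q N r = 1 := by
  unfold geomWeight
  rw [← Finset.sum_div, Finset.sum_range_reflect (fun j => q ^ j) N]
  exact div_self (geom_sum_pos_of_nonneg hq hN).ne'

/-- The contribution of the initial distance is below the accuracy after logarithmically many
rounds. -/
lemma geom_initial_le {μ η ε D : ℝ} (hμ : 0 < μ) (hη : 0 < η) (hμη : μ * η < 1) (hε : 0 < ε)
    (hD : 0 ≤ D) {N : ℕ} (hN : Real.log (2 + μ * D / ε) / (μ * η) ≤ N) :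
    2 / η * ((1 - μ * η) ^ N * D / ∑ j ∈ Finset.range N, (1 - μ * η) ^ j) ≤ 2 * ε := by
  set q := 1 - μ * η with hq
  set L := 2 + μ * D / ε with hL
  have hq0 : 0 ≤ q := by linarith
  have hLp : 2 ≤ L := by have : 0 ≤ μ * D / ε := by positivity
                         linarith
  have hμη0 : 0 < μ * η := by positivity
  have hqN : q ^ N ≤ 1 / L := by
    calc q ^ N ≤ Real.exp (-(μ * η)) ^ N := by
          gcongr
          have := Real.add_one_le_exp (-(μ * η))
          linarith
      _ = Real.exp (-(N * (μ * η))) := by rw [← Real.exp_nat_mul]; ring_nf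
      _ ≤ Real.exp (-Real.log L) := by
          apply Real.exp_le_exp.2
          rw [div_le_iff₀ hμη0] at hN
          linarith
      _ = 1 / L := by rw [Real.exp_neg, Real.exp_log (by linarith), one_div]
  have hS : (∑ j ∈ Finset.range N, q ^ j) * (μ * η) = 1 - q ^ N := by
    have := geom_sum_mul_neg q N
    rwa [show 1 - q = μ * η by rw [hq]; ring] at this
  have h1L : 1 / L ≤ 1 / 2 := by gcongr
  have hS' : ∑ j ∈ Finset.range N, q ^ j = (1 - q ^ N) / (μ * η) := by
    rw [eq_div_iff hμη0.ne', hS]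
  have hpos : 0 < 1 - q ^ N := by linarith
  rw [hS']
  have e : 2 / η * (q ^ N * D / ((1 - q ^ N) / (μ * η))) = 2 * (μ * D) * q ^ N / (1 - q ^ N) := by
    field_simp
  rw [e, div_le_iff₀ hpos]
  have hLinv : q ^ N * L ≤ 1 := by
    have := mul_le_mul_of_nonneg_right hqN (by linarith : 0 ≤ L)
    rwa [one_div_mul_cancel (by linarith)] at this
  have hLε : L * ε = 2 * ε + μ * D := by rw [hL]; field_simp
  nlinarith [pow_nonneg hq0 N]

/-- The step size is chosen so that the noise stays below the accuracy. -/
lemma noise_contribution_le {β σ ε κ M C : ℝ} (hC : 16 ≤ C) (hβ : 0 < β) (hε : 0 < ε)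
    (hκ : 0 < κ) (hM : 0 < M) :
    2 / (1 / (C * (β + σ ^ 2 / (ε * κ * M)))) *
      (2 * (1 / (C * (β + σ ^ 2 / (ε * κ * M)))) ^ 2 * (σ ^ 2 / (κ * M))) ≤ ε := by
  have e0 : σ ^ 2 / (κ * M) = ε * (σ ^ 2 / (ε * κ * M)) := by field_simp
  rw [e0]
  have hv0 : 0 ≤ σ ^ 2 / (ε * κ * M) := by positivity
  generalize σ ^ 2 / (ε * κ * M) = v at hv0 ⊢
  have e : 2 / (1 / (C * (β + v))) * (2 * (1 / (C * (β + v))) ^ 2 * (ε * v)) =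
      4 * ε * v / (C * (β + v)) := by field_simp; ring
  rw [e, div_le_iff₀ (by positivity)]
  have h1 : 16 * (β + v) ≤ C * (β + v) := by gcongr
  have h2 := mul_le_mul_of_nonneg_left h1 hε.le
  nlinarith [mul_pos hε hβ, mul_nonneg hε.le hv0]

/-- A large global step size makes the bias from the local drift negligible: the lower bound on
`ηg` keeps the drift of the gradients below `√(μ ε / 5)`. -/
lemma bias_contribution_le {β μ ε η ηl ηg κ Z : ℝ} (hβ : 0 < β) (hμ : 0 < μ) (hμβ : μ ≤ β)
    (hε : 0 < ε) (hη : 0 < η) (h16 : 16 * β * η ≤ 1) (hηl : 0 < ηl)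
    (hκηl : 2 * κ * ηl * ηg = 2 * η) (hηg : 1 + Z / √(μ * ε / 5) ≤ ηg) (hκ : 0 < κ)
    (hZ : 0 ≤ Z) :
    2 / η * ((2 * η / μ + 4 * η ^ 2) * (β * (2 * κ * ηl * Z)) ^ 2) ≤ ε := by
  have hβη : 0 < β * η := mul_pos hβ hη
  have hpos : 0 < √(μ * ε / 5) := by positivity
  have h1 : β * (2 * κ * ηl * Z) ≤ √(μ * ε / 5) := by
    have h2 : Z ≤ √(μ * ε / 5) * ηg := by
      have := mul_le_mul_of_nonneg_left hηg hpos.le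
      rw [mul_add, mul_div_cancel₀ _ hpos.ne'] at this
      linarith
    calc β * (2 * κ * ηl * Z) ≤ β * (2 * κ * ηl * (√(μ * ε / 5) * ηg)) := by gcongr
      _ = β * (2 * κ * ηl * ηg) * √(μ * ε / 5) := by ring
      _ = (2 * β * η) * √(μ * ε / 5) := by rw [hκηl]; ring
      _ ≤ 1 * √(μ * ε / 5) := by gcongr; linarith
      _ = √(μ * ε / 5) := one_mul _
  have h2 : (β * (2 * κ * ηl * Z)) ^ 2 ≤ μ * ε / 5 := by
    calc (β * (2 * κ * ηl * Z)) ^ 2 ≤ √(μ * ε / 5) ^ 2 := by gcongr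
      _ = μ * ε / 5 := Real.sq_sqrt (by positivity)
  calc 2 / η * ((2 * η / μ + 4 * η ^ 2) * (β * (2 * κ * ηl * Z)) ^ 2)
      ≤ 2 / η * ((2 * η / μ + 4 * η ^ 2) * (μ * ε / 5)) := by gcongr
    _ = ε / 5 * (4 + 8 * (μ * η)) := by field_simp; ring
    _ ≤ ε / 5 * 5 := by
        gcongr
        have : μ * η ≤ β * η := by gcongr
        linarith
    _ = ε := by ring

section

variable {M K d : ℕ} {X : Fin M → Type*} {P : Model K d X} {proto : Protocol}
  {n : ℕ} {S : Dataset K n X} {ηl ηg : ℝ} {κ : ℕ} {ω₀ : Param d} {μ β : ℝ}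

/-- The optimization error of the weighted average of the global models. -/
lemma lintegral_gap_output_le [NeZero n] (hd : ∀ m z, Differentiable ℝ (sampleLoss P m z))
    (hM : 0 < M) (hκ : 0 < κ) (hμ : 0 < μ) (hβ : 0 < β)
    (hq : ∀ m, QuadraticBounds μ β (localLoss P S m) (∇ (localLoss P S m)))
    {xs : Param d} (hxs : IsEmpiricalOptimum P S xs)
    (hη : 0 < κ * ηg * ηl) (hη' : 16 * β * (κ * ηg * ηl) ≤ 1) (hμη : μ * (κ * ηg * ηl) ≤ 1)
    {s σ τ B : ℝ}
    (hW : ∀ ξ m r, ∀ k ≤ κ, localIterate P proto S ξ ηl ηg κ ω₀ m r k ∈ P.W)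
    (hs : ∀ m i, ∀ ω ∈ P.W, ‖∇ (sampleLoss P m (S m i)) ω - ∇ (localLoss P S m) ω‖ ≤ s)
    (hσ : ∀ m, ∀ ω ∈ P.W,
      (1 / (n : ℝ)) * ∑ i, ‖∇ (sampleLoss P m (S m i)) ω - ∇ (localLoss P S m) ω‖ ^ 2 ≤ σ ^ 2)
    {N : ℕ} (hN : 0 < N)
    (hτ : ∀ r < N, ∀ ξ m, ∀ k < κ, ‖localIterate P proto S ξ ηl ηg κ ω₀ m r k -
      (serverState P proto S ξ ηl ηg κ ω₀ r).1‖ ≤ τ)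
    (hB : ∀ r < N, ∀ ξ, ‖(serverState P proto S ξ ηl ηg κ ω₀ r).1 - xs‖ ≤ B) :
    ∫⁻ ξ, ENNReal.ofReal (globalLoss P S (output P proto
        ⟨ηl, ηg, N - 1, κ, geomWeight (1 - μ * (κ * ηg * ηl)) N⟩ ω₀ S ξ) - globalLoss P S xs)
        ∂(seedLaw M n) ≤
      ENNReal.ofReal (2 / (κ * ηg * ηl) * ((1 - μ * (κ * ηg * ηl)) ^ N * ‖ω₀ - xs‖ ^ 2 /
          ∑ j ∈ Finset.range N, (1 - μ * (κ * ηg * ηl)) ^ j) +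
        2 / (κ * ηg * ηl) * (2 * (κ * ηg * ηl) ^ 2 * (σ ^ 2 / (κ * M)) +
          (2 * (κ * ηg * ηl) / μ + 4 * (κ * ηg * ηl) ^ 2) * (β * τ) ^ 2)) := by
  set η := κ * ηg * ηl with hηdef
  set q := 1 - μ * η with hqdef
  have hq0 : 0 ≤ q := by linarith
  set ν := 2 * η ^ 2 * (σ ^ 2 / (κ * M)) + (2 * η / μ + 4 * η ^ 2) * (β * τ) ^ 2 with hν
  have hQ := quadraticBounds_globalLoss hM hq
  set x : ℕ → (Fin M × ℕ × ℕ → Fin n) → Param d :=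
    fun r ξ => (serverState P proto S ξ ηl ηg κ ω₀ r).1 with hx
  have hi : ∀ r < N, Integrable (fun ξ => globalLoss P S (x r ξ) - globalLoss P S xs)
      (seedLaw M n) := fun r hr =>
    integrable_comp_of_bounded (measurable_serverState r).1 (hB r hr)
      (F := fun y => globalLoss P S y - globalLoss P S xs)
      ((differentiable_globalLoss hd).continuous.sub continuous_const)
  set G : ℕ → ℝ := fun r => ∫ ξ, (globalLoss P S (x r ξ) - globalLoss P S xs) ∂(seedLaw M n)
  set a : ℕ → ℝ := fun r => ∫ ξ, ‖x r ξ - xs‖ ^ 2 ∂(seedLaw M n) with ha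
  have hrec := sum_le_of_contraction (a := a) (G := G) (η := η / 2) (ν := ν) hq0 N
    fun r hr => expected_descent hd hM hκ hμ hβ hq hxs hη hη' hW hs hσ (hτ r hr) (hB r hr)
  have ha0 : a 0 = ‖ω₀ - xs‖ ^ 2 := by simp [ha, hx, serverState]
  have haN : 0 ≤ a N := integral_nonneg fun ξ => by positivity
  have hSpos := geom_sum_pos_of_nonneg hq0 hN
  rw [Finset.sum_range_reflect (fun j => q ^ j) N, ha0] at hrec
  have hsum : ∑ r ∈ Finset.range N, geomWeight q N r * G r ≤
      2 / η * (q ^ N * ‖ω₀ - xs‖ ^ 2 / ∑ j ∈ Finset.range N, q ^ j) + 2 / η * ν := by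
    have e : ∑ r ∈ Finset.range N, geomWeight q N r * G r =
        (∑ r ∈ Finset.range N, q ^ (N - 1 - r) * G r) / ∑ j ∈ Finset.range N, q ^ j := by
      rw [Finset.sum_div]
      exact Finset.sum_congr rfl fun r _ => by rw [geomWeight]; ring
    rw [e, div_le_iff₀ hSpos, ← mul_add, mul_assoc, add_mul, div_mul_cancel₀ _ hSpos.ne']
    rw [div_mul_eq_mul_div, le_div_iff₀ hη]
    linarith
  have hpt : ∀ ξ, globalLoss P S (output P proto ⟨ηl, ηg, N - 1, κ, geomWeight q N⟩ ω₀ S ξ) -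
      globalLoss P S xs ≤
      ∑ r ∈ Finset.range N, geomWeight q N r * (globalLoss P S (x r ξ) - globalLoss P S xs) := by
    intro ξ
    have h1 := hQ.map_sum_le hμ.le (Finset.range N) (geomWeight q N) (fun r => x r ξ)
      (geomWeight_nonneg hq0 N) (sum_geomWeight hq0 hN)
    have h2 : output P proto ⟨ηl, ηg, N - 1, κ, geomWeight q N⟩ ω₀ S ξ =
        ∑ r ∈ Finset.range N, geomWeight q N r • x r ξ := by
      simp only [output, hx]
      rw [Nat.sub_add_cancel hN]
    rw [h2]
    simp only [mul_sub, Finset.sum_sub_distrib, ← Finset.sum_mul, sum_geomWeight hq0 hN, one_mul]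
    linarith
  have hnn : ∀ ξ, 0 ≤ ∑ r ∈ Finset.range N,
      geomWeight q N r * (globalLoss P S (x r ξ) - globalLoss P S xs) := fun ξ =>
    Finset.sum_nonneg fun r _ => mul_nonneg (geomWeight_nonneg hq0 N r) (sub_nonneg.2 (hxs _))
  have hint : Integrable (fun ξ => ∑ r ∈ Finset.range N,
      geomWeight q N r * (globalLoss P S (x r ξ) - globalLoss P S xs)) (seedLaw M n) :=
    integrable_finsetSum _ fun r hr => (hi r (Finset.mem_range.1 hr)).const_mul _
  refine (lintegral_mono fun ξ => ENNReal.ofReal_le_ofReal (hpt ξ)).trans ?_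
  rw [← ofReal_integral_eq_lintegral_ofReal hint (Filter.Eventually.of_forall hnn)]
  apply ENNReal.ofReal_le_ofReal
  rw [integral_finsetSum _ fun r hr => (hi r (Finset.mem_range.1 hr)).const_mul _]
  simpa only [integral_const_mul] using hsum

/-- The initial distance and the gradients at the optimum are bounded uniformly over the
datasets. -/
lemma exists_uniform_bounds (hM : 0 < M)
    (hβ : 0 < β) (hμ : 0 < μ) {G Δ : ℝ} (hω₀ : ω₀ ∈ P.W)
    (hq : ∀ (S : Dataset K n X) m, QuadraticBounds μ β (localLoss P S m) (∇ (localLoss P S m)))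
    (hG : proto = Protocol.fedAvg → HasBoundedDissimilarity P n G)
    (hΔ : ∀ (S : Dataset K n X) ω, IsEmpiricalOptimum P S ω →
      initDistSq P proto β ω₀ S ω ≤ Δ ^ 2) :
    ∃ H, 0 ≤ H ∧ ∀ (S : Dataset K n X) ω, IsEmpiricalOptimum P S ω →
      ‖ω₀ - ω‖ ^ 2 ≤ Δ ^ 2 ∧ ∀ m, ‖∇ (localLoss P S m) ω‖ ≤ H := by
  have hM' : (0 : ℝ) < M := by exact_mod_cast hM
  cases proto with
  | fedAvg =>
    refine ⟨√(M * G ^ 2) + β * |Δ|, by positivity, fun S ω hω => ?_⟩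
    have h1 := hΔ S ω hω
    simp only [initDistSq] at h1
    refine ⟨h1, fun m => ?_⟩
    have h2 := hG rfl S ω₀ hω₀
    rw [one_div, inv_mul_le_iff₀ hM'] at h2
    have h3 : ‖∇ (localLoss P S m) ω₀‖ ≤ √(M * G ^ 2) := by
      apply Real.le_sqrt_of_sq_le
      exact (Finset.single_le_sum (f := fun m => ‖∇ (localLoss P S m) ω₀‖ ^ 2)
        (fun m _ => by positivity) (Finset.mem_univ m)).trans h2
    have h4 := (hq S m).lipschitz hμ.le hβ ω ω₀
    have h5 : ‖ω - ω₀‖ ≤ |Δ| := by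
      rw [norm_sub_rev]; exact (sq_le_sq₀ (norm_nonneg _) (abs_nonneg _)).1 (by rwa [sq_abs])
    have h6 := norm_le_norm_add_norm_sub' (∇ (localLoss P S m) ω) (∇ (localLoss P S m) ω₀)
    have h7 := mul_le_mul_of_nonneg_left h5 hβ.le
    linarith
  | scaffold =>
    refine ⟨√(2 * M * β ^ 2 * Δ ^ 2), by positivity, fun S ω hω => ?_⟩
    have h1 := hΔ S ω hω
    simp only [initDistSq] at h1
    have h2 : 0 ≤ (1 / (2 * (M : ℝ) * β ^ 2)) * ∑ m, ‖∇ (localLoss P S m) ω‖ ^ 2 := by positivity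
    refine ⟨by linarith, fun m => ?_⟩
    apply Real.le_sqrt_of_sq_le
    have h3 : (1 / (2 * (M : ℝ) * β ^ 2)) * ∑ m, ‖∇ (localLoss P S m) ω‖ ^ 2 ≤ Δ ^ 2 := by
      have : 0 ≤ ‖ω₀ - ω‖ ^ 2 := by positivity
      linarith
    rw [one_div, inv_mul_le_iff₀ (by positivity)] at h3
    exact (Finset.single_le_sum (f := fun m => ‖∇ (localLoss P S m) ω‖ ^ 2)
        (fun m _ => by positivity) (Finset.mem_univ m)).trans h3

/-- Both protocols reach the accuracy `4 ε` in the stated number of rounds. The global step size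
is taken so large, at a fixed product `κ ηg ηl`, that the local models hardly leave the global one:
a round is then a step of minibatch gradient descent up to a negligible bias. -/
theorem exists_tuning [NeZero n] [Nonempty (Dataset K n X)]
    (hd : ∀ m z, Differentiable ℝ (sampleLoss P m z))
    (hM : 0 < M) (hd0 : 0 < d) (hκ : 0 < κ) (hμ : 0 < μ) (hβ : 0 < β) {σ G Δ ε C : ℝ} (hC : 16 ≤ C)
    (hε : 0 < ε) (hreg : IsRegular P n μ β σ)
    (hG : proto = Protocol.fedAvg → HasBoundedDissimilarity P n G)
    (hΔ : ∀ (S : Dataset K n X) ω, IsEmpiricalOptimum P S ω →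
      initDistSq P proto β ω₀ S ω ≤ Δ ^ 2)
    (hW : ∀ ηl ηg : ℝ, 0 < ηl → 1 ≤ ηg → C * β * κ * ηg * ηl ≤ 1 →
      StaysIn P proto n κ ηl ηg ω₀) :
    ∃ h : Tuning, (h.steps = κ ∧ 0 < h.ηl ∧ 1 ≤ h.ηg ∧ C * β * κ * h.ηg * h.ηl ≤ 1 ∧
        (∀ r, 0 ≤ h.weight r) ∧ ∑ r ∈ Finset.range (h.rounds + 1), h.weight r = 1) ∧
      (h.rounds : ℝ) ≤ C * (roundsOrder proto μ β σ G ε κ M * Real.log (2 + μ * Δ ^ 2 / ε)) ∧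
      (∀ (S : Dataset K n X) ξ, ∀ r, (serverState P proto S ξ h.ηl h.ηg κ ω₀ r).1 ∈ P.W) ∧
      ∀ S : Dataset K n X, ∃ xs, IsEmpiricalOptimum P S xs ∧
        ∫⁻ ξ, ENNReal.ofReal (globalLoss P S (output P proto h ω₀ S ξ) - globalLoss P S xs)
          ∂(seedLaw M n) ≤ ENNReal.ofReal (4 * ε) := by
  have hM' : (0 : ℝ) < M := by exact_mod_cast hM
  have hκ' : (0 : ℝ) < κ := by exact_mod_cast hκ
  have hn : (0 : ℝ) < n := by exact_mod_cast NeZero.pos n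
  have : NeZero d := ⟨hd0.ne'⟩
  have : Nontrivial (Param d) := inferInstance
  let m0 : Fin M := ⟨0, hM⟩
  have hq := fun (S : Dataset K n X) m => hreg.quadraticBounds_localLoss hd S m
  have hμβ : μ ≤ β := (hq (Classical.arbitrary _) m0).le_curvature
  have hω₀ : ω₀ ∈ P.W := by
    have h1 := hW (1 / (C * β * κ)) 1 (by positivity) le_rfl
      (by rw [mul_one, mul_one_div_cancel (by positivity)])
    simpa [localIterate, localSteps, serverState] using
      h1 (Classical.arbitrary _) (fun _ => 0) m0 0 0 (Nat.zero_le _)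
  obtain ⟨H, hH0, hH⟩ := exists_uniform_bounds (proto := proto) hM hβ hμ hω₀ hq hG hΔ
  -- the noise of one sample is at most `√n` times the standard deviation
  set s := √(n * σ ^ 2) with hsdef
  have hs : ∀ (S : Dataset K n X) m i, ∀ ω ∈ P.W,
      ‖∇ (sampleLoss P m (S m i)) ω - ∇ (localLoss P S m) ω‖ ≤ s := by
    intro S m i ω hω
    have h1 := hreg.variance S m ω hω
    rw [one_div, inv_mul_le_iff₀ hn] at h1
    apply Real.le_sqrt_of_sq_le
    exact (Finset.single_le_sum (f := fun i => ‖∇ (sampleLoss P m (S m i)) ω -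
      ∇ (localLoss P S m) ω‖ ^ 2) (fun i _ => by positivity) (Finset.mem_univ i)).trans h1
  set η := 1 / (C * (β + σ ^ 2 / (ε * κ * M))) with hη
  have hη0 : 0 < η := by positivity
  have hCη : C * β * η ≤ 1 := by
    rw [hη, mul_one_div, div_le_one (by positivity)]
    have : 0 ≤ σ ^ 2 / (ε * κ * M) := by positivity
    gcongr
    linarith
  have h16 : 16 * β * η ≤ 1 := le_trans (by gcongr) hCη
  have hμη : μ * η < 1 := by
    have : μ * η ≤ β * η := by gcongr
    nlinarith [mul_pos hβ hη0]
  set N := ⌈Real.log (2 + μ * Δ ^ 2 / ε) / (μ * η)⌉₊ with hN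
  have hlog : 0 < Real.log (2 + μ * Δ ^ 2 / ε) := by
    apply Real.log_pos
    have : 0 ≤ μ * Δ ^ 2 / ε := by positivity
    linarith
  have hN0 : 0 < N := Nat.ceil_pos.2 (by positivity)
  set Z := 7 ^ N * (s + H + β * |Δ|) with hZ
  have hZ0 : 0 ≤ Z := by positivity
  -- the bias of a round is at most `Z / ηg`
  set ηg := 1 + Z / √(μ * ε / 5) with hηg
  have hηg1 : 1 ≤ ηg := by have : 0 ≤ Z / √(μ * ε / 5) := by positivity
                           linarith
  set ηl := η / (κ * ηg) with hηl
  have hηl0 : 0 < ηl := by positivity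
  have hprod : κ * ηg * ηl = η := by rw [hηl]; field_simp
  have hstep : C * β * κ * ηg * ηl ≤ 1 := by
    calc C * β * κ * ηg * ηl = C * β * (κ * ηg * ηl) := by ring
      _ ≤ 1 := by rw [hprod]; exact hCη
  have hstay := hW ηl ηg hηl0 hηg1 hstep
  have hq0 : 0 ≤ 1 - μ * η := by linarith
  refine ⟨⟨ηl, ηg, N - 1, κ, geomWeight (1 - μ * η) N⟩, ⟨rfl, hηl0, hηg1, hstep,
    geomWeight_nonneg hq0 N, ?_⟩, ?_, ?_, fun S => ?_⟩
  · simp only [Nat.sub_add_cancel hN0]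
    exact sum_geomWeight hq0 hN0
  · have h1 : ((N - 1 : ℕ) : ℝ) ≤ Real.log (2 + μ * Δ ^ 2 / ε) / (μ * η) := by
      rw [Nat.cast_pred hN0]
      have := Nat.ceil_lt_add_one
        (by positivity : 0 ≤ Real.log (2 + μ * Δ ^ 2 / ε) / (μ * η))
      linarith
    refine h1.trans ?_
    have h2 : Real.log (2 + μ * Δ ^ 2 / ε) / (μ * η) =
        C * ((β / μ + σ ^ 2 / (μ * ε * κ * M)) * Real.log (2 + μ * Δ ^ 2 / ε)) := by
      rw [hη]; field_simp
    rw [h2]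
    have h3 : β / μ + σ ^ 2 / (μ * ε * κ * M) ≤ roundsOrder proto μ β σ G ε κ M := by
      cases proto with
      | fedAvg =>
        simp only [roundsOrder]
        exact le_add_of_nonneg_right (Real.sqrt_nonneg _)
      | scaffold => exact le_rfl
    gcongr
  · intro S ξ r
    simpa [localIterate, localSteps] using hstay S ξ m0 r 0 (Nat.zero_le _)
  · obtain ⟨xs, hxs⟩ := (quadraticBounds_globalLoss hM (hq S)).exists_minimizer hμ
      (differentiable_globalLoss hd).continuous
    obtain ⟨hdist, hgrad⟩ := hH S xs hxs
    have hdist' : ‖ω₀ - xs‖ ≤ |Δ| :=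
      (sq_le_sq₀ (norm_nonneg _) (abs_nonneg _)).1 (by rwa [sq_abs])
    have hlip := fun m => (hq S m).lipschitz hμ.le hβ
    have hbound : ∀ r < N, ∀ ξ m, s + H +
        β * ‖(serverState P proto S ξ ηl ηg κ ω₀ r).1 - xs‖ +
        ‖correction proto (serverState P proto S ξ ηl ηg κ ω₀ r).2 m‖ ≤ Z := by
      intro r hr ξ m
      refine (serverState_bound hM hκ hβ.le hηl0 hηg1 (by rw [hprod]; linarith)
        (Real.sqrt_nonneg _) hH0 hlip (hs S) hgrad (hstay S ξ) r m).trans ?_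
      rw [hZ]
      gcongr
      norm_num
    have hβκ : 2 * β * κ * ηl ≤ 1 := by
      have h1 : 2 * β * κ * ηl * 1 ≤ 2 * β * κ * ηl * ηg := by gcongr
      have h2 : 2 * β * κ * ηl * ηg = 2 * β * η := by rw [← hprod]; ring
      nlinarith [mul_pos hβ hη0]
    have hκηl : 2 * κ * ηl * ηg = 2 * η := by rw [← hprod]; ring
    refine ⟨xs, hxs, ?_⟩
    have key := lintegral_gap_output_le (proto := proto) (ηl := ηl) (ηg := ηg) (ω₀ := ω₀)
      (τ := 2 * κ * ηl * Z) (B := Z / β) hd hM hκ hμ hβ (hq S) hxs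
      (by rw [hprod]; exact hη0) (by rw [hprod]; exact h16) (by rw [hprod]; exact hμη.le)
      (hstay S) (hs S) (hreg.variance S) hN0
      (by
        intro r hr ξ m k hk
        refine ((norm_localIterate_sub_le hβ.le hηl0 hβκ hlip (hs S) hgrad (hstay S ξ) m r hZ0
          (hbound r hr ξ m) k hk.le).1).trans ?_
        have : (k : ℝ) ≤ κ := by exact_mod_cast hk.le
        gcongr)
      (by
        intro r hr ξ
        rw [le_div_iff₀ hβ]
        have h1 := hbound r hr ξ m0
        have h2 := norm_nonneg (correction proto (serverState P proto S ξ ηl ηg κ ω₀ r).2 m0)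
        have h3 : 0 ≤ s := Real.sqrt_nonneg _
        linarith)
    rw [hprod] at key
    refine key.trans (ENNReal.ofReal_le_ofReal ?_)
    have t1 : 2 / η * ((1 - μ * η) ^ N * ‖ω₀ - xs‖ ^ 2 /
        ∑ j ∈ Finset.range N, (1 - μ * η) ^ j) ≤ 2 * ε := by
      refine le_trans ?_ (geom_initial_le hμ hη0 hμη hε (sq_nonneg Δ) (Nat.le_ceil _))
      have := geom_sum_pos_of_nonneg hq0 hN0
      gcongr
    have t2 := noise_contribution_le hC hβ hε hκ' hM' (σ := σ)
    rw [← hη] at t2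
    have t3 := bias_contribution_le hβ hμ hμβ hε hη0 h16 hηl0 hκηl
      (Z := Z) le_rfl hκ' hZ0
    rw [mul_add]
    linarith

end

/-! ### Symmetrization -/

/-- A family of independent pairs with independent entries is a pair of independent families. -/
lemma measurePreserving_pi_prod {ι : Type*} [Fintype ι] {α β : ι → Type*}
    [∀ i, MeasurableSpace (α i)] [∀ i, MeasurableSpace (β i)] (μ : ∀ i, Measure (α i))
    (ν : ∀ i, Measure (β i)) [∀ i, SigmaFinite (μ i)] [∀ i, SigmaFinite (ν i)] :
    MeasurePreserving (fun Q : ∀ i, α i × β i => ((fun i => (Q i).1), fun i => (Q i).2))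
      (Measure.pi fun i => (μ i).prod (ν i)) ((Measure.pi μ).prod (Measure.pi ν)) := by
  have hm : Measurable (fun Q : ∀ i, α i × β i => ((fun i => (Q i).1), fun i => (Q i).2)) := by
    fun_prop
  refine ⟨hm, ?_⟩
  refine (Measure.prod_eq_generateFrom generateFrom_pi generateFrom_pi isPiSystem_pi isPiSystem_pi
    (Measure.FiniteSpanningSetsIn.pi fun i => (μ i).toFiniteSpanningSetsIn)
    (Measure.FiniteSpanningSetsIn.pi fun i => (ν i).toFiniteSpanningSetsIn) ?_).symm
  rintro _ ⟨s, hs, rfl⟩ _ ⟨t, ht, rfl⟩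
  have hs' : ∀ i, MeasurableSet (s i) := fun i => hs i (Set.mem_univ i)
  have ht' : ∀ i, MeasurableSet (t i) := fun i => ht i (Set.mem_univ i)
  rw [Measure.map_apply hm ((MeasurableSet.univ_pi hs').prod (MeasurableSet.univ_pi ht'))]
  rw [show (fun Q : ∀ i, α i × β i => ((fun i => (Q i).1), fun i => (Q i).2)) ⁻¹'
      (Set.univ.pi s ×ˢ Set.univ.pi t) = Set.univ.pi fun i => s i ×ˢ t i by
    ext; simp [Set.mem_pi, forall_and]]
  simp_rw [Measure.pi_pi, Measure.prod_prod, Finset.prod_mul_distrib]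

section Symmetrization

variable {M n : ℕ} {Z : Fin M → Type*} [∀ m, MeasurableSpace (Z m)] (ν : ∀ m, Measure (Z m))
  [∀ m, IsProbabilityMeasure (ν m)]

lemma measurePreserving_unzip :
    MeasurePreserving (fun Q : ∀ m, Fin n → Z m × Z m =>
        ((fun m i => (Q m i).1 : ∀ m, Fin n → Z m), (fun m i => (Q m i).2 : ∀ m, Fin n → Z m)))
      (Measure.pi fun m => Measure.pi fun _ => (ν m).prod (ν m))
      ((Measure.pi fun m => Measure.pi fun _ => ν m).prod
        (Measure.pi fun m => Measure.pi fun _ => ν m)) := by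
  have h1 := measurePreserving_pi
    (fun m => Measure.pi fun _ : Fin n => (ν m).prod (ν m))
    (fun m => (Measure.pi fun _ : Fin n => ν m).prod (Measure.pi fun _ : Fin n => ν m))
    (fun m => measurePreserving_pi_prod (fun _ : Fin n => ν m) (fun _ : Fin n => ν m))
  have h2 := measurePreserving_pi_prod (fun m => Measure.pi fun _ : Fin n => ν m)
    (fun m => Measure.pi fun _ : Fin n => ν m)
  exact h2.comp h1

/-- Exchanging the samples with negative sign between two independent datasets preserves their
joint law. -/
lemma lintegral_swap_samples (σ : Fin M → Fin n → ℤˣ)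
    {h : (∀ m, Fin n → Z m × Z m) → ℝ≥0∞} (hh : Measurable h) :
    ∫⁻ Q, h (fun m i => if σ m i = 1 then Q m i else (Q m i).swap)
        ∂(Measure.pi fun m => Measure.pi fun _ => (ν m).prod (ν m)) =
      ∫⁻ Q, h Q ∂(Measure.pi fun m => Measure.pi fun _ => (ν m).prod (ν m)) := by
  have h1 : ∀ m, ∀ i : Fin n, MeasurePreserving
      (fun q : Z m × Z m => if σ m i = 1 then q else q.swap)
      ((ν m).prod (ν m)) ((ν m).prod (ν m)) := by
    intro m i
    by_cases hs : σ m i = 1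
    · simp only [hs, if_true]; exact MeasurePreserving.id _
    · simp only [hs, if_false]; exact Measure.measurePreserving_swap
  have h2 := measurePreserving_pi (fun m => Measure.pi fun _ : Fin n => (ν m).prod (ν m))
    (fun m => Measure.pi fun _ : Fin n => (ν m).prod (ν m))
    (fun m => measurePreserving_pi (fun _ : Fin n => (ν m).prod (ν m))
      (fun _ : Fin n => (ν m).prod (ν m)) (h1 m))
  exact h2.lintegral_comp hh

/-- The symmetrization inequality. -/
lemma lintegral_iSup_sub_le {ι : Type*} [Countable ι] {g : ι → ∀ m, Z m → ℝ}
    (hg : ∀ t m, Measurable (g t m)) (c : ℝ) :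
    ∫⁻ S, ∫⁻ S', ⨆ t, ENNReal.ofReal (c * ∑ m, ∑ i, (g t m (S' m i) - g t m (S m i)))
        ∂(Measure.pi fun m => Measure.pi fun _ : Fin n => ν m)
        ∂(Measure.pi fun m => Measure.pi fun _ : Fin n => ν m) ≤
      2 * ((∫⁻ S, ∑ σ : Fin M → Fin n → ℤˣ, ⨆ t, ENNReal.ofReal
        (c * ∑ m, ∑ i, ((σ m i : ℤ) : ℝ) * g t m (S m i))
        ∂(Measure.pi fun m => Measure.pi fun _ : Fin n => ν m)) / 2 ^ (M * n)) := by
  set π := Measure.pi fun m => Measure.pi fun _ : Fin n => ν m with hπ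
  set π₂ := Measure.pi fun m => Measure.pi fun _ : Fin n => (ν m).prod (ν m) with hπ₂
  set A : (Fin M → Fin n → ℤˣ) → (∀ m, Fin n → Z m) → ℝ≥0∞ := fun σ S =>
    ⨆ t, ENNReal.ofReal (c * ∑ m, ∑ i, ((σ m i : ℤ) : ℝ) * g t m (S m i)) with hA
  have hAm : ∀ σ, Measurable (A σ) := fun σ => Measurable.iSup fun t => by
    have := fun m => hg t m
    fun_prop
  set H : (∀ m, Fin n → Z m × Z m) → ℝ≥0∞ := fun Q =>
    ⨆ t, ENNReal.ofReal (c * ∑ m, ∑ i, (g t m (Q m i).2 - g t m (Q m i).1)) with hH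
  have hHm : Measurable H := Measurable.iSup fun t => by
    have := fun m => hg t m
    fun_prop
  have hpair : ∀ u : (∀ m, Fin n → Z m) × (∀ m, Fin n → Z m) → ℝ≥0∞, Measurable u →
      ∫⁻ Q, u ((fun m i => (Q m i).1), fun m i => (Q m i).2) ∂π₂ =
        ∫⁻ S, ∫⁻ S', u (S, S') ∂π ∂π := by
    intro u hu
    rw [(measurePreserving_unzip ν).lintegral_comp hu, lintegral_prod _ hu.aemeasurable]
  have e1 : ∫⁻ S, ∫⁻ S', ⨆ t, ENNReal.ofReal (c * ∑ m, ∑ i, (g t m (S' m i) - g t m (S m i)))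
      ∂π ∂π = ∫⁻ Q, H Q ∂π₂ := by
    refine (hpair (fun p => ⨆ t, ENNReal.ofReal
      (c * ∑ m, ∑ i, (g t m (p.2 m i) - g t m (p.1 m i)))) (Measurable.iSup fun t => ?_)).symm
    have := fun m => hg t m
    fun_prop
  have hneg : ∀ S, ∑ σ, A (-σ) S = ∑ σ, A σ S := fun S => Equiv.sum_comp (Equiv.neg _) (A · S)
  have hpt : ∀ (σ : Fin M → Fin n → ℤˣ) (Q : ∀ m, Fin n → Z m × Z m),
      H (fun m i => if σ m i = 1 then Q m i else (Q m i).swap) ≤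
        A σ (fun m i => (Q m i).2) + A (-σ) (fun m i => (Q m i).1) := by
    intro σ Q
    refine iSup_le fun t => ?_
    have e : c * ∑ m, ∑ i, (g t m (if σ m i = 1 then Q m i else (Q m i).swap).2 -
        g t m (if σ m i = 1 then Q m i else (Q m i).swap).1) =
        c * ∑ m, ∑ i, ((σ m i : ℤ) : ℝ) * g t m (Q m i).2 +
          c * ∑ m, ∑ i, (((-σ) m i : ℤ) : ℝ) * g t m (Q m i).1 := by
      rw [← mul_add, ← Finset.sum_add_distrib]
      congr 1
      refine Finset.sum_congr rfl fun m _ => ?_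
      rw [← Finset.sum_add_distrib]
      refine Finset.sum_congr rfl fun i _ => ?_
      rcases Int.units_eq_one_or (σ m i) with hs | hs
      · simp [hs, sub_eq_add_neg]
      · have : (-1 : ℤˣ) ≠ 1 := by decide
        simp [hs, this]; ring
    rw [e]
    refine ENNReal.ofReal_add_le.trans ?_
    exact add_le_add
      (le_iSup (fun t => ENNReal.ofReal (c * ∑ m, ∑ i, ((σ m i : ℤ) : ℝ) * g t m (Q m i).2)) t)
      (le_iSup (fun t => ENNReal.ofReal
        (c * ∑ m, ∑ i, (((-σ) m i : ℤ) : ℝ) * g t m (Q m i).1)) t)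
  have hσ : ∀ σ : Fin M → Fin n → ℤˣ, ∫⁻ Q, H Q ∂π₂ ≤ ∫⁻ S, A σ S ∂π + ∫⁻ S, A (-σ) S ∂π := by
    intro σ
    rw [← lintegral_swap_samples ν σ hHm]
    refine (lintegral_mono (hpt σ)).trans_eq ?_
    have a1 : Measurable fun p : (∀ m, Fin n → Z m) × (∀ m, Fin n → Z m) => A σ p.2 :=
      (hAm σ).comp measurable_snd
    have a2 : Measurable fun p : (∀ m, Fin n → Z m) × (∀ m, Fin n → Z m) => A (-σ) p.1 :=
      (hAm (-σ)).comp measurable_fst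
    rw [hpair (fun p => A σ p.2 + A (-σ) p.1) (a1.add a2)]
    have : ∀ S, ∫⁻ S', (A σ S' + A (-σ) S) ∂π = ∫⁻ S', A σ S' ∂π + A (-σ) S := by
      intro S
      rw [lintegral_add_left (hAm σ)]
      simp
    simp only [this]
    rw [lintegral_add_left measurable_const]
    simp
  have hsum := Finset.sum_le_sum fun σ (_ : σ ∈ Finset.univ) => hσ σ
  rw [Finset.sum_const, Finset.sum_add_distrib, Finset.card_univ, nsmul_eq_mul,
    ← lintegral_finsetSum _ fun σ _ => hAm σ, ← lintegral_finsetSum _ fun σ _ => hAm (-σ)] at hsum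
  simp only [hneg] at hsum
  have hcard : Fintype.card (Fin M → Fin n → ℤˣ) = 2 ^ (M * n) := by
    simp only [Fintype.card_fun, Fintype.card_units_int, Fintype.card_fin]
    rw [← pow_mul, mul_comm]
  rw [hcard, ← two_mul] at hsum
  rw [e1, ← mul_div_assoc, ENNReal.le_div_iff_mul_le (Or.inl (by positivity))
    (Or.inl (by simp))]
  push_cast at hsum
  rw [mul_comm]
  exact hsum

end Symmetrization

section Rademacher

variable {M K d n : ℕ} {X : Fin M → Type*} {P : Model K d X}

/-- Subtracting the losses of a fixed reference parameter does not change the Rademacher average,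
because the signs are centred. -/
lemma sum_iSup_sub_le_signedSup {ωs : Param d} (hωs : ωs ∈ P.W) {D : Set (Param d)}
    (hD : D ⊆ P.W) (S : Dataset K n X) :
    ∑ σ : Fin M → Fin n → ℤˣ, ⨆ ω : D, ENNReal.ofReal (1 / ((M : ℝ) * n) * ∑ m, ∑ i,
        ((σ m i : ℤ) : ℝ) * (sampleLoss P m (S m i) ω - sampleLoss P m (S m i) ωs)) ≤
      (∑ σ : Fin M → Fin n → ℤˣ, signedSup P S σ).toENNReal := by
  set R : (Fin M → Fin n → ℤˣ) → Param d → ℝ := fun σ ω => 1 / ((M : ℝ) * n) * ∑ m, ∑ i,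
    ((σ m i : ℤ) : ℝ) * sampleLoss P m (S m i) ω with hR
  have hle : ∀ σ, ∀ ω ∈ P.W, (R σ ω : EReal) ≤ signedSup P S σ := fun σ ω hω =>
    le_iSup₂ (f := fun ω _ => (R σ ω : EReal)) ω hω
  have hbot : ∀ σ, signedSup P S σ ≠ ⊥ := fun σ h => by
    have := hle σ ωs hωs
    rw [h, le_bot_iff] at this
    exact EReal.coe_ne_bot _ this
  by_cases htop : ∃ σ, signedSup P S σ = ⊤
  · obtain ⟨σ, hσ⟩ := htop
    have hne : ∀ s : Finset (Fin M → Fin n → ℤˣ), ∑ σ ∈ s, signedSup P S σ ≠ ⊥ := by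
      intro s
      induction s using Finset.cons_induction with
      | empty => simp
      | cons a s ha ih =>
        rw [Finset.sum_cons, Ne, EReal.add_eq_bot_iff, not_or]
        exact ⟨hbot a, ih⟩
    have : ∑ σ : Fin M → Fin n → ℤˣ, signedSup P S σ = ⊤ := by
      rw [← Finset.add_sum_erase _ _ (Finset.mem_univ σ), hσ]
      exact EReal.top_add_of_ne_bot (hne _)
    rw [this]
    simp
  · push Not at htop
    set v : (Fin M → Fin n → ℤˣ) → ℝ := fun σ => (signedSup P S σ).toReal
    have hv : ∀ σ, signedSup P S σ = (v σ : EReal) := fun σ =>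
      (EReal.coe_toReal (htop σ) (hbot σ)).symm
    have hRv : ∀ σ, ∀ ω ∈ P.W, R σ ω ≤ v σ := fun σ ω hω => by
      have := hle σ ω hω
      rw [hv σ] at this
      exact_mod_cast this
    have hzero : ∑ σ, R σ ωs = 0 := by
      have h1 : ∑ σ, R σ ωs = ∑ σ, R (-σ) ωs :=
        (Equiv.sum_comp (Equiv.neg (Fin M → Fin n → ℤˣ)) (fun σ => R σ ωs)).symm
      have h2 : ∀ σ, R (-σ) ωs = -R σ ωs := by
        intro σ
        simp [hR]
      simp only [h2, Finset.sum_neg_distrib] at h1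
      linarith
    have hcoe : ∑ σ : Fin M → Fin n → ℤˣ, signedSup P S σ = ((∑ σ, v σ : ℝ) : EReal) := by
      simp only [hv]
      induction (Finset.univ : Finset (Fin M → Fin n → ℤˣ)) using Finset.cons_induction with
      | empty => simp
      | cons a s ha ih => rw [Finset.sum_cons, Finset.sum_cons, ih, EReal.coe_add]
    rw [hcoe, EReal.toENNReal_of_ne_top (EReal.coe_ne_top _), EReal.toReal_coe]
    have e : ∑ σ, v σ = ∑ σ, (v σ - R σ ωs) := by rw [Finset.sum_sub_distrib, hzero, sub_zero]
    rw [e, ENNReal.ofReal_sum_of_nonneg fun σ _ => sub_nonneg.2 (hRv σ ωs hωs)]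
    refine Finset.sum_le_sum fun σ _ => iSup_le fun ω => ENNReal.ofReal_le_ofReal ?_
    have := hRv σ ω (hD ω.2)
    simp only [mul_sub, Finset.sum_sub_distrib]
    simp only [hR] at this ⊢
    linarith

end Rademacher

/-! ### The law of the data -/

/-- No measurability is needed: the Bochner integral of a function that is not integrable is zero. -/
lemma ofReal_integral_le_lintegral {Ω : Type*} [MeasurableSpace Ω] {ρ : Measure Ω} (f : Ω → ℝ) :
    ENNReal.ofReal (∫ ω, f ω ∂ρ) ≤ ∫⁻ ω, ENNReal.ofReal (f ω) ∂ρ := by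
  by_cases hf : Integrable f ρ
  · rw [integral_eq_lintegral_pos_part_sub_lintegral_neg_part hf]
    exact (ENNReal.ofReal_le_ofReal (sub_le_self _ ENNReal.toReal_nonneg)).trans
      ENNReal.ofReal_toReal_le
  · simp [integral_undef hf]

section SampleLaw

variable {K : ℕ} {Y : Type*} [MeasurableSpace Y] {ρ : Measure (Y × (Fin K → unitInterval))}
  {p : Y → Fin K → ℝ}

lemma measurable_observe (a : Fin K) :
    Measurable fun z : Y × (Fin K → unitInterval) => ((z.1, a, z.2 a) : Sample K Y) := by
  fun_prop

lemma IsActionRule.le_one (hp : IsActionRule p) (x : Y) (a : Fin K) : p x a ≤ 1 :=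
  (hp.sum_eq_one x) ▸ Finset.single_le_sum (fun a _ => hp.nonneg x a) (Finset.mem_univ a)

lemma lintegral_sampleLaw (hp : IsActionRule p) {φ : Sample K Y → ℝ≥0∞} (hφ : Measurable φ) :
    ∫⁻ z, φ z ∂(sampleLaw ρ p) =
      ∑ a, ∫⁻ z, ENNReal.ofReal (p z.1 a) * φ (z.1, a, z.2 a) ∂ρ := by
  rw [sampleLaw, lintegral_finsetSum_measure]
  refine Finset.sum_congr rfl fun a _ => ?_
  have h := hp.measurable a
  rw [lintegral_map hφ (measurable_observe a)]
  exact lintegral_withDensity_eq_lintegral_mul ρ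
    (by fun_prop : Measurable fun z : Y × (Fin K → unitInterval) => ENNReal.ofReal (p z.1 a))
    (hφ.comp (measurable_observe a))

lemma isProbabilityMeasure_sampleLaw [IsProbabilityMeasure ρ] (hp : IsActionRule p) :
    IsProbabilityMeasure (sampleLaw ρ p) := by
  constructor
  rw [← lintegral_one, lintegral_sampleLaw hp measurable_const]
  have h := hp.measurable
  rw [← lintegral_finsetSum _ fun a _ => by fun_prop]
  simp only [mul_one, ← ENNReal.ofReal_sum_of_nonneg fun a _ => hp.nonneg _ a, hp.sum_eq_one,
    ENNReal.ofReal_one, lintegral_one, measure_univ]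

lemma integrable_sampleLaw (hp : IsActionRule p) {φ : Sample K Y → ℝ} (hφ : Measurable φ)
    (hi : ∀ a, Integrable (fun z => φ (z.1, a, z.2 a)) ρ) : Integrable φ (sampleLaw ρ p) := by
  refine ⟨hφ.aestronglyMeasurable, ?_⟩
  rw [HasFiniteIntegral, lintegral_sampleLaw hp hφ.enorm]
  refine ENNReal.sum_lt_top.2 fun a _ => lt_of_le_of_lt (lintegral_mono fun z => ?_) (hi a).2
  calc ENNReal.ofReal (p z.1 a) * ‖φ (z.1, a, z.2 a)‖ₑ ≤ 1 * ‖φ (z.1, a, z.2 a)‖ₑ := by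
        gcongr
        exact ENNReal.ofReal_le_one.2 (hp.le_one _ _)
    _ = _ := one_mul _

lemma integral_sampleLaw (hp : IsActionRule p) {φ : Sample K Y → ℝ} (hφ : Measurable φ)
    (hi : ∀ a, Integrable (fun z => φ (z.1, a, z.2 a)) ρ) :
    ∫ z, φ z ∂(sampleLaw ρ p) = ∑ a, ∫ z, p z.1 a * φ (z.1, a, z.2 a) ∂ρ := by
  have h := integrable_sampleLaw hp hφ hi
  rw [sampleLaw] at h ⊢
  rw [integral_finsetSum_measure fun a _ => (integrable_finsetSum_measure.1 h) a
    (Finset.mem_univ a)]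
  refine Finset.sum_congr rfl fun a _ => ?_
  have hm := hp.measurable a
  rw [integral_map (measurable_observe a).aemeasurable hφ.aestronglyMeasurable,
    integral_withDensity_eq_integral_toReal_smul (by fun_prop)
      (Filter.Eventually.of_forall fun _ => ENNReal.ofReal_lt_top)]
  simp only [ENNReal.toReal_ofReal (hp.nonneg _ _), smul_eq_mul]

lemma integrable_weighted (hp : IsActionRule p) (a : Fin K) {φ : Y × (Fin K → unitInterval) → ℝ}
    (hi : Integrable φ ρ) : Integrable (fun z => p z.1 a * φ z) ρ := by
  have := hp.measurable a
  refine hi.bdd_mul (c := 1) (by fun_prop : Measurable fun z : Y × (Fin K → unitInterval) =>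
    p z.1 a).aestronglyMeasurable (Filter.Eventually.of_forall fun z => ?_)
  rw [Real.norm_of_nonneg (hp.nonneg _ _)]
  exact hp.le_one _ _

end SampleLaw

section Samples

variable {M n : ℕ} {Z : Fin M → Type*} [∀ m, MeasurableSpace (Z m)] (ν : ∀ m, Measure (Z m))
  [∀ m, IsProbabilityMeasure (ν m)]

lemma measurePreserving_sample (m : Fin M) (i : Fin n) :
    MeasurePreserving (fun S : ∀ m, Fin n → Z m => S m i)
      (Measure.pi fun m => Measure.pi fun _ : Fin n => ν m) (ν m) :=
  (measurePreserving_eval (fun _ : Fin n => ν m) i).comp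
    (measurePreserving_eval (fun m => Measure.pi fun _ : Fin n => ν m) m)

lemma integrable_sum_samples {u : ∀ m, Z m → ℝ} (hu : ∀ m, Integrable (u m) (ν m)) :
    Integrable (fun S => ∑ m, ∑ i : Fin n, u m (S m i))
      (Measure.pi fun m => Measure.pi fun _ : Fin n => ν m) :=
  integrable_finsetSum _ fun m _ => integrable_finsetSum _ fun i _ =>
    (measurePreserving_sample ν m i).integrable_comp_of_integrable (hu m)

lemma integral_sum_samples {u : ∀ m, Z m → ℝ} (hu : ∀ m, Integrable (u m) (ν m)) :
    ∫ S, ∑ m, ∑ i : Fin n, u m (S m i) ∂(Measure.pi fun m => Measure.pi fun _ : Fin n => ν m) =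
      ∑ m, (n : ℝ) * ∫ z, u m z ∂(ν m) := by
  have h : ∀ m (i : Fin n), Integrable (fun S : ∀ m, Fin n → Z m => u m (S m i))
      (Measure.pi fun m => Measure.pi fun _ : Fin n => ν m) := fun m i =>
    (measurePreserving_sample ν m i).integrable_comp_of_integrable (hu m)
  have h1 : ∀ m (i : Fin n), ∫ S, u m (S m i)
      ∂(Measure.pi fun m => Measure.pi fun _ : Fin n => ν m) = ∫ z, u m z ∂(ν m) := by
    intro m i
    have h2 := integral_map (μ := Measure.pi fun m => Measure.pi fun _ : Fin n => ν m)
      (measurePreserving_sample ν m i).measurable.aemeasurable (f := u m)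
      (by rw [(measurePreserving_sample ν m i).map_eq]; exact (hu m).aestronglyMeasurable)
    rw [(measurePreserving_sample ν m i).map_eq] at h2
    exact h2.symm
  rw [integral_finsetSum _ fun m _ => integrable_finsetSum _ fun i _ => h m i]
  refine Finset.sum_congr rfl fun m _ => ?_
  rw [integral_finsetSum _ fun i _ => h m i]
  simp only [h1, Finset.sum_const, Finset.card_univ, Fintype.card_fin, nsmul_eq_mul]

end Samples

/-! ### Generalization and the population risk -/

section Risk

variable {M K d n : ℕ} {X : Fin M → Type*} [∀ m, MeasurableSpace (X m)] {P : Model K d X}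
  {D : Env K X} {p : Predictor K X} {ωs : Param d}

/-- The population risk when the actions are drawn according to `p`. -/
noncomputable def risk (P : Model K d X) (D : Env K X) (p : Predictor K X) (ω : Param d) : ℝ :=
  (1 / (M : ℝ)) * ∑ m, ∫ z, sampleLoss P m z ω
    ∂(sampleLaw (D m : Measure (X m × (Fin K → unitInterval))) (p m))

lemma measurable_sampleLoss
    (hf : ∀ m a, Measurable fun q : Param d × X m => P.f q.1 m q.2 a)
    (hl : ∀ m, Measurable fun q : ℝ × ℝ => P.loss m q.1 q.2) (m : Fin M) (ω : Param d) :
    Measurable fun z => sampleLoss P m z ω := by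
  have h1 : Measurable fun q : Fin K × X m => P.f ω m q.2 q.1 :=
    measurable_from_prod_countable_right fun a => (hf m a).comp (by fun_prop :
      Measurable fun x : X m => (ω, x))
  have h2 : Measurable fun z : Sample K (X m) => P.f ω m z.1 z.2.1 :=
    h1.comp (by fun_prop : Measurable fun z : Sample K (X m) => (z.2.1, z.1))
  exact (hl m).comp (h2.prodMk (by fun_prop : Measurable fun z : Sample K (X m) => (z.2.2 : ℝ)))

omit [∀ m, MeasurableSpace (X m)] in
lemma globalLoss_sub (S : Dataset K n X) (ω ω' : Param d) :
    globalLoss P S ω - globalLoss P S ω' = 1 / ((M : ℝ) * n) *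
      ∑ m, ∑ i, (sampleLoss P m (S m i) ω - sampleLoss P m (S m i) ω') := by
  simp only [globalLoss, localLoss, Finset.sum_sub_distrib, ← Finset.mul_sum]
  simp only [one_div, mul_inv]
  ring

/-- Uniformly over `W`, the empirical excess loss underestimates the excess risk by at most a
function of the data whose mean is at most twice the Rademacher complexity. -/
lemma exists_generalization_bound {𝓔 : Set (Env K X)} (hD : D ∈ 𝓔) (hn : 0 < n) (hM : 0 < M)
    (hf : ∀ m a, Measurable fun q : Param d × X m => P.f q.1 m q.2 a)
    (hl : ∀ m, Measurable fun q : ℝ × ℝ => P.loss m q.1 q.2)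
    (hd : ∀ m z, Differentiable ℝ (sampleLoss P m z))
    (hi : ∀ m, ∀ ω ∈ P.W, ∀ a, Integrable
        (fun q : X m × (Fin K → unitInterval) => P.loss m (P.f ω m q.1 a) (q.2 a))
        (D m : Measure (X m × (Fin K → unitInterval))))
    (hp : ∀ m, IsActionRule (p m)) (hωs : ωs ∈ P.W) :
    ∃ Γ : Dataset K n X → ℝ≥0∞, Measurable Γ ∧
      (∀ S, ∀ ω ∈ P.W, ENNReal.ofReal (risk P D p ω - risk P D p ωs -
        (globalLoss P S ω - globalLoss P S ωs)) ≤ Γ S) ∧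
      ∫⁻ S, Γ S ∂(dataLaw n D p) ≤ 2 * rademacher P 𝓔 n := by
  have hM' : (M : ℝ) ≠ 0 := by exact_mod_cast hM.ne'
  have hn' : (n : ℝ) ≠ 0 := by exact_mod_cast hn.ne'
  have := fun m => isProbabilityMeasure_sampleLaw (ρ := (D m : Measure _)) (hp m)
  set π := dataLaw n D p with hπ
  have : IsProbabilityMeasure π := by rw [hπ, dataLaw]; infer_instance
  -- a countable dense set of parameters makes the supremum measurable
  obtain ⟨T, hTW, hTc, hTd⟩ :=
    (TopologicalSpace.IsSeparable.of_separableSpace P.W).exists_countable_dense_subset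
  have : Countable T := hTc
  set g : Param d → ∀ m, Sample K (X m) → ℝ := fun ω m z =>
    sampleLoss P m z ω - sampleLoss P m z ωs with hg
  have hgm : ∀ ω m, Measurable (g ω m) := fun ω m =>
    (measurable_sampleLoss hf hl m ω).sub (measurable_sampleLoss hf hl m ωs)
  have hgi : ∀ ω ∈ P.W, ∀ m, Integrable (g ω m)
      (sampleLaw (D m : Measure (X m × (Fin K → unitInterval))) (p m)) := fun ω hω m =>
    (integrable_sampleLaw (hp m) (measurable_sampleLoss hf hl m ω) (hi m ω hω)).sub
      (integrable_sampleLaw (hp m) (measurable_sampleLoss hf hl m ωs) (hi m ωs hωs))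
  set c := 1 / ((M : ℝ) * n) with hc
  set H : Dataset K n X → Dataset K n X → ℝ≥0∞ := fun S S' =>
    ⨆ t : T, ENNReal.ofReal (c * ∑ m, ∑ i, (g t m (S' m i) - g t m (S m i))) with hH
  have hHm : Measurable fun q : Dataset K n X × Dataset K n X => H q.1 q.2 :=
    Measurable.iSup fun t => by
      have := hgm t
      fun_prop
  refine ⟨fun S => ∫⁻ S', H S S' ∂π, hHm.lintegral_prod_right', ?_, ?_⟩
  · intro S ω hω
    have hgi' := integrable_sum_samples (n := n) _ (fun m => hgi ω hω m)
    have hmean : ∫ S' : Dataset K n X, (c * ∑ m, ∑ i, (g ω m (S' m i) - g ω m (S m i))) ∂π =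
        risk P D p ω - risk P D p ωs - (globalLoss P S ω - globalLoss P S ωs) := by
      have h1 := integral_sum_samples (n := n) _ (fun m => hgi ω hω m)
      have h2 : ∀ m, ∫ z, g ω m z
          ∂(sampleLaw (D m : Measure (X m × (Fin K → unitInterval))) (p m)) =
          ∫ z, sampleLoss P m z ω
            ∂(sampleLaw (D m : Measure (X m × (Fin K → unitInterval))) (p m)) -
          ∫ z, sampleLoss P m z ωs
            ∂(sampleLaw (D m : Measure (X m × (Fin K → unitInterval))) (p m)) := fun m =>
        integral_sub
          (integrable_sampleLaw (hp m) (measurable_sampleLoss hf hl m ω) (hi m ω hω))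
          (integrable_sampleLaw (hp m) (measurable_sampleLoss hf hl m ωs) (hi m ωs hωs))
      simp only [Finset.sum_sub_distrib, mul_sub]
      refine (integral_sub (hgi'.const_mul c) (integrable_const _)).trans ?_
      rw [integral_const_mul, integral_const, probReal_univ, one_smul, globalLoss_sub, h1]
      simp only [Finset.sum_sub_distrib, mul_sub]
      refine congrArg₂ _ ?_ (by simp only [hg, hc, Finset.sum_sub_distrib, mul_sub])
      simp only [h2, ← Finset.mul_sum, risk, Finset.sum_sub_distrib, hc]
      field_simp
    rw [← hmean]
    refine (ofReal_integral_le_lintegral _).trans (lintegral_mono fun S' => ?_)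
    -- the supremum over the dense subset bounds the value at `ω` by continuity
    have hcont : Continuous fun ω : Param d =>
        ENNReal.ofReal (c * ∑ m, ∑ i, (g ω m (S' m i) - g ω m (S m i))) := by
      have := fun m z => (hd m z).continuous
      simp only [hg]
      exact ENNReal.continuous_ofReal.comp (by fun_prop)
    have hcl : IsClosed {ω : Param d |
        ENNReal.ofReal (c * ∑ m, ∑ i, (g ω m (S' m i) - g ω m (S m i))) ≤ H S S'} :=
      isClosed_le hcont continuous_const
    exact closure_minimal (fun t ht => le_iSup (fun t : T =>
      ENNReal.ofReal (c * ∑ m, ∑ i, (g t m (S' m i) - g t m (S m i)))) ⟨t, ht⟩) hcl (hTd hω)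
  · have h0 := lintegral_iSup_sub_le (n := n)
      (fun m => sampleLaw (D m : Measure (X m × (Fin K → unitInterval))) (p m))
      (g := fun (t : T) m z => g t m z) (fun t m => hgm t m) c
    refine le_trans h0 ?_
    have h1 : (∫⁻ S, (∑ σ : Fin M → Fin n → ℤˣ, ⨆ t : T, ENNReal.ofReal
        (c * ∑ m, ∑ i, ((σ m i : ℤ) : ℝ) * g t m (S m i))) ∂π) / 2 ^ (M * n) ≤
        ∫⁻ S, empiricalRademacher P S ∂π := by
      rw [div_eq_mul_inv, ← lintegral_mul_const'' _ (by
        refine Measurable.aemeasurable (Finset.measurable_sum _ fun σ _ => Measurable.iSup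
          fun t => ?_)
        have := hgm t
        fun_prop)]
      refine lintegral_mono fun S => ?_
      rw [empiricalRademacher, div_eq_mul_inv]
      gcongr
      exact sum_iSup_sub_le_signedSup hωs hTW S
    exact mul_le_mul_right (h1.trans (le_iSup₂_of_le D hD
      (le_iSup₂_of_le (f := fun (p : Predictor K X) (_ : ∀ m, IsActionRule (p m)) =>
        ∫⁻ S, empiricalRademacher P S ∂(dataLaw n D p)) p hp le_rfl))) 2

/-- The squared prediction error is controlled by the excess risk, because the conditional expected
loss is strongly convex and the true mean reward minimizes it. -/
lemma lintegral_sqError_le (hM : 0 < M)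
    (hf : ∀ m a, Measurable fun q : Param d × X m => P.f q.1 m q.2 a)
    (hl : ∀ m, Measurable fun q : ℝ × ℝ => P.loss m q.1 q.2)
    (hi : ∀ m, ∀ ω ∈ P.W, ∀ a, Integrable
        (fun q : X m × (Fin K → unitInterval) => P.loss m (P.f ω m q.1 a) (q.2 a))
        (D m : Measure (X m × (Fin K → unitInterval))))
    {μf : ℝ} (hμf : 0 < μf)
    (hsc : ∀ m, ∀ r : unitInterval, StrongConvexOn Set.univ μf fun y => P.loss m y r)
    (hωs : ωs ∈ P.W)
    (hreal : ∀ m, ∀ᵐ x ∂(contextLaw D m), ∀ a, P.f ωs m x a = meanReward D m x a)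
    (hopt : ∀ m, ∀ᵐ x ∂(contextLaw D m), ∀ a, ∀ y : ℝ,
        Integrable (fun r : Fin K → unitInterval => P.loss m y (r a)) (rewardLaw D m x) ∧
        ∫ r, P.loss m (P.f ωs m x a) (r a) ∂(rewardLaw D m x) ≤
          ∫ r, P.loss m y (r a) ∂(rewardLaw D m x))
    (hp : ∀ m, IsActionRule (p m)) {ω : Param d} (hω : ω ∈ P.W) :
    ∑ m, ∫⁻ x, ENNReal.ofReal (∑ a, p m x a * (P.f ω m x a - meanReward D m x a) ^ 2)
        ∂(contextLaw D m) ≤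
      ENNReal.ofReal (4 * M / μf * (risk P D p ω - risk P D p ωs)) := by
  have hM' : (M : ℝ) ≠ 0 := by exact_mod_cast hM.ne'
  set Λ : Fin M → ℝ := fun m =>
    ∫ z, sampleLoss P m z ω ∂(sampleLaw (D m : Measure (X m × (Fin K → unitInterval))) (p m)) -
    ∫ z, sampleLoss P m z ωs ∂(sampleLaw (D m : Measure (X m × (Fin K → unitInterval))) (p m))
    with hΛ
  have key : ∀ m, 0 ≤ 4 / μf * Λ m ∧
      ∫⁻ x, ENNReal.ofReal (∑ a, p m x a * (P.f ω m x a - meanReward D m x a) ^ 2)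
        ∂(contextLaw D m) ≤ ENNReal.ofReal (4 / μf * Λ m) := by
    intro m
    set ρ := (D m : Measure (X m × (Fin K → unitInterval))) with hρ
    have hNonempty : Nonempty (Fin K → unitInterval) := inferInstance
    set h : Fin K → X m × (Fin K → unitInterval) → ℝ := fun a z => p m z.1 a *
      (P.loss m (P.f ω m z.1 a) (z.2 a) - P.loss m (P.f ωs m z.1 a) (z.2 a)) with hh
    have hhi : ∀ a, Integrable (h a) ρ := fun a =>
      integrable_weighted (hp m) a ((hi m ω hω a).sub (hi m ωs hωs a))
    have hsumi : Integrable (fun z => ∑ a, h a z) (ρ.fst ⊗ₘ ρ.condKernel) := by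
      rw [ρ.disintegrate ρ.condKernel]
      exact integrable_finsetSum _ fun a _ => hhi a
    have e1 : Λ m = ∫ x, ∫ r, ∑ a, h a (x, r) ∂(rewardLaw D m x) ∂(contextLaw D m) := by
      have e2 : Λ m = ∑ a, ∫ z, h a z ∂ρ := by
        simp only [hΛ]
        rw [integral_sampleLaw (hp m) (measurable_sampleLoss hf hl m ω) (hi m ω hω),
          integral_sampleLaw (hp m) (measurable_sampleLoss hf hl m ωs) (hi m ωs hωs),
          ← Finset.sum_sub_distrib]
        refine Finset.sum_congr rfl fun a _ => ?_
        refine (integral_sub (integrable_weighted (hp m) a (hi m ω hω a))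
          (integrable_weighted (hp m) a (hi m ωs hωs a))).symm.trans ?_
        simp only [hh, mul_sub]
        rfl
      rw [e2, ← integral_finsetSum _ fun a _ => hhi a]
      nth_rewrite 1 [← ρ.disintegrate ρ.condKernel]
      rw [Measure.integral_compProd hsumi]
      rfl
    have hpt : ∀ᵐ x ∂(contextLaw D m),
        ∑ a, p m x a * (P.f ω m x a - meanReward D m x a) ^ 2 ≤
          4 / μf * ∫ r, ∑ a, h a (x, r) ∂(rewardLaw D m x) := by
      filter_upwards [hreal m, hopt m] with x hx hox
      have hai : ∀ a, Integrable (fun r => h a (x, r)) (rewardLaw D m x) := fun a =>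
        ((hox a (P.f ω m x a)).1.sub (hox a (P.f ωs m x a)).1).const_mul (p m x a)
      rw [integral_finsetSum _ fun a _ => hai a, Finset.mul_sum]
      refine Finset.sum_le_sum fun a _ => ?_
      simp only [hh]
      rw [integral_const_mul, integral_sub (hox a _).1 (hox a _).1, ← hx a]
      set y := P.f ω m x a
      set ys := P.f ωs m x a
      -- strong convexity at the midpoint of `y` and the minimizer `ys`
      have hmid : ∀ r : Fin K → unitInterval,
          P.loss m ((1 / 2 : ℝ) * y + (1 / 2 : ℝ) * ys) (r a) ≤ 1 / 2 * P.loss m y (r a) +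
            1 / 2 * P.loss m ys (r a) - μf / 8 * (y - ys) ^ 2 := by
        intro r
        have h1 := (hsc m (r a)).2 (Set.mem_univ y) (Set.mem_univ ys)
          (by norm_num : (0 : ℝ) ≤ 1 / 2) (by norm_num : (0 : ℝ) ≤ 1 / 2) (by norm_num)
        simp only [smul_eq_mul, Real.norm_eq_abs, sq_abs] at h1
        linarith
      have i1 := (hox a y).1.const_mul (1 / 2)
      have i2 := (hox a ys).1.const_mul (1 / 2)
      have : IsProbabilityMeasure (rewardLaw D m x) := by unfold rewardLaw; infer_instance
      have h2 := integral_mono (hox a _).1 ((i1.add i2).sub (integrable_const _)) hmid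
      have h3 := (hox a ((1 / 2 : ℝ) * y + (1 / 2 : ℝ) * ys)).2
      have h4 : ∫ r : Fin K → unitInterval, (1 / 2 * P.loss m y (r a) +
            1 / 2 * P.loss m ys (r a) - μf / 8 * (y - ys) ^ 2) ∂(rewardLaw D m x) =
          1 / 2 * ∫ r : Fin K → unitInterval, P.loss m y (r a) ∂(rewardLaw D m x) +
          1 / 2 * ∫ r : Fin K → unitInterval, P.loss m ys (r a) ∂(rewardLaw D m x) -
            μf / 8 * (y - ys) ^ 2 := by
        have i3 : Integrable (fun r : Fin K → unitInterval => 1 / 2 * P.loss m y (r a) +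
            1 / 2 * P.loss m ys (r a)) (rewardLaw D m x) := i1.add i2
        rw [integral_sub i3 (integrable_const _), integral_add i1 i2, integral_const_mul,
          integral_const_mul, integral_const, probReal_univ, one_smul]
      have h5 : (y - ys) ^ 2 ≤ 4 / μf * (∫ r : Fin K → unitInterval, P.loss m y (r a)
          ∂(rewardLaw D m x) - ∫ r : Fin K → unitInterval, P.loss m ys (r a)
          ∂(rewardLaw D m x)) := by
        have h6 := h3.trans (h2.trans_eq h4)
        rw [div_mul_eq_mul_div, le_div_iff₀ hμf]
        linarith
      have h7 := mul_le_mul_of_nonneg_left h5 ((hp m).nonneg x a)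
      linarith
    have hint : Integrable (fun x => ∫ r, ∑ a, h a (x, r) ∂(rewardLaw D m x))
        (contextLaw D m) := by
      have h1 := hsumi.integral_compProd
      simp only [Kernel.prodMkLeft_apply, Kernel.const_apply] at h1
      exact h1
    have hnn : ∀ᵐ x ∂(contextLaw D m),
        0 ≤ 4 / μf * ∫ r, ∑ a, h a (x, r) ∂(rewardLaw D m x) := by
      filter_upwards [hpt] with x hx
      exact (Finset.sum_nonneg fun a _ => mul_nonneg ((hp m).nonneg x a) (sq_nonneg _)).trans hx
    rw [e1, ← integral_const_mul]
    refine ⟨integral_nonneg_of_ae hnn, ?_⟩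
    rw [ofReal_integral_eq_lintegral_ofReal (hint.const_mul _) hnn]
    exact lintegral_mono_ae (by
      filter_upwards [hpt] with x hx
      exact ENNReal.ofReal_le_ofReal hx)
  refine (Finset.sum_le_sum fun m _ => (key m).2).trans ?_
  rw [← ENNReal.ofReal_sum_of_nonneg fun m _ => (key m).1]
  apply ENNReal.ofReal_le_ofReal
  rw [← Finset.mul_sum]
  simp only [hΛ, Finset.sum_sub_distrib, risk]
  apply le_of_eq
  field_simp

end Risk

/-! ### Inverse gap weighting -/

section IGW

variable {K : ℕ} {greedy : (Fin K → ℝ) → Fin K}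
  (hgr : ∀ (v : Fin K → ℝ) (a : Fin K), v a ≤ v (greedy v))

lemma sum_igw (γ : ℝ) (v : Fin K → ℝ) : ∑ a, igw greedy γ v a = 1 := by
  rw [← Finset.add_sum_erase _ _ (Finset.mem_univ (greedy v))]
  have : ∑ a ∈ Finset.univ.erase (greedy v), igw greedy γ v a =
      ∑ a ∈ Finset.univ.erase (greedy v), 1 / ((K : ℝ) + γ * (v (greedy v) - v a)) :=
    Finset.sum_congr rfl fun a ha => by rw [igw, if_neg (Finset.ne_of_mem_erase ha)]
  rw [this, igw, if_pos rfl]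
  ring

include hgr

lemma inv_le_igw {γ : ℝ} (hγ : 0 ≤ γ) (v : Fin K → ℝ) (a : Fin K) :
    1 / ((K : ℝ) + γ * (v (greedy v) - v a)) ≤ igw greedy γ v a := by
  by_cases h : a = greedy v
  · have hK : (0 : ℝ) < K := by exact_mod_cast Fin.pos a
    rw [igw, if_pos h, h]
    have h1 : ∑ a' ∈ Finset.univ.erase (greedy v), 1 / ((K : ℝ) + γ * (v (greedy v) - v a')) ≤
        ∑ _a' ∈ Finset.univ.erase (greedy v), 1 / (K : ℝ) := by
      refine Finset.sum_le_sum fun a' _ => one_div_le_one_div_of_le hK ?_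
      have := mul_nonneg hγ (sub_nonneg.2 (hgr v a'))
      linarith
    rw [Finset.sum_const, Finset.card_erase_of_mem (Finset.mem_univ _), Finset.card_univ,
      Fintype.card_fin, nsmul_eq_mul, Nat.cast_pred (Fin.pos a)] at h1
    have h2 : ((K : ℝ) - 1) * (1 / K) = 1 - 1 / K := by field_simp
    rw [sub_self, mul_zero, add_zero]
    linarith
  · rw [igw, if_neg h]

lemma igw_denominator_pos {γ : ℝ} (hγ : 0 ≤ γ) (v : Fin K → ℝ) (a : Fin K) :
    0 < (K : ℝ) + γ * (v (greedy v) - v a) := by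
  have hK : (0 : ℝ) < K := by exact_mod_cast Fin.pos a
  have := mul_nonneg hγ (sub_nonneg.2 (hgr v a))
  linarith

lemma igw_pos {γ : ℝ} (hγ : 0 ≤ γ) (v : Fin K → ℝ) (a : Fin K) : 0 < igw greedy γ v a :=
  (one_div_pos.2 (igw_denominator_pos hgr hγ v a)).trans_le (inv_le_igw hgr hγ v a)

lemma inv_igw_le {γ : ℝ} (hγ : 0 ≤ γ) (v : Fin K → ℝ) (a : Fin K) :
    1 / igw greedy γ v a ≤ K + γ * (v (greedy v) - v a) :=
  (one_div_le (igw_pos hgr hγ v a) (igw_denominator_pos hgr hγ v a)).2 (inv_le_igw hgr hγ v a)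

/-- The estimated regret of inverse gap weighting. -/
lemma sum_igw_mul_gap_le {γ : ℝ} (hγ : 0 < γ) (v : Fin K → ℝ) :
    ∑ a, igw greedy γ v a * (v (greedy v) - v a) ≤ K / γ := by
  have h : ∀ a ∈ Finset.univ, igw greedy γ v a * (v (greedy v) - v a) ≤ 1 / γ := by
    intro a _
    by_cases h : a = greedy v
    · rw [← h, sub_self, mul_zero]; positivity
    · have hp := igw_denominator_pos hgr hγ.le v a
      have hK : (0 : ℝ) < K := by exact_mod_cast Fin.pos a
      rw [igw, if_neg h, one_div_mul_eq_div, div_le_div_iff₀ hp hγ]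
      linarith
  refine (Finset.sum_le_sum h).trans_eq ?_
  rw [Finset.sum_const, Finset.card_univ, Fintype.card_fin, nsmul_eq_mul, mul_one_div]

omit hgr in
lemma measurable_igw (hm : Measurable greedy) (γ : ℝ) (a : Fin K) :
    Measurable fun v => igw greedy γ v a := by
  have hset : ∀ a, MeasurableSet {v : Fin K → ℝ | a = greedy v} := fun a =>
    measurableSet_eq_fun measurable_const hm
  have hmax : Measurable fun v : Fin K → ℝ => v (greedy v) := by
    have h : Measurable fun q : Fin K × (Fin K → ℝ) => q.2 q.1 :=
      measurable_from_prod_countable_right fun a => measurable_pi_apply a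
    exact h.comp (hm.prodMk measurable_id)
  have hinv : ∀ a, Measurable fun v : Fin K → ℝ =>
      1 / ((K : ℝ) + γ * (v (greedy v) - v a)) := fun a =>
    measurable_const.div (measurable_const.add
      ((hmax.sub (measurable_pi_apply a)).const_mul γ))
  have hsum : Measurable fun v : Fin K → ℝ => ∑ a' ∈ Finset.univ.erase (greedy v),
      1 / ((K : ℝ) + γ * (v (greedy v) - v a')) := by
    have e : (fun v : Fin K → ℝ => ∑ a' ∈ Finset.univ.erase (greedy v),
        1 / ((K : ℝ) + γ * (v (greedy v) - v a'))) = fun v => ∑ a',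
        if a' = greedy v then 0 else 1 / ((K : ℝ) + γ * (v (greedy v) - v a')) := by
      funext v
      rw [← Finset.add_sum_erase _ _ (Finset.mem_univ (greedy v)), if_pos rfl, zero_add]
      exact Finset.sum_congr rfl fun a ha => by rw [if_neg (Finset.ne_of_mem_erase ha)]
    rw [e]
    exact Finset.measurable_sum _ fun a' _ => Measurable.ite (hset a') measurable_const (hinv a')
  unfold igw
  exact Measurable.ite (hset a) (measurable_const.sub hsum) (hinv a)

lemma isActionRule_igw {Y : Type*} [MeasurableSpace Y] (hm : Measurable greedy) {γ : ℝ}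
    (hγ : 0 ≤ γ) {v : Y → Fin K → ℝ} (hv : ∀ a, Measurable fun x => v x a) :
    IsActionRule fun x => igw greedy γ (v x) where
  measurable a := (measurable_igw hm γ a).comp (measurable_pi_lambda _ hv)
  nonneg x a := (igw_pos hgr hγ (v x) a).le
  sum_eq_one x := sum_igw γ (v x)

/-- One epoch of inverse gap weighting. Suppose that the old distribution `p` explores each action
at a rate tied to its true regret, up to an excess `B`. If the squared error of the new predictor
`v` under `p` is `Q`, then the new distribution has the same property with an excess `B'`, in which
the old excess is damped, and its regret is of the order `(K + B') / γ'`. -/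
lemma igw_step {γ γ' B : ℝ} (hγ' : 0 < γ') (hle : γ ≤ γ')
    {p u v : Fin K → ℝ} (hp : ∀ a, 0 < p a)
    (hinv : ∀ a, 1 / p a ≤ K + 2 * γ * (u (greedy u) - u a) + B) :
    (∀ a, 1 / igw greedy γ' v a ≤ K + 2 * γ' * (u (greedy u) - u a) +
      (B / 4 + K / 4 + 4 * γ' ^ 2 * ∑ a, p a * (v a - u a) ^ 2)) ∧
    ∑ a, igw greedy γ' v a * (u (greedy u) - u a) ≤
      4 / 3 * (K + (B / 4 + K / 4 + 4 * γ' ^ 2 * ∑ a, p a * (v a - u a) ^ 2)) / γ' := by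
  set Q := ∑ a, p a * (v a - u a) ^ 2 with hQ
  set δ := (K + B) / (8 * γ') + 2 * γ' * Q with hδ
  have hB' : B / 4 + K / 4 + 4 * γ' ^ 2 * Q = 2 * γ' * δ := by
    rw [hδ]; field_simp; ring
  have hreg : ∀ a, 0 ≤ u (greedy u) - u a := fun a => sub_nonneg.2 (hgr u a)
  -- the prediction error of an action, in terms of how often it has been explored
  have herr : ∀ a, |v a - u a| ≤ δ + (u (greedy u) - u a) / 4 := by
    intro a
    have h1 : p a * (v a - u a) ^ 2 ≤ Q :=
      Finset.single_le_sum (f := fun a => p a * (v a - u a) ^ 2)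
        (fun a _ => mul_nonneg (hp a).le (sq_nonneg _)) (Finset.mem_univ a)
    have h2 : |v a - u a| ≤ 1 / p a / (8 * γ') + 2 * γ' * (p a * (v a - u a) ^ 2) := by
      have h3 : 0 ≤ (4 * γ' * p a * |v a - u a| - 1) ^ 2 / (8 * γ' * p a) := by
        have := hp a; positivity
      have h4 : (4 * γ' * p a * |v a - u a| - 1) ^ 2 / (8 * γ' * p a) =
          1 / p a / (8 * γ') + 2 * γ' * (p a * |v a - u a| ^ 2) - |v a - u a| := by
        have := (hp a).ne'
        field_simp
        ring
      rw [sq_abs] at h4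
      linarith
    have h5 : 1 / p a / (8 * γ') ≤ (K + B) / (8 * γ') + (u (greedy u) - u a) / 4 := by
      rw [div_le_iff₀ (by positivity), add_mul, div_mul_cancel₀ _ (by positivity)]
      have h6 := hinv a
      have h7 : γ * (u (greedy u) - u a) ≤ γ' * (u (greedy u) - u a) :=
        mul_le_mul_of_nonneg_right hle (hreg a)
      linarith
    have h8 : 2 * γ' * (p a * (v a - u a) ^ 2) ≤ 2 * γ' * Q := by gcongr
    linarith
  have herr' := fun a => abs_le.1 (herr a)
  have hstar := herr' (greedy u)
  rw [sub_self, zero_div, add_zero] at hstar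
  rw [hB']
  constructor
  · intro a
    refine (inv_igw_le hgr hγ'.le v a).trans ?_
    -- estimated regret in terms of the true one
    have h1 : v (greedy v) - v a ≤ 5 / 4 * (u (greedy u) - u a) + 2 * δ := by
      have h2 := (herr' (greedy v)).2
      have h3 := (herr' a).1
      have h4 := hreg (greedy v)
      linarith
    have h5 := mul_le_mul_of_nonneg_left h1 hγ'.le
    have h6 := mul_nonneg hγ'.le (hreg a)
    linarith
  · -- true regret in terms of the estimated one
    have h1 : ∀ a, u (greedy u) - u a ≤ 4 / 3 * (v (greedy v) - v a) + 8 / 3 * δ := by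
      intro a
      have h2 := hstar.1
      have h3 := (herr' a).2
      have h4 := hgr v (greedy u)
      linarith
    have h5 : ∑ a, igw greedy γ' v a * (u (greedy u) - u a) ≤
        ∑ a, (4 / 3 * (igw greedy γ' v a * (v (greedy v) - v a)) +
          igw greedy γ' v a * (8 / 3 * δ)) := by
      refine Finset.sum_le_sum fun a _ => ?_
      have := mul_le_mul_of_nonneg_left (h1 a) (igw_pos hgr hγ'.le v a).le
      linarith
    rw [Finset.sum_add_distrib, ← Finset.mul_sum, ← Finset.sum_mul, sum_igw, one_mul] at h5
    have h6 := sum_igw_mul_gap_le hgr hγ' v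
    have h7 : 4 / 3 * (K + 2 * γ' * δ) / γ' = 4 / 3 * (K / γ') + 8 / 3 * δ := by
      field_simp; ring
    rw [h7]
    linarith

end IGW

/-! ### The regret of one epoch -/

section Regret

variable {M K d : ℕ} {X : Fin M → Type*} [∀ m, MeasurableSpace (X m)] {D : Env K X}

lemma measurable_meanReward (m : Fin M) (a : Fin K) :
    Measurable fun x => meanReward D m x a := by
  have h : StronglyMeasurable fun x =>
      ∫ r : Fin K → unitInterval, (r a : ℝ)
        ∂((D m : Measure (X m × (Fin K → unitInterval))).condKernel x) := by
    apply StronglyMeasurable.integral_kernel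
    exact (by fun_prop : Measurable fun r : Fin K → unitInterval => (r a : ℝ)).stronglyMeasurable
  exact h.measurable

lemma meanReward_mem_Icc (m : Fin M) (x : X m) (a : Fin K) :
    meanReward D m x a ∈ Set.Icc (0 : ℝ) 1 := by
  have : IsProbabilityMeasure (rewardLaw D m x) := by unfold rewardLaw; infer_instance
  refine ⟨integral_nonneg fun r => (r a).2.1, ?_⟩
  have h := integral_mono_of_nonneg (μ := rewardLaw D m x)
    (Filter.Eventually.of_forall fun r : Fin K → unitInterval => (r a).2.1)
    (integrable_const (1 : ℝ)) (Filter.Eventually.of_forall fun r => (r a).2.2)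
  rw [meanReward]
  simpa using h

variable {greedy : (Fin K → ℝ) → Fin K}

/-- The gap between the largest mean reward and that of action `a`. -/
noncomputable def gap (D : Env K X) (greedy : (Fin K → ℝ) → Fin K) (m : Fin M) (x : X m)
    (a : Fin K) : ℝ :=
  meanReward D m x (greedy (meanReward D m x)) - meanReward D m x a

lemma measurable_gap (hm : Measurable greedy) (m : Fin M) (a : Fin K) :
    Measurable fun x => gap D greedy m x a := by
  have h : Measurable fun q : Fin K × (Fin K → ℝ) => q.2 q.1 :=
    measurable_from_prod_countable_right fun a => measurable_pi_apply a
  have hμ : Measurable fun x => meanReward D m x :=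
    measurable_pi_lambda _ fun a => measurable_meanReward m a
  exact (h.comp ((hm.comp hμ).prodMk hμ)).sub (measurable_meanReward m a)

/-- The expected regret of an epoch, in terms of the action selection distribution. The regret is
replaced by a measurable upper bound, which also counts the steps after the horizon. -/
lemma lintegral_epochRegret_le (hm : Measurable greedy)
    (hgr : ∀ (v : Fin K → ℝ) (a : Fin K), v a ≤ v (greedy v)) {p : Predictor K X}
    (hp : ∀ m, IsActionRule (p m)) (E : ℕ → ℕ+) (T l : ℕ) :
    ∃ Φ : Dataset K (E l) X → ℝ≥0∞, Measurable Φ ∧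
      (∀ S, ENNReal.ofReal (epochRegret D E T l S) ≤ Φ S) ∧
      ∫⁻ S, Φ S ∂(dataLaw (E l) D p) ≤ (E l : ℕ) *
        ∑ m, ∫⁻ x, ENNReal.ofReal (∑ a, p m x a * gap D greedy m x a) ∂(contextLaw D m) := by
  have := fun m => isProbabilityMeasure_sampleLaw
    (ρ := (D m : Measure (X m × (Fin K → unitInterval)))) (hp m)
  have hgap : ∀ m x a, 0 ≤ gap D greedy m x a := fun m x a => sub_nonneg.2 (hgr _ a)
  have hφ : ∀ m, Measurable fun z : Sample K (X m) =>
      ENNReal.ofReal (gap D greedy m z.1 z.2.1) := by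
    intro m
    have h1 : Measurable fun q : Fin K × X m => gap D greedy m q.2 q.1 :=
      measurable_from_prod_countable_right fun a => measurable_gap hm m a
    exact (h1.comp (by fun_prop : Measurable fun z : Sample K (X m) =>
      (z.2.1, z.1))).ennreal_ofReal
  have hcomp : ∀ m (i : Fin (E l)), Measurable fun S : Dataset K (E l) X =>
      ENNReal.ofReal (gap D greedy m (S m i).1 (S m i).2.1) := fun m i =>
    (hφ m).comp (by fun_prop : Measurable fun S : Dataset K (E l) X => S m i)
  refine ⟨fun S => ∑ m, ∑ i, ENNReal.ofReal (gap D greedy m (S m i).1 (S m i).2.1), ?_, ?_, ?_⟩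
  · exact Finset.measurable_sum _ fun m _ => Finset.measurable_sum _ fun i _ => hcomp m i
  · intro S
    have e : ∑ m, ∑ i, ENNReal.ofReal (gap D greedy m (S m i).1 (S m i).2.1) =
        ENNReal.ofReal (∑ m, ∑ i, gap D greedy m (S m i).1 (S m i).2.1) := by
      rw [ENNReal.ofReal_sum_of_nonneg fun m _ => Finset.sum_nonneg fun i _ => hgap m _ _]
      exact Finset.sum_congr rfl fun m _ =>
        (ENNReal.ofReal_sum_of_nonneg fun i _ => hgap m _ _).symm
    refine le_of_le_of_eq ?_ e.symm
    apply ENNReal.ofReal_le_ofReal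
    refine Finset.sum_le_sum fun m _ => Finset.sum_le_sum fun i _ => ?_
    have hsup : ⨆ a, meanReward D m (S m i).1 a =
        meanReward D m (S m i).1 (greedy (meanReward D m (S m i).1)) := by
      have : Nonempty (Fin K) := ⟨greedy 0⟩
      exact le_antisymm (ciSup_le fun a => hgr _ a)
        (le_ciSup (Set.finite_range _).bddAbove _)
    split_ifs
    · rw [hsup]; rfl
    · exact hgap m _ _
  · rw [lintegral_finsetSum _ fun m _ => Finset.measurable_sum _ fun i _ => hcomp m i,
      Finset.mul_sum]
    refine Finset.sum_le_sum fun m _ => ?_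
    rw [lintegral_finsetSum _ fun i _ => hcomp m i]
    have h1 : ∀ i : Fin (E l), ∫⁻ S, ENNReal.ofReal (gap D greedy m (S m i).1 (S m i).2.1)
        ∂(dataLaw (E l) D p) = ∫⁻ x, ENNReal.ofReal (∑ a, p m x a * gap D greedy m x a)
          ∂(contextLaw D m) := by
      intro i
      have h2 := (measurePreserving_sample (n := E l)
        (fun m => sampleLaw (D m : Measure (X m × (Fin K → unitInterval))) (p m)) m i).lintegral_comp
        (hφ m)
      refine h2.trans ?_
      rw [lintegral_sampleLaw (hp m) (hφ m)]
      have h3 : ∀ a, Measurable fun x => p m x a * gap D greedy m x a := fun a =>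
        ((hp m).measurable a).mul (measurable_gap hm m a)
      rw [contextLaw, Measure.fst, lintegral_map (by fun_prop) measurable_fst]
      have h4 : ∀ z : X m × (Fin K → unitInterval),
          ENNReal.ofReal (∑ a, p m z.1 a * gap D greedy m z.1 a) =
          ∑ a, ENNReal.ofReal (p m z.1 a) * ENNReal.ofReal (gap D greedy m z.1 a) := by
        intro z
        rw [ENNReal.ofReal_sum_of_nonneg fun a _ => mul_nonneg ((hp m).nonneg _ a) (hgap m _ a)]
        exact Finset.sum_congr rfl fun a _ => ENNReal.ofReal_mul ((hp m).nonneg _ a)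
      simp only [h4]
      rw [lintegral_finsetSum]
      intro a _
      have h5 := (hp m).measurable a
      have h6 := measurable_gap (D := D) hm m a
      fun_prop
    simp only [h1, Finset.sum_const, Finset.card_univ, Fintype.card_fin, nsmul_eq_mul]
    exact le_rfl

end Regret

/-! ### The squared error after one call of the protocol -/

instance isProbabilityMeasure_contextLaw {M K : ℕ} {X : Fin M → Type*}
    [∀ m, MeasurableSpace (X m)] (D : Env K X) (m : Fin M) :
    IsProbabilityMeasure (contextLaw D m) := by
  unfold contextLaw; infer_instance

lemma isProbabilityMeasure_dataLaw {M K n : ℕ} {X : Fin M → Type*} [∀ m, MeasurableSpace (X m)]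
    (D : Env K X) {p : Predictor K X} (hp : ∀ m, IsActionRule (p m)) :
    IsProbabilityMeasure (dataLaw n D p) := by
  have := fun m => isProbabilityMeasure_sampleLaw
    (ρ := (D m : Measure (X m × (Fin K → unitInterval)))) (hp m)
  unfold dataLaw; infer_instance

section SqError

variable {M K d n : ℕ} {X : Fin M → Type*} [∀ m, MeasurableSpace (X m)] {P : Model K d X}
  {D : Env K X} {p : Predictor K X} {ωs : Param d}

/-- The squared prediction error of `f_ω` when the actions are drawn according to `p`, summed over
the agents. -/
noncomputable def sqError (P : Model K d X) (D : Env K X) (p : Predictor K X) (ω : Param d) :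
    ℝ≥0∞ :=
  ∑ m, ∫⁻ x, ENNReal.ofReal (∑ a, p m x a * (P.f ω m x a - meanReward D m x a) ^ 2)
    ∂(contextLaw D m)

/-- The squared prediction error after one call of the protocol: the generalization error costs
twice the Rademacher complexity, the optimization error four times. -/
lemma lintegral_sqError_output_le [NeZero n] {𝓔 : Set (Env K X)} (hD : D ∈ 𝓔) (hM : 0 < M)
    (hf : ∀ m a, Measurable fun q : Param d × X m => P.f q.1 m q.2 a)
    (hl : ∀ m, Measurable fun q : ℝ × ℝ => P.loss m q.1 q.2)
    (hd : ∀ m z, Differentiable ℝ (sampleLoss P m z))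
    (hi : ∀ m, ∀ ω ∈ P.W, ∀ a, Integrable
        (fun q : X m × (Fin K → unitInterval) => P.loss m (P.f ω m q.1 a) (q.2 a))
        (D m : Measure (X m × (Fin K → unitInterval))))
    {μf : ℝ} (hμf : 0 < μf)
    (hsc : ∀ m, ∀ r : unitInterval, StrongConvexOn Set.univ μf fun y => P.loss m y r)
    (hωs : ωs ∈ P.W)
    (hreal : ∀ m, ∀ᵐ x ∂(contextLaw D m), ∀ a, P.f ωs m x a = meanReward D m x a)
    (hopt : ∀ m, ∀ᵐ x ∂(contextLaw D m), ∀ a, ∀ y : ℝ,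
        Integrable (fun r : Fin K → unitInterval => P.loss m y (r a)) (rewardLaw D m x) ∧
        ∫ r, P.loss m (P.f ωs m x a) (r a) ∂(rewardLaw D m x) ≤
          ∫ r, P.loss m y (r a) ∂(rewardLaw D m x))
    (hR : rademacher P 𝓔 n ≠ ⊤) {proto : Protocol} {h : Tuning} {ω₀ : Param d}
    (hout : ∀ (S : Dataset K n X) ξ, output P proto h ω₀ S ξ ∈ P.W)
    (hgap : ∀ S : Dataset K n X, ∃ xs, IsEmpiricalOptimum P S xs ∧
      ∫⁻ ξ, ENNReal.ofReal (globalLoss P S (output P proto h ω₀ S ξ) - globalLoss P S xs)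
        ∂(seedLaw M n) ≤ ENNReal.ofReal (4 * (rademacher P 𝓔 n).toReal))
    (hp : ∀ m, IsActionRule (p m)) :
    ∫⁻ S, ∫⁻ ξ, sqError P D p (output P proto h ω₀ S ξ) ∂(seedLaw M n) ∂(dataLaw n D p) ≤
      ENNReal.ofReal (24 * M * (rademacher P 𝓔 n).toReal / μf) := by
  have := isProbabilityMeasure_dataLaw (n := n) D hp
  obtain ⟨Γ, hΓm, hΓ, hΓi⟩ :=
    exists_generalization_bound hD (NeZero.pos n) hM hf hl hd hi hp hωs
  set R := (rademacher P 𝓔 n).toReal with hRdef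
  have hR0 : 0 ≤ R := ENNReal.toReal_nonneg
  have hc : 0 ≤ 4 * (M : ℝ) / μf := by positivity
  calc ∫⁻ S, ∫⁻ ξ, sqError P D p (output P proto h ω₀ S ξ) ∂(seedLaw M n) ∂(dataLaw n D p)
      ≤ ∫⁻ S, ENNReal.ofReal (4 * M / μf) * (Γ S + ENNReal.ofReal (4 * R)) ∂(dataLaw n D p) := by
        refine lintegral_mono fun S => ?_
        obtain ⟨xs, hxs, hxs'⟩ := hgap S
        refine (lintegral_mono (g := fun ξ => ENNReal.ofReal (4 * M / μf) * (Γ S +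
          ENNReal.ofReal (globalLoss P S (output P proto h ω₀ S ξ) - globalLoss P S xs)))
          fun ξ => ?_).trans ?_
        · refine (lintegral_sqError_le hM hf hl hi hμf hsc hωs hreal hopt hp (hout S ξ)).trans ?_
          rw [ENNReal.ofReal_mul hc]
          refine mul_le_mul_right ?_ _
          refine (ENNReal.ofReal_le_ofReal ?_).trans
            (ENNReal.ofReal_add_le.trans (add_le_add (hΓ S _ (hout S ξ)) le_rfl))
          have := hxs ωs
          linarith
        · rw [lintegral_const_mul' _ _ ENNReal.ofReal_ne_top,
            lintegral_add_left measurable_const, lintegral_const, measure_univ, mul_one]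
          exact mul_le_mul_right (add_le_add le_rfl hxs') _
    _ ≤ ENNReal.ofReal (4 * M / μf) * (2 * ENNReal.ofReal R + ENNReal.ofReal (4 * R)) := by
        rw [lintegral_const_mul' _ _ ENNReal.ofReal_ne_top, lintegral_add_left hΓm,
          lintegral_const, measure_univ, mul_one, hRdef, ENNReal.ofReal_toReal hR]
        gcongr
    _ = ENNReal.ofReal (24 * M * R / μf) := by
        rw [← ENNReal.ofReal_ofNat 2, ← ENNReal.ofReal_mul (by norm_num),
          ← ENNReal.ofReal_add (by positivity) (by positivity), ← ENNReal.ofReal_mul hc]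
        congr 1
        ring

end SqError

/-! ### The regret over all epochs -/

section Epochs

variable {M K d : ℕ} {X : Fin M → Type*} [∀ m, MeasurableSpace (X m)] {P : Model K d X}
  {D : Env K X} {proto : Protocol} {greedy : (Fin K → ℝ) → Fin K} {γ : ℕ → ℝ} {E : ℕ → ℕ+}
  {h : ℕ → Tuning} {ω₀ : Param d} {T : ℕ}

/-- One epoch, when the expected regret of the later epochs is affinely bounded in the squared
error of the next predictor. -/
lemma ofReal_regretFrom_succ_le (hm : Measurable greedy)
    (hgr : ∀ (v : Fin K → ℝ) (a : Fin K), v a ≤ v (greedy v)) {k l : ℕ} {fhat : Predictor K X}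
    (hp : ∀ m, IsActionRule fun x => igw greedy (γ l) (fhat m x)) {U s A c Q : ℝ≥0∞}
    (hs : s ≠ ⊤) (hc : c ≠ ⊤)
    (hnext : ∀ (S : Dataset K (E l) X) ξ,
      ENNReal.ofReal (regretFrom D P proto greedy γ E h ω₀ T k (l + 1)
        (P.f (output P proto (h l) ω₀ S ξ))) ≤
      U + s * (A + c * sqError P D (fun m x => igw greedy (γ l) (fhat m x))
        (output P proto (h l) ω₀ S ξ)))
    (hQ : ∫⁻ S, ∫⁻ ξ, sqError P D (fun m x => igw greedy (γ l) (fhat m x))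
        (output P proto (h l) ω₀ S ξ) ∂(seedLaw M (E l))
        ∂(dataLaw (E l) D fun m x => igw greedy (γ l) (fhat m x)) ≤ Q) :
    ENNReal.ofReal (regretFrom D P proto greedy γ E h ω₀ T (k + 1) l fhat) ≤
      (E l : ℕ) * ∑ m, ∫⁻ x, ENNReal.ofReal
        (∑ a, igw greedy (γ l) (fhat m x) a * gap D greedy m x a) ∂(contextLaw D m) +
      (U + s * (A + c * Q)) := by
  set p : Predictor K X := fun m x => igw greedy (γ l) (fhat m x) with hpdef
  have := isProbabilityMeasure_dataLaw (n := E l) D hp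
  obtain ⟨Φ, hΦm, hΦ, hΦi⟩ := lintegral_epochRegret_le (D := D) hm hgr hp E T l
  set q : Dataset K (E l) X → ℝ≥0∞ := fun S =>
    ∫⁻ ξ, sqError P D p (output P proto (h l) ω₀ S ξ) ∂(seedLaw M (E l)) with hq
  calc ENNReal.ofReal (regretFrom D P proto greedy γ E h ω₀ T (k + 1) l fhat)
      ≤ ∫⁻ S, (Φ S + (U + s * (A + c * q S))) ∂(dataLaw (E l) D p) := by
        rw [regretFrom]
        refine (ofReal_integral_le_lintegral _).trans (lintegral_mono fun S => ?_)
        refine ENNReal.ofReal_add_le.trans (add_le_add (hΦ S) ?_)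
        refine (ofReal_integral_le_lintegral _).trans
          ((lintegral_mono fun ξ => hnext S ξ).trans_eq ?_)
        rw [lintegral_add_left measurable_const, lintegral_const, measure_univ, mul_one,
          lintegral_const_mul' _ _ hs, lintegral_add_left measurable_const, lintegral_const,
          measure_univ, mul_one, lintegral_const_mul' _ _ hc]
    _ = ∫⁻ S, Φ S ∂(dataLaw (E l) D p) +
          (U + s * (A + c * ∫⁻ S, q S ∂(dataLaw (E l) D p))) := by
        rw [lintegral_add_left hΦm, lintegral_add_left measurable_const, lintegral_const,
          measure_univ, mul_one, lintegral_const_mul' _ _ hs, lintegral_add_left measurable_const,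
          lintegral_const, measure_univ, mul_one, lintegral_const_mul' _ _ hc]
    _ ≤ _ := by gcongr

/-- The mean of an excess `B`, summed over the agents. -/
noncomputable def meanExcess (D : Env K X) (B : ∀ m, X m → ℝ) : ℝ≥0∞ :=
  ∑ m, ∫⁻ x, ENNReal.ofReal (B m x) ∂(contextLaw D m)

/-- The excess produced by `igw_step` has its mean damped by `1/4`. -/
lemma meanExcess_step_le {p : Predictor K X} {B : ∀ m, X m → ℝ} (hB : ∀ m, Measurable (B m))
    (γ' : ℝ) (ω : Param d) :
    meanExcess D (fun m x => B m x / 4 + K / 4 +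
        4 * γ' ^ 2 * ∑ a, p m x a * (P.f ω m x a - meanReward D m x a) ^ 2) ≤
      (ENNReal.ofReal (1 / 4) * meanExcess D B + ENNReal.ofReal (K * M / 4)) +
        ENNReal.ofReal (4 * γ' ^ 2) * sqError P D p ω := by
  have h1 : ∀ m, ∫⁻ x, ENNReal.ofReal (B m x / 4 + K / 4 +
        4 * γ' ^ 2 * ∑ a, p m x a * (P.f ω m x a - meanReward D m x a) ^ 2) ∂(contextLaw D m) ≤
      (ENNReal.ofReal (1 / 4) * ∫⁻ x, ENNReal.ofReal (B m x) ∂(contextLaw D m) +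
        ENNReal.ofReal (K / 4)) +
      ENNReal.ofReal (4 * γ' ^ 2) * ∫⁻ x, ENNReal.ofReal
        (∑ a, p m x a * (P.f ω m x a - meanReward D m x a) ^ 2) ∂(contextLaw D m) := by
    intro m
    refine (lintegral_mono (g := fun x => (ENNReal.ofReal (1 / 4) * ENNReal.ofReal (B m x) +
      ENNReal.ofReal (K / 4)) + ENNReal.ofReal (4 * γ' ^ 2) * ENNReal.ofReal
        (∑ a, p m x a * (P.f ω m x a - meanReward D m x a) ^ 2)) fun x => ?_).trans_eq ?_
    · refine ENNReal.ofReal_add_le.trans (add_le_add (ENNReal.ofReal_add_le.trans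
        (add_le_add (le_of_eq ?_) le_rfl)) (le_of_eq (ENNReal.ofReal_mul (by positivity))))
      rw [← ENNReal.ofReal_mul (by norm_num)]
      congr 1
      ring
    · have hBm := hB m
      rw [lintegral_add_left (by fun_prop), lintegral_const_mul' _ _ ENNReal.ofReal_ne_top,
        lintegral_add_right _ measurable_const, lintegral_const, measure_univ, mul_one,
        lintegral_const_mul' _ _ ENNReal.ofReal_ne_top]
  refine (Finset.sum_le_sum fun m _ => h1 m).trans_eq ?_
  rw [Finset.sum_add_distrib, Finset.sum_add_distrib, ← Finset.mul_sum, ← Finset.mul_sum,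
    Finset.sum_const, Finset.card_univ, Fintype.card_fin, nsmul_eq_mul, meanExcess, sqError,
    ← ENNReal.ofReal_natCast M, ← ENNReal.ofReal_mul (by positivity)]
  congr 3
  ring_nf

/-- The distributions of inverse gap weighting with the predictor `fhat` explore each action at a
rate tied to its true gap, up to the excess `B`, and their regret is bounded accordingly. -/
structure ExploresUpTo (D : Env K X) (greedy : (Fin K → ℝ) → Fin K) (γ : ℝ)
    (fhat : Predictor K X) (B : ∀ m, X m → ℝ) : Prop where
  measurable_excess : ∀ m, Measurable (B m)
  excess_nonneg : ∀ m x, 0 ≤ B m x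
  measurable_predictor : ∀ m a, Measurable fun x => fhat m x a
  inv_le : ∀ m x a, 1 / igw greedy γ (fhat m x) a ≤ K + 2 * γ * gap D greedy m x a + B m x
  regret_le : ∀ m x, ∑ a, igw greedy γ (fhat m x) a * gap D greedy m x a ≤
    4 / 3 * (K + B m x) / γ

/-- One epoch followed by `k` others, whose regret is bounded in terms of the mean excess of the
next predictor. The exploration in this epoch is only required to be tied to the gaps at some rate
`g`, which lets the first epoch take part with `g = 0`. -/
lemma ofReal_regretFrom_succ_le_of_excess (hm : Measurable greedy)
    (hgr : ∀ (v : Fin K → ℝ) (a : Fin K), v a ≤ v (greedy v))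
    (hf : ∀ m a, Measurable fun q : Param d × X m => P.f q.1 m q.2 a) {k l : ℕ}
    (hγ : 0 ≤ γ l) (hγ' : 0 < γ (l + 1)) {Q : ℝ≥0∞}
    (hQ : ∀ p : Predictor K X, (∀ m, IsActionRule (p m)) →
      ∫⁻ S, ∫⁻ ξ, sqError P D p (output P proto (h l) ω₀ S ξ) ∂(seedLaw M (E l))
        ∂(dataLaw (E l) D p) ≤ Q)
    (hγQ : ENNReal.ofReal (4 * γ (l + 1) ^ 2) * Q ≤ ENNReal.ofReal (96 * (K * M)))
    {fhat : Predictor K X} (hfhat : ∀ m a, Measurable fun x => fhat m x a)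
    {B : ∀ m, X m → ℝ} (hB : ∀ m, Measurable (B m)) (hB0 : ∀ m x, 0 ≤ B m x) {g : ℝ}
    (hg : k ≠ 0 → g ≤ γ (l + 1))
    (hinv : ∀ m x a, 1 / igw greedy (γ l) (fhat m x) a ≤
      K + 2 * g * gap D greedy m x a + B m x)
    {U s : ℝ≥0∞} (hs : s ≠ ⊤)
    (hk : ∀ fhat' B', ExploresUpTo D greedy (γ (l + 1)) fhat' B' →
      ENNReal.ofReal (regretFrom D P proto greedy γ E h ω₀ T k (l + 1) fhat') ≤
        U + s * meanExcess D B') :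
    ENNReal.ofReal (regretFrom D P proto greedy γ E h ω₀ T (k + 1) l fhat) ≤
      (E l : ℕ) * ∑ m, ∫⁻ x, ENNReal.ofReal
        (∑ a, igw greedy (γ l) (fhat m x) a * gap D greedy m x a) ∂(contextLaw D m) +
      (U + s * (ENNReal.ofReal (1 / 4) * meanExcess D B + ENNReal.ofReal (97 * (K * M)))) := by
  have hp : ∀ m, IsActionRule fun x => igw greedy (γ l) (fhat m x) := fun m =>
    isActionRule_igw hgr hm hγ (hfhat m)
  refine (ofReal_regretFrom_succ_le (U := U) (s := s)
    (A := ENNReal.ofReal (1 / 4) * meanExcess D B + ENNReal.ofReal (K * M / 4))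
    (c := ENNReal.ofReal (4 * γ (l + 1) ^ 2)) (Q := Q)
    hm hgr hp hs ENNReal.ofReal_ne_top (fun S ξ => ?_) (hQ _ hp)).trans ?_
  · rcases Nat.eq_zero_or_pos k with rfl | hkpos
    · simp [regretFrom]
    · set ω := output P proto (h l) ω₀ S ξ
      have hfω : ∀ m a, Measurable fun x => P.f ω m x a := fun m a =>
        (hf m a).comp (by fun_prop : Measurable fun x : X m => (ω, x))
      have hstep := fun m x => igw_step hgr (v := P.f ω m x) hγ' (hg hkpos.ne')
        (igw_pos hgr hγ (fhat m x)) (u := meanReward D m x) (B := B m x) (hinv m x)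
      have hQm : ∀ m, Measurable fun x => ∑ a, igw greedy (γ l) (fhat m x) a *
          (P.f ω m x a - meanReward D m x a) ^ 2 := fun m =>
        Finset.measurable_sum _ fun a _ => ((hp m).measurable a).mul
          (((hfω m a).sub (measurable_meanReward m a)).pow_const 2)
      refine (hk (P.f ω) (fun m x => B m x / 4 + K / 4 + 4 * γ (l + 1) ^ 2 *
        ∑ a, igw greedy (γ l) (fhat m x) a * (P.f ω m x a - meanReward D m x a) ^ 2)
        ⟨fun m => ?_, fun m x => ?_, hfω, fun m x a => (hstep m x).1 a,
          fun m x => (hstep m x).2⟩).trans ?_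
      · exact (((hB m).div_const 4).add_const _).add ((hQm m).const_mul _)
      · have h1 := hB0 m x
        have h2 : 0 ≤ ∑ a, igw greedy (γ l) (fhat m x) a *
            (P.f ω m x a - meanReward D m x a) ^ 2 :=
          Finset.sum_nonneg fun a _ => mul_nonneg ((hp m).nonneg x a) (sq_nonneg _)
        positivity
      · gcongr
        exact meanExcess_step_le hB _ ω
  · rw [add_assoc (ENNReal.ofReal (1 / 4) * meanExcess D B)]
    gcongr
    refine (add_le_add le_rfl hγQ).trans ?_
    rw [← ENNReal.ofReal_add (by positivity) (by positivity)]
    apply ENNReal.ofReal_le_ofReal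
    have : (0 : ℝ) ≤ K * M := by positivity
    linarith

/-- The regret from epoch `l ≥ 2` on is at most affine in the mean excess at its start. The
coefficients account for mean excesses up to `194 K M`: this level reproduces itself, because an
epoch damps the excess by `1 / 4` and adds at most `97 K M`. -/
lemma exists_ofReal_regretFrom_le (hm : Measurable greedy)
    (hgr : ∀ (v : Fin K → ℝ) (a : Fin K), v a ≤ v (greedy v))
    (hf : ∀ m a, Measurable fun q : Param d × X m => P.f q.1 m q.2 a) {L : ℕ}
    (hγ : ∀ l ∈ Finset.Icc 1 L, 0 < γ (l + 1)) (hmono : MonotoneOn γ (Set.Icc 2 L))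
    {Q : ℕ → ℝ≥0∞}
    (hQ : ∀ l ∈ Finset.Icc 1 L, ∀ p : Predictor K X, (∀ m, IsActionRule (p m)) →
      ∫⁻ S, ∫⁻ ξ, sqError P D p (output P proto (h l) ω₀ S ξ) ∂(seedLaw M (E l))
        ∂(dataLaw (E l) D p) ≤ Q l)
    (hγQ : ∀ l ∈ Finset.Icc 1 L,
      ENNReal.ofReal (4 * γ (l + 1) ^ 2) * Q l ≤ ENNReal.ofReal (96 * (K * M))) (k : ℕ) :
    ∀ l, 2 ≤ l → l + k ≤ L + 1 → ∃ U s : ℝ≥0∞, s ≠ ⊤ ∧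
      U + s * ENNReal.ofReal (194 * (K * M)) ≤
        ∑ j ∈ Finset.range k, ENNReal.ofReal (260 * (K * M * E (l + j) / γ (l + j))) ∧
      ∀ fhat B, ExploresUpTo D greedy (γ l) fhat B →
        ENNReal.ofReal (regretFrom D P proto greedy γ E h ω₀ T k l fhat) ≤
          U + s * meanExcess D B := by
  induction k with
  | zero => exact fun l _ _ => ⟨0, 0, by simp, by simp, fun fhat B _ => by simp [regretFrom]⟩
  | succ k ih =>
    intro l hl hlk
    obtain ⟨U, s, hs, hUs, hk⟩ := ih (l + 1) (by omega) (by omega)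
    have hlL : l ∈ Finset.Icc 1 L := Finset.mem_Icc.2 (by omega)
    have hγl : 0 < γ l := by
      have := hγ (l - 1) (Finset.mem_Icc.2 (by omega))
      rwa [Nat.sub_add_cancel (by omega)] at this
    set w : ℝ := E l / γ l with hw
    have hw0 : 0 ≤ w := by positivity
    have hN : (0 : ℝ) ≤ K * M := by positivity
    -- the regret `(4 / 3) w (K M + excess)` of this epoch, and the affine bound of the next one
    -- at the damped excess
    refine ⟨ENNReal.ofReal (4 / 3 * w) * ENNReal.ofReal (K * M) + U +
      s * ENNReal.ofReal (97 * (K * M)), ENNReal.ofReal (4 / 3 * w) + s * ENNReal.ofReal (1 / 4),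
      ENNReal.add_ne_top.2 ⟨ENNReal.ofReal_ne_top, ENNReal.mul_ne_top hs ENNReal.ofReal_ne_top⟩,
      ?_, fun fhat B hB => ?_⟩
    · rw [Finset.sum_range_succ']
      have e : ∑ j ∈ Finset.range k, ENNReal.ofReal
            (260 * (K * M * E (l + (j + 1)) / γ (l + (j + 1)))) =
          ∑ j ∈ Finset.range k, ENNReal.ofReal (260 * (K * M * E (l + 1 + j) / γ (l + 1 + j))) :=
        Finset.sum_congr rfl fun j _ => by rw [Nat.add_comm j 1, ← Nat.add_assoc]
      rw [e, add_zero]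
      calc ENNReal.ofReal (4 / 3 * w) * ENNReal.ofReal (K * M) + U +
            s * ENNReal.ofReal (97 * (K * M)) +
            (ENNReal.ofReal (4 / 3 * w) + s * ENNReal.ofReal (1 / 4)) *
              ENNReal.ofReal (194 * (K * M))
          = (U + s * (ENNReal.ofReal (97 * (K * M)) +
              ENNReal.ofReal (1 / 4) * ENNReal.ofReal (194 * (K * M)))) +
            ENNReal.ofReal (4 / 3 * w) *
              (ENNReal.ofReal (K * M) + ENNReal.ofReal (194 * (K * M))) := by ring
        _ ≤ (U + s * ENNReal.ofReal (194 * (K * M))) +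
            ENNReal.ofReal (260 * (K * M * E l / γ l)) := by
          rw [← ENNReal.ofReal_mul (by norm_num), ← ENNReal.ofReal_add (by positivity)
            (by positivity), ← ENNReal.ofReal_add (by positivity) (by positivity),
            ← ENNReal.ofReal_mul (by positivity)]
          refine add_le_add (add_le_add le_rfl (mul_le_mul_right (ENNReal.ofReal_le_ofReal ?_) s))
            (ENNReal.ofReal_le_ofReal (le_of_eq ?_))
          · linarith
          · rw [hw]
            ring
        _ ≤ _ := by gcongr
    · refine (ofReal_regretFrom_succ_le_of_excess hm hgr hf hγl.le (hγ l hlL) (hQ l hlL)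
        (hγQ l hlL) hB.measurable_predictor hB.measurable_excess hB.excess_nonneg
        (g := γ l) (fun hk0 => hmono ⟨hl, by omega⟩ ⟨by omega, by omega⟩ (Nat.le_succ l))
        hB.inv_le hs hk).trans ?_
      have h1 : ((E l : ℕ) : ℝ≥0∞) * ∑ m, ∫⁻ x, ENNReal.ofReal
          (∑ a, igw greedy (γ l) (fhat m x) a * gap D greedy m x a) ∂(contextLaw D m) ≤
          ENNReal.ofReal (4 / 3 * w) * (ENNReal.ofReal (K * M) + meanExcess D B) := by
        have h2 : ∀ m, ∫⁻ x, ENNReal.ofReal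
            (∑ a, igw greedy (γ l) (fhat m x) a * gap D greedy m x a) ∂(contextLaw D m) ≤
            ENNReal.ofReal (4 / 3 / γ l) * (ENNReal.ofReal K +
              ∫⁻ x, ENNReal.ofReal (B m x) ∂(contextLaw D m)) := by
          intro m
          refine (lintegral_mono (g := fun x => ENNReal.ofReal (4 / 3 / γ l) *
            (ENNReal.ofReal K + ENNReal.ofReal (B m x))) fun x => ?_).trans_eq ?_
          · refine (ENNReal.ofReal_le_ofReal (hB.regret_le m x)).trans_eq ?_
            beta_reduce
            rw [← ENNReal.ofReal_add (by positivity) (hB.excess_nonneg m x),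
              ← ENNReal.ofReal_mul (by positivity)]
            congr 1
            ring
          · rw [lintegral_const_mul' _ _ ENNReal.ofReal_ne_top,
              lintegral_add_left measurable_const, lintegral_const, measure_univ, mul_one]
        refine (mul_le_mul_right (Finset.sum_le_sum fun m _ => h2 m) _).trans_eq ?_
        rw [← Finset.mul_sum, Finset.sum_add_distrib, Finset.sum_const, Finset.card_univ,
          Fintype.card_fin, nsmul_eq_mul, ← mul_assoc, ← meanExcess,
          ← ENNReal.ofReal_natCast M, ← ENNReal.ofReal_mul (by positivity),
          ← ENNReal.ofReal_natCast, ← ENNReal.ofReal_mul (by positivity)]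
        rw [mul_comm (M : ℝ), show (E l : ℝ) * (4 / 3 / γ l) = 4 / 3 * w by rw [hw]; ring]
      refine (add_le_add h1 le_rfl).trans_eq ?_
      ring

/-- The regret over all epochs. In the first epoch, where the predictor vanishes, the actions are
uniform and the regret per step is at most `1`. -/
lemma ofReal_regretFrom_one_le (hm : Measurable greedy)
    (hgr : ∀ (v : Fin K → ℝ) (a : Fin K), v a ≤ v (greedy v))
    (hf : ∀ m a, Measurable fun q : Param d × X m => P.f q.1 m q.2 a) {L : ℕ} (hγ0 : 0 ≤ γ 1)
    (hγ : ∀ l ∈ Finset.Icc 1 L, 0 < γ (l + 1)) (hmono : MonotoneOn γ (Set.Icc 2 L))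
    {Q : ℕ → ℝ≥0∞}
    (hQ : ∀ l ∈ Finset.Icc 1 L, ∀ p : Predictor K X, (∀ m, IsActionRule (p m)) →
      ∫⁻ S, ∫⁻ ξ, sqError P D p (output P proto (h l) ω₀ S ξ) ∂(seedLaw M (E l))
        ∂(dataLaw (E l) D p) ≤ Q l)
    (hγQ : ∀ l ∈ Finset.Icc 1 L,
      ENNReal.ofReal (4 * γ (l + 1) ^ 2) * Q l ≤ ENNReal.ofReal (96 * (K * M))) :
    ENNReal.ofReal (regretFrom D P proto greedy γ E h ω₀ T L 1 fun _ _ _ => 0) ≤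
      ENNReal.ofReal (M * E 1) +
        ∑ l ∈ Finset.Icc 2 L, ENNReal.ofReal (260 * (K * M * E l / γ l)) := by
  rcases L with - | k
  · simp [regretFrom]
  · have h1 : 1 ∈ Finset.Icc 1 (k + 1) := Finset.mem_Icc.2 (by omega)
    obtain ⟨U, s, hs, hUs, hk⟩ := exists_ofReal_regretFrom_le (T := T) hm hgr hf hγ hmono hQ hγQ k 2
      le_rfl (by omega)
    refine (ofReal_regretFrom_succ_le_of_excess hm hgr hf hγ0 (hγ 1 h1) (hQ 1 h1) (hγQ 1 h1)
      (fun _ _ => measurable_const) (B := fun _ _ => 0) (fun _ => measurable_const)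
      (fun _ _ => le_rfl) (g := 0) (fun _ => (hγ 1 h1).le) (fun m x a => ?_) hs hk).trans ?_
    · have := inv_igw_le hgr hγ0 (fun _ => 0) a
      simpa using this
    · refine add_le_add ?_ ?_
      · have h2 : ∀ m, ∫⁻ x, ENNReal.ofReal (∑ a, igw greedy (γ 1) (fun _ => 0) a *
            gap D greedy m x a) ∂(contextLaw D m) ≤ 1 := by
          intro m
          refine (lintegral_mono (g := fun _ => 1) fun x => ?_).trans_eq (by simp)
          rw [ENNReal.ofReal_le_one]
          refine (Finset.sum_le_sum (g := fun a => igw greedy (γ 1) (fun _ => 0) a)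
            fun a _ => ?_).trans_eq (sum_igw _ _)
          have h3 := (igw_pos hgr hγ0 (fun _ => 0) a).le
          have h4 : gap D greedy m x a ≤ 1 := by
            have h5 := (meanReward_mem_Icc (D := D) m x a).1
            have h6 := (meanReward_mem_Icc (D := D) m x (greedy (meanReward D m x))).2
            unfold gap
            linarith
          exact mul_le_of_le_one_right h3 h4
        refine (mul_le_mul_right (Finset.sum_le_sum fun m _ => h2 m) _).trans_eq ?_
        rw [Finset.sum_const, Finset.card_univ, Fintype.card_fin, nsmul_eq_mul, mul_one,
          ← Nat.cast_mul, mul_comm, ← ENNReal.ofReal_natCast, Nat.cast_mul]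
      · have h2 : meanExcess D (fun _ _ => 0) = 0 := by simp [meanExcess]
        rw [h2, mul_zero, zero_add]
        have h3 : U + s * ENNReal.ofReal (97 * (K * M)) ≤
            U + s * ENNReal.ofReal (194 * (K * M)) := by
          gcongr
          norm_num
        refine h3.trans (hUs.trans_eq ?_)
        rw [← Finset.Ico_succ_right_eq_Icc, Finset.sum_Ico_eq_sum_range]
        rfl

end Epochs

lemma output_mem {M K d n : ℕ} {X : Fin M → Type*} {P : Model K d X} (hW : Convex ℝ P.W)
    {proto : Protocol} {h : Tuning} {ω₀ : Param d} {S : Dataset K n X}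
    {ξ : Fin M × ℕ × ℕ → Fin n} (hw : ∀ r, 0 ≤ h.weight r)
    (hw1 : ∑ r ∈ Finset.range (h.rounds + 1), h.weight r = 1)
    (hs : ∀ r, (serverState P proto S ξ h.ηl h.ηg h.steps ω₀ r).1 ∈ P.W) :
    output P proto h ω₀ S ξ ∈ P.W :=
  hW.sum_mem (fun r _ => hw r) hw1 fun r _ => hs r

/-- The learning rate balances exploration against the squared error guaranteed by the previous
epoch. -/
lemma ofReal_learningRate_sq_mul_le {M K : ℕ} {R μf : ℝ} (hR : 0 < R) (hμf : 0 < μf) :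
    ENNReal.ofReal (4 * √(K * μf / R) ^ 2) * ENNReal.ofReal (24 * M * R / μf) ≤
      ENNReal.ofReal (96 * (K * M)) := by
  rw [Real.sq_sqrt (by positivity), ← ENNReal.ofReal_mul (by positivity)]
  apply ENNReal.ofReal_le_ofReal
  apply le_of_eq
  field_simp
  ring

lemma div_sqrt_eq {K R μf : ℝ} (hK : 0 < K) (hR : 0 < R) (hμf : 0 < μf) :
    K / √(K * μf / R) = √(K * R / μf) := by
  rw [div_eq_iff (by positivity), ← Real.sqrt_mul (by positivity)]
  rw [show K * R / μf * (K * μf / R) = K * K by field_simp, Real.sqrt_mul_self hK.le]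

end FedIGW

theorem mainTheorem5 :
    ∃ C : ℝ, 0 < C ∧
    ∀ (M K d : ℕ) (_ : 0 < M) (_ : 0 < d)
      (X : Fin M → Type*) [∀ m, MeasurableSpace (X m)]
      -- the environment, in a class of possible environments
      (𝓔 : Set (FedIGW.Env K X)) (D : FedIGW.Env K X) (_ : D ∈ 𝓔)
      -- the function class and the losses
      (P : FedIGW.Model K d X) (_ : Convex ℝ P.W)
      (_ : ∀ m a, Measurable fun q : FedIGW.Param d × X m => P.f q.1 m q.2 a)
      (_ : ∀ m, Measurable fun q : ℝ × ℝ => P.loss m q.1 q.2)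
      (_ : ∀ m z, Differentiable ℝ (FedIGW.sampleLoss P m z))
      (_ : ∀ m, ∀ ω ∈ P.W, ∀ a, Integrable
        (fun q : X m × (Fin K → unitInterval) => P.loss m (P.f ω m q.1 a) (q.2 a))
        (D m : Measure (X m × (Fin K → unitInterval))))
      -- strong convexity of the losses in the first coordinate
      (μf : ℝ) (_ : 0 < μf)
      (_ : ∀ m, ∀ r : unitInterval, StrongConvexOn Set.univ μf fun y => P.loss m y r)
      -- realizability, and optimality of the true rewards for the losses
      (ωstar : FedIGW.Param d) (_ : ωstar ∈ P.W)
      (_ : ∀ m, ∀ᵐ x ∂(FedIGW.contextLaw D m), ∀ a,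
        P.f ωstar m x a = FedIGW.meanReward D m x a)
      (_ : ∀ m, ∀ᵐ x ∂(FedIGW.contextLaw D m), ∀ a, ∀ y : ℝ,
        Integrable (fun r : Fin K → unitInterval => P.loss m y (r a)) (FedIGW.rewardLaw D m x) ∧
        ∫ r, P.loss m (P.f ωstar m x a) (r a) ∂(FedIGW.rewardLaw D m x) ≤
          ∫ r, P.loss m y (r a) ∂(FedIGW.rewardLaw D m x))
      -- measurable choice of a maximizing action
      (greedy : (Fin K → ℝ) → Fin K) (_ : Measurable greedy)
      (_ : ∀ (v : Fin K → ℝ) (a : Fin K), v a ≤ v (greedy v))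
      -- horizon, epoch lengths, Rademacher complexities, learning rates
      (T : ℕ) (E : ℕ → ℕ+)
      (_ : ∀ l ∈ Finset.Icc 1 (FedIGW.numEpochs E T),
        FedIGW.rademacher P 𝓔 (E l) ≠ 0 ∧ FedIGW.rademacher P 𝓔 (E l) ≠ ⊤)
      (_ : MonotoneOn (FedIGW.learningRate P 𝓔 μf E) (Set.Icc 2 (FedIGW.numEpochs E T)))
      -- the federated learning problems
      (proto : FedIGW.Protocol) (κ : ℕ → ℕ) (_ : ∀ l, 0 < κ l)
      (ω₀ : FedIGW.Param d) (μ β σ G Δ : ℝ) (_ : 0 < μ) (_ : 0 < β) (_ : 0 ≤ σ) (_ : 0 ≤ G)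
      (_ : ∀ l ∈ Finset.Icc 1 (FedIGW.numEpochs E T), FedIGW.IsRegular P (E l) μ β σ)
      (_ : proto = FedIGW.Protocol.fedAvg →
        ∀ l ∈ Finset.Icc 1 (FedIGW.numEpochs E T), FedIGW.HasBoundedDissimilarity P (E l) G)
      (_ : ∀ l ∈ Finset.Icc 1 (FedIGW.numEpochs E T), ∀ S : FedIGW.Dataset K (E l) X, ∀ ω,
        FedIGW.IsEmpiricalOptimum P S ω → FedIGW.initDistSq P proto β ω₀ S ω ≤ Δ ^ 2)
      (_ : ∀ l ∈ Finset.Icc 1 (FedIGW.numEpochs E T), ∀ ηl ηg : ℝ, 0 < ηl → 1 ≤ ηg →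
        C * β * κ l * ηg * ηl ≤ 1 → FedIGW.StaysIn P proto (E l) (κ l) ηl ηg ω₀),
    -- a tuning of the protocol for each epoch
    ∃ h : ℕ → FedIGW.Tuning,
      (∀ l, (h l).steps = κ l ∧ 0 < (h l).ηl ∧ 1 ≤ (h l).ηg ∧
        C * β * κ l * (h l).ηg * (h l).ηl ≤ 1 ∧ (∀ r, 0 ≤ (h l).weight r) ∧
        ∑ r ∈ Finset.range ((h l).rounds + 1), (h l).weight r = 1) ∧
      FedIGW.regret D P proto greedy (FedIGW.learningRate P 𝓔 μf E) E h ω₀ T ≤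
        C * (M * E 1 + ∑ l ∈ Finset.Icc 2 (FedIGW.numEpochs E T),
          √(K * (FedIGW.rademacher P 𝓔 (E (l - 1))).toReal / μf) * M * E l) ∧
      ((∑ l ∈ Finset.Icc 1 (FedIGW.numEpochs E T), (h l).rounds : ℕ) : ℝ) ≤
        C * ∑ l ∈ Finset.Icc 1 (FedIGW.numEpochs E T),
          FedIGW.roundsOrder proto μ β σ G (FedIGW.rademacher P 𝓔 (E l)).toReal (κ l) M *
            Real.log (2 + μ * Δ ^ 2 / (FedIGW.rademacher P 𝓔 (E l)).toReal) := by 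
  refine ⟨1000, by norm_num, ?_⟩
  intro M K d hM hd X _ 𝓔 D hD P hW hf hloss hdiff hi μf hμf hsc ωs hωs hreal hopt greedy hm hgr T E hR
    hmono proto κ hκ ω₀ μ β σ G Δ hμ hβ _ _ hreg hG hΔ hstay
  have hKpos : 0 < K := Fin.pos (greedy 0)
  have hX : ∀ m, Nonempty (X m) := fun m =>
    (nonempty_of_isProbabilityMeasure
      (D m : Measure (X m × (Fin K → unitInterval)))).map Prod.fst
  have : Nonempty (Fin K) := ⟨⟨0, hKpos⟩⟩
  have hne : ∀ n, NeZero ((E n : ℕ)) := fun n => ⟨(E n).ne_zero⟩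
  set L := FedIGW.numEpochs E T with hL
  set R : ℕ → ℝ := fun l => (FedIGW.rademacher P 𝓔 (E l)).toReal with hRdef
  have hRpos : ∀ l ∈ Finset.Icc 1 L, 0 < R l := fun l hl =>
    ENNReal.toReal_pos (hR l hl).1 (hR l hl).2
  -- outside the epochs that are played, any admissible tuning will do
  have htun : ∀ l, ∃ t : FedIGW.Tuning,
      (t.steps = κ l ∧ 0 < t.ηl ∧ 1 ≤ t.ηg ∧ 1000 * β * κ l * t.ηg * t.ηl ≤ 1 ∧
        (∀ r, 0 ≤ t.weight r) ∧ ∑ r ∈ Finset.range (t.rounds + 1), t.weight r = 1) ∧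
      (l ∈ Finset.Icc 1 L →
        (t.rounds : ℝ) ≤ 1000 * (FedIGW.roundsOrder proto μ β σ G (R l) (κ l) M *
          Real.log (2 + μ * Δ ^ 2 / R l)) ∧
        (∀ (S : FedIGW.Dataset K (E l) X) ξ, FedIGW.output P proto t ω₀ S ξ ∈ P.W) ∧
        ∀ S : FedIGW.Dataset K (E l) X, ∃ xs, FedIGW.IsEmpiricalOptimum P S xs ∧
          ∫⁻ ξ, ENNReal.ofReal (FedIGW.globalLoss P S (FedIGW.output P proto t ω₀ S ξ) -
            FedIGW.globalLoss P S xs) ∂(FedIGW.seedLaw M (E l)) ≤ ENNReal.ofReal (4 * R l)) := by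
    intro l
    have hκl : (0 : ℝ) < κ l := by exact_mod_cast hκ l
    by_cases hlL : l ∈ Finset.Icc 1 L
    · obtain ⟨t, ht, hrounds, hmem, hgap⟩ := FedIGW.exists_tuning (C := 1000) hdiff hM hd (hκ l)
        hμ hβ (by norm_num) (hRpos l hlL) (hreg l hlL) (fun e => hG e l hlL) (hΔ l hlL)
        (hstay l hlL)
      refine ⟨t, ht, fun _ => ⟨hrounds, fun S ξ => ?_, hgap⟩⟩
      exact FedIGW.output_mem hW ht.2.2.2.2.1 ht.2.2.2.2.2 (ht.1 ▸ hmem S ξ)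
    · refine ⟨⟨1 / (1000 * β * κ l), 1, 0, κ l, fun _ => 1⟩,
        ⟨rfl, by positivity, le_rfl, ?_, fun _ => zero_le_one, by simp⟩, fun h => absurd h hlL⟩
      rw [mul_one, mul_one_div_cancel (by positivity)]
  choose h hadm hplayed using htun
  refine ⟨h, hadm, ?_, ?_⟩
  · have hγ : ∀ l ∈ Finset.Icc 1 L, 0 < FedIGW.learningRate P 𝓔 μf E (l + 1) := by
      intro l hl
      have h1 := hRpos l hl
      have h2 : (0 : ℝ) < K := by exact_mod_cast hKpos
      exact Real.sqrt_pos.2 (div_pos (mul_pos h2 hμf) h1)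
    have hmain := FedIGW.ofReal_regretFrom_one_le (T := T) (h := h) (proto := proto) (ω₀ := ω₀)
      (D := D) (E := E) (γ := FedIGW.learningRate P 𝓔 μf E) (L := L)
      (Q := fun l => ENNReal.ofReal (24 * M * R l / μf)) hm hgr hf (Real.sqrt_nonneg _) hγ hmono
      (fun l hl p hp => FedIGW.lintegral_sqError_output_le hD hM hf hloss hdiff hi hμf hsc hωs hreal
        hopt (hR l hl).2 (hplayed l hl).2.1 (hplayed l hl).2.2 hp)
      (fun l hl => FedIGW.ofReal_learningRate_sq_mul_le (hRpos l hl) hμf)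
    have hterm : ∀ l ∈ Finset.Icc 2 L,
        260 * (K * M * E l / FedIGW.learningRate P 𝓔 μf E l) =
          260 * (√(K * R (l - 1) / μf) * M * E l) := by
      intro l hl
      rw [Finset.mem_Icc] at hl
      rw [← FedIGW.div_sqrt_eq (by exact_mod_cast hKpos)
        (hRpos (l - 1) (Finset.mem_Icc.2 (by omega))) hμf]
      simp only [FedIGW.learningRate, hRdef]
      ring
    rw [Finset.sum_congr rfl fun l hl => by rw [hterm l hl],
      ← ENNReal.ofReal_sum_of_nonneg fun l _ => by positivity,
      ← ENNReal.ofReal_add (by positivity) (Finset.sum_nonneg fun l _ => by positivity),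
      ENNReal.ofReal_le_ofReal_iff
        (add_nonneg (by positivity) (Finset.sum_nonneg fun l _ => by positivity)),
      ← Finset.mul_sum] at hmain
    refine hmain.trans ?_
    have h1 : (0 : ℝ) ≤ M * E 1 := by positivity
    have h2 : 0 ≤ ∑ l ∈ Finset.Icc 2 L, √(K * R (l - 1) / μf) * M * E l :=
      Finset.sum_nonneg fun l _ => by positivity
    linarith
  · push_cast
    rw [Finset.mul_sum]
    exact Finset.sum_le_sum fun l hl => (hplayed l hl).1
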